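/- Let $V$ be a finite-dimensional complex Hermitian (positive definite) vector space and let $W\subset U(V)$ be a finite group generated by reflections (elements whose fixed space is a hyperplane) and acting irreducibly on $V\neq 0$. For a finite set $\mathcal A$ of linear hyperplanes of a Hermitian space $V$, let $X(\mathcal A)=V\setminus\bigcup_{H\in\mathcal A}H$, and let $\mathcal C(\mathcal A)$ be the set of all sums of lines $H^\perp$, $H\in\mathcal A$ (including $0$). A decomposition of $U\in\mathcal C(\mathcal A)$ is a family of $k>1$ nonzero subspaces $U_1,\dots,U_k\in\mathcal C(\mathcal A)$ with $U=\bigoplus_i U_i$ such that, for every $B\in\mathcal C(\mathcal A)$ with $B\subset U$, all $B\cap U_i$ lie in $\mathcal C(\mathcal A)$ and $B=\bigoplus_i (B\cap U_i)$. Let $\mathcal F(\mathcal A)$ be the set of irreducible subspaces, i.e. of nonzero elements of $\mathcal C(\mathcal A)$ that have no decomposition. The minimal wonderful model $\overline X(\mathcal A)$ is the closure of the image of the embedding $$X(\mathcal A)\to V\times\prod_{D\in\mathcal F(\mathcal A)}\mathbb P(V/D^\perp),\qquad v\mapsto (v,([v])_D).$$ For $F\in\mathcal F(\mathcal A)$ let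 $\mathcal D_F$ be the irreducible component of the boundary $\overline X(\mathcal A)\setminus X(\mathcal A)$ whose projection to $V$ is $F^\perp$. The inertia class $z_F$ around $\mathcal D_F$ is the set of elements of $\pi_1(X(\mathcal A),x_0)$ represented by a path in $X(\mathcal A)$ from $x_0$ to a point of a circle around the centre of a holomorphic disc in $\overline X(\mathcal A)$ that meets the boundary only in its centre, at a point of $\mathcal D_F$ lying on no other component and transversally to $\mathcal D_F$, followed by this circle run once counterclockwise and by the path run backwards. Let $\mathcal A_W$ be the set of reflecting hyperplanes of $W$, $X(W)=X(\mathcal A_W)$, $\mathcal F_W=\mathcal F(\mathcal A_W)$, $P(W)=\pi_1(X(W))$. For $A\in\mathcal F_W$ let $W_A=\{w\in W : w \text{ fixes } A^\perp \text{ pointwise}\}$, which acts on $A$; let $\mathcal A_{W_A}$ be the set of hyperplanes of $A$ that are fixed by reflections in $W_A$, $X(W_A)\subset A$ the complement of $\mathcal A_{W_A}$, and $P(W_A)=\pi_1(X(W_A))$. Let $x\in A^\perp$ and $\varepsilon>0$ be such that the open ball of radius $\varepsilon$ around $x$ meets no hyperplane of $\mathcal A_W$ that does not contain $A^\perp$,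 and let $$i_A\colon X(W_A)\hookrightarrow X(W),\qquad i_A(a)=x+\frac{\varepsilon}{\sqrt{1+\|a\|^2}}\,a,$$ be the resulting local inclusion, which identifies $X(W_A)$ with $\{x+a\in X(W) : a\in A,\ \|a\|<\varepsilon\}$. **Theorem.** For every base point $a_0\in X(W_A)$, the homomorphism $$(i_A)_*\colon P(W_A)=\pi_1(X(W_A),a_0)\to P(W)=\pi_1(X(W),i_A(a_0))$$ is injective. Moreover the inertia class around the divisor $\mathcal D_{A,W_A}$ of $\overline X(W_A)$ attached to the whole space $A$ consists of a single element $z_{W_A}\in P(W_A)$, and the inertia class $z_A$ around the divisor $\mathcal D_A$ of $\overline X(W)$ is the conjugacy class of $(i_A)_*(z_{W_A})$ in $P(W)$. -/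

import Mathlib

namespace ReflArr

noncomputable section

open Metric

/-! ### Hyperplane arrangements, sums of dual lines, irreducible subspaces -/

section Arrangement

variable {V : Type*} [NormedAddCommGroup V] [InnerProductSpace ℂ V]

/-- The complement `X(𝒜)` in `V` of a central hyperplane arrangement `𝒜`. -/
def complement (𝒜 : Set (Submodule ℂ V)) : Set V :=
  {v | ∀ H ∈ 𝒜, v ∉ H}

/-- The closure `𝒞(𝒜)` under sums of the set of dual lines `Hᗮ`, `H ∈ 𝒜`
(the zero subspace is the empty sum). -/
def sumClosure (𝒜 : Set (Submodule ℂ V)) : Set (Submodule ℂ V) :=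
  {U | ∃ S ⊆ 𝒜, U = ⨆ H ∈ S, Hᗮ}

/-- `{u 0, …, u (k - 1)}`, with `k > 1`, is a decomposition of `U` in `𝒞(𝒜)`. -/
structure IsDecomposition (𝒜 : Set (Submodule ℂ V)) (U : Submodule ℂ V) {k : ℕ}
    (u : Fin k → Submodule ℂ V) : Prop where
  one_lt : 1 < k
  mem : ∀ i, u i ∈ sumClosure 𝒜
  ne_bot : ∀ i, u i ≠ ⊥
  indep : iSupIndep u
  iSup_eq : ⨆ i, u i = U
  inf_mem : ∀ B ∈ sumClosure 𝒜, B ≤ U → ∀ i, B ⊓ u i ∈ sumClosure 𝒜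
  iSup_inf_eq : ∀ B ∈ sumClosure 𝒜, B ≤ U → ⨆ i, B ⊓ u i = B

/-- The set `ℱ(𝒜)` of irreducible subspaces: the nonzero members of `𝒞(𝒜)` that admit no
decomposition. -/
def irreducibles (𝒜 : Set (Submodule ℂ V)) : Set (Submodule ℂ V) :=
  {F | F ∈ sumClosure 𝒜 ∧ F ≠ ⊥ ∧
    ∀ (k : ℕ) (u : Fin k → Submodule ℂ V), ¬ IsDecomposition 𝒜 F u}

theorem notMem_orthogonal [FiniteDimensional ℂ V] {𝒜 : Set (Submodule ℂ V)} {v : V}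
    (hv : v ∈ complement 𝒜) {D : Submodule ℂ V} (hD : D ∈ irreducibles 𝒜) : v ∉ Dᗮ := by
  obtain ⟨⟨S, hS, rfl⟩, hne, -⟩ := hD
  intro hmem
  obtain ⟨H, hH⟩ : S.Nonempty := by
    by_contra h
    rw [Set.not_nonempty_iff_eq_empty] at h
    exact hne (by simp [h])
  have h1 : v ∈ Hᗮᗮ :=
    Submodule.orthogonal_le (le_iSup₂_of_le (f := fun K (_ : K ∈ S) => Kᗮ) H hH le_rfl) hmem
  rw [Submodule.orthogonal_orthogonal] at h1
  exact hv H (hS hH) h1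

end Arrangement

/-! ### The minimal wonderful model -/

/-- The classical (quotient) topology on a projective space. -/
instance projectivizationTopology (E : Type*) [AddCommGroup E] [Module ℂ E] [TopologicalSpace E] :
    TopologicalSpace (Projectivization ℂ E) :=
  TopologicalSpace.coinduced (Projectivization.mk' ℂ) inferInstance

section Model

variable {V : Type*} [NormedAddCommGroup V] [InnerProductSpace ℂ V]

/-- The product `V × ∏_{D ∈ ℱ(𝒜)} ℙ(V / Dᗮ)`, with the product of the classical topologies. -/
abbrev Ambient (𝒜 : Set (Submodule ℂ V)) : Type _ :=
  V × ((D : irreducibles 𝒜) → Projectivization ℂ (V ⧸ (D : Submodule ℂ V)ᗮ))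

/-- The vector space `V × ∏_{D ∈ ℱ(𝒜)} V / Dᗮ`. -/
abbrev CoordSpace (𝒜 : Set (Submodule ℂ V)) : Type _ :=
  V × ((D : irreducibles 𝒜) → V ⧸ (D : Submodule ℂ V)ᗮ)

/-- Systems of homogeneous coordinates of points of `Ambient 𝒜`. -/
abbrev HomCoord (𝒜 : Set (Submodule ℂ V)) : Type _ :=
  {y : CoordSpace 𝒜 // ∀ D, y.2 D ≠ 0}

/-- The point of `Ambient 𝒜` with given homogeneous coordinates. -/
def HomCoord.toAmbient {𝒜 : Set (Submodule ℂ V)} (y : HomCoord 𝒜) : Ambient 𝒜 :=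
  (y.1.1, fun D => Projectivization.mk ℂ (y.1.2 D) (y.2 D))

/-- Polynomial functions on a complex vector space. -/
def polynomialFunctions (E : Type*) [AddCommGroup E] [Module ℂ E] : Subalgebra ℂ (E → ℂ) :=
  Algebra.adjoin ℂ (Set.range fun (φ : Module.Dual ℂ E) (x : E) => φ x)

/-- The Zariski topology on a complex vector space. -/
@[reducible]
def zariskiAffine (E : Type*) [AddCommGroup E] [Module ℂ E] : TopologicalSpace E :=
  TopologicalSpace.generateFrom {O | ∃ p ∈ polynomialFunctions E, O = {x | p x ≠ 0}}

/-- The Zariski topology on `V × ∏_{D ∈ ℱ(𝒜)} ℙ(V / Dᗮ)`: the quotient of the Zariski topology on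
the homogeneous coordinates. -/
@[reducible]
def zariski (𝒜 : Set (Submodule ℂ V)) : TopologicalSpace (Ambient 𝒜) :=
  TopologicalSpace.coinduced HomCoord.toAmbient
    (TopologicalSpace.induced Subtype.val (zariskiAffine (CoordSpace 𝒜)))

variable [FiniteDimensional ℂ V]

/-- The embedding `X(𝒜) → V × ∏_{D ∈ ℱ(𝒜)} ℙ(V / Dᗮ)`. -/
def embed (𝒜 : Set (Submodule ℂ V)) (v : complement 𝒜) : Ambient 𝒜 :=
  (v, fun D => Projectivization.mk ℂ (Submodule.Quotient.mk (v : V)) (by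
    rw [Ne, Submodule.Quotient.mk_eq_zero]
    exact notMem_orthogonal v.2 D.2))

/-- The minimal wonderful model. -/
def wonderfulModel (𝒜 : Set (Submodule ℂ V)) : Set (Ambient 𝒜) :=
  closure (Set.range (embed 𝒜))

/-- The boundary (divisor at infinity) of the minimal wonderful model. -/
def boundary (𝒜 : Set (Submodule ℂ V)) : Set (Ambient 𝒜) :=
  wonderfulModel 𝒜 \ Set.range (embed 𝒜)

/-- `Z` is an irreducible component of the boundary. -/
def IsBoundaryComponent (𝒜 : Set (Submodule ℂ V)) (Z : Set (Ambient 𝒜)) : Prop :=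
  Maximal (fun Y => Y ⊆ boundary 𝒜 ∧ @IsIrreducible _ (zariski 𝒜) Y) Z

/-- `Z` is the component `𝒟_F` of the boundary: the one whose image in `V` is `Fᗮ`. -/
def IsDivisorOf (𝒜 : Set (Submodule ℂ V)) (F : Submodule ℂ V) (Z : Set (Ambient 𝒜)) : Prop :=
  IsBoundaryComponent 𝒜 Z ∧ Prod.fst '' Z = (Fᗮ : Set V)

/-! ### Inertia -/

/-- The holomorphic disc `s ↦ [Φ s]`, `|s| < 1`, in the wonderful model, given by a holomorphic
lift `Φ` to homogeneous coordinates, meets the boundary exactly at `s = 0`, in a point that lies on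
the component `Z` and on no other component, and it is transversal to `Z` there (its velocity is not
annihilated by the differentials of all functions vanishing on `Z`). -/
structure IsTransversalDisc (𝒜 : Set (Submodule ℂ V)) (Z : Set (Ambient 𝒜))
    (Φ : ℂ → HomCoord 𝒜) : Prop where
  holomorphic_fst : DifferentiableOn ℂ (fun s => (Φ s).1.1) (ball 0 1)
  holomorphic_snd : ∀ D, DifferentiableOn ℂ (fun s => (Φ s).1.2 D) (ball 0 1)
  center_mem : (Φ 0).toAmbient ∈ Z
  center_notMem : ∀ Z', IsBoundaryComponent 𝒜 Z' → Z' ≠ Z → (Φ 0).toAmbient ∉ Z'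
  punctured : ∀ s ∈ ball (0 : ℂ) 1, s ≠ 0 → (Φ s).toAmbient ∈ Set.range (embed 𝒜)
  transversal : ∃ p ∈ polynomialFunctions (CoordSpace 𝒜),
    (∀ y : HomCoord 𝒜, y.toAmbient ∈ Z → p y.1 = 0) ∧ deriv (fun s => p (Φ s).1) 0 ≠ 0

/-- The inertia class around `𝒟_F` in `π₁(X(𝒜), x₀)`: the classes of the loops that follow a path
`γ` from `x₀` to a point close to `𝒟_F`, run once counterclockwise around `𝒟_F` along the circle
`|s| = 1/2` of a disc transversal to `𝒟_F`, and return along `γ`. -/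
def inertiaClass (𝒜 : Set (Submodule ℂ V)) (F : Submodule ℂ V) (x₀ : complement 𝒜) :
    Set (FundamentalGroup (complement 𝒜) x₀) :=
  {g | ∃ Z, IsDivisorOf 𝒜 F Z ∧ ∃ Φ, IsTransversalDisc 𝒜 Z Φ ∧
    ∃ (y : complement 𝒜) (γ : Path x₀ y) (ℓ : Path y y),
      (∀ t : unitInterval,
        (ℓ t : V) = (Φ (Complex.exp (2 * Real.pi * Complex.I * (t : ℝ)) / 2)).1.1) ∧
      g = FundamentalGroup.fromPath (Path.Homotopic.Quotient.mk (γ.trans (ℓ.trans γ.symm)))}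

end Model

/-! ### Complex reflection groups and parabolic subgroups -/

section Groups

variable {V : Type*} [NormedAddCommGroup V] [InnerProductSpace ℂ V]

/-- The subspace of vectors fixed by `w`. -/
def fixedSpace (w : V ≃ₗᵢ[ℂ] V) : Submodule ℂ V where
  carrier := {v | w v = v}
  add_mem' {a b} ha hb := by
    simp only [Set.mem_ofPred_eq] at *
    rw [map_add, ha, hb]
  zero_mem' := by simp
  smul_mem' c a ha := by
    simp only [Set.mem_ofPred_eq] at *
    rw [map_smul, ha]

/-- A (complex) reflection: a transformation whose fixed space is a hyperplane. -/
def IsReflection (w : V ≃ₗᵢ[ℂ] V) : Prop :=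
  Module.finrank ℂ (fixedSpace w) + 1 = Module.finrank ℂ V

/-- `W` is an irreducible finite complex reflection group, acting unitarily on `V`. -/
structure IsIrreducibleReflectionGroup (W : Subgroup (V ≃ₗᵢ[ℂ] V)) : Prop where
  finite : Finite W
  generated : Subgroup.closure {s | s ∈ W ∧ IsReflection s} = W
  nontrivial : Nontrivial V
  irreducible : ∀ U : Submodule ℂ V, (∀ w ∈ W, ∀ u ∈ U, w u ∈ U) → U = ⊥ ∨ U = ⊤

/-- The arrangement `𝒜_W` of the reflecting hyperplanes of `W`. -/
def arrangement (W : Subgroup (V ≃ₗᵢ[ℂ] V)) : Set (Submodule ℂ V) :=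
  {H | ∃ s ∈ W, IsReflection s ∧ H = fixedSpace s}

/-- The group `W_A = {w ∈ W | w fixes Aᗮ pointwise}`, acting on `V`. -/
def parabolic (W : Subgroup (V ≃ₗᵢ[ℂ] V)) (A : Submodule ℂ V) : Subgroup (V ≃ₗᵢ[ℂ] V) where
  carrier := {w | w ∈ W ∧ ∀ v ∈ Aᗮ, w v = v}
  mul_mem' {a b} ha hb := ⟨W.mul_mem ha.1 hb.1, fun v hv => by
    change a (b v) = v
    rw [hb.2 v hv, ha.2 v hv]⟩
  one_mem' := ⟨W.one_mem, fun v _ => rfl⟩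
  inv_mem' {a} ha := ⟨W.inv_mem ha.1, fun v hv => by
    have h : a v = v := ha.2 v hv
    conv_lhs => rw [← h]
    exact a.symm_apply_apply v⟩

/-- The group `W_A` acting on `A`. -/
def parabolicOn (W : Subgroup (V ≃ₗᵢ[ℂ] V)) (A : Submodule ℂ V) : Subgroup (A ≃ₗᵢ[ℂ] A) where
  carrier := {g | ∃ w ∈ parabolic W A, ∀ a : A, ((g a : A) : V) = w a}
  mul_mem' := by
    rintro g g' ⟨w, hw, h⟩ ⟨w', hw', h'⟩
    exact ⟨w * w', mul_mem hw hw', fun a => by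
      change ((g (g' a) : A) : V) = w (w' a)
      rw [h, h']⟩
  one_mem' := ⟨1, one_mem _, fun a => rfl⟩
  inv_mem' := by
    rintro g ⟨w, hw, h⟩
    refine ⟨w⁻¹, inv_mem hw, fun a => ?_⟩
    have h1 := h (g⁻¹ a)
    have h2 : g (g⁻¹ a) = a := g.apply_symm_apply a
    rw [h2] at h1
    rw [h1]
    exact (w.symm_apply_apply _).symm

/-! ### The local inclusion -/

/-- `x` is a point of `Aᗮ` on no hyperplane of `𝒜_W` but those containing `Aᗮ`, and the hyperplanes
not containing `Aᗮ` do not meet the ball of radius `ε` around `x`. -/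
structure IsTubePoint (W : Subgroup (V ≃ₗᵢ[ℂ] V)) (A : Submodule ℂ V) (x : V) (ε : ℝ) : Prop where
  mem : x ∈ Aᗮ
  pos : 0 < ε
  disjoint : ∀ H ∈ arrangement W, ¬ Aᗮ ≤ H → Disjoint (ball x ε) (H : Set V)

variable [FiniteDimensional ℂ V]

/-- A reflection in `W` whose hyperplane contains `Aᗮ` restricts to a reflection in `W_A`. -/
theorem exists_restriction {W : Subgroup (V ≃ₗᵢ[ℂ] V)} {A : Submodule ℂ V} {s : V ≃ₗᵢ[ℂ] V}
    (hs : s ∈ W) (hr : IsReflection s) (hA : Aᗮ ≤ fixedSpace s) :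
    ∃ g ∈ parabolicOn W A, IsReflection g ∧
      fixedSpace g = (fixedSpace s).comap A.subtype := by
  have hfix : ∀ v ∈ Aᗮ, s v = v := fun v hv => hA hv
  have hstab : ∀ a ∈ A, s a ∈ A := by
    intro a ha
    rw [← Submodule.orthogonal_orthogonal A, Submodule.mem_orthogonal]
    intro v hv
    rw [← hfix v hv, s.inner_map_map]
    exact Submodule.inner_left_of_mem_orthogonal ha hv
  let f : A →ₗ[ℂ] A := (s.toLinearEquiv : V →ₗ[ℂ] V).restrict hstab
  let fi : A →ₗᵢ[ℂ] A := ⟨f, fun a => s.norm_map a⟩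
  let g : A ≃ₗᵢ[ℂ] A := fi.toLinearIsometryEquiv rfl
  have hg : ∀ a : A, ((g a : A) : V) = s a := fun a => rfl
  have hfg : fixedSpace g = (fixedSpace s).comap A.subtype := by
    ext a
    constructor
    · intro h
      have h' : g a = a := h
      change s (a : V) = a
      rw [← hg, h']
    · intro h
      have h' : s (a : V) = a := h
      change g a = a
      exact Subtype.ext (by rw [hg, h'])
  refine ⟨g, ⟨s, ⟨hs, hfix⟩, hg⟩, ?_, hfg⟩
  unfold IsReflection at *
  rw [hfg]
  have h1 : A ⊔ fixedSpace s = ⊤ := by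
    refine top_le_iff.mp ?_
    rw [← Submodule.sup_orthogonal_of_hasOrthogonalProjection (K := A)]
    exact sup_le_sup_left hA A
  have h2 := Submodule.finrank_sup_add_finrank_inf_eq A (fixedSpace s)
  rw [h1, finrank_top] at h2
  have h3 : Module.finrank ℂ ((fixedSpace s).comap A.subtype)
      = Module.finrank ℂ (A ⊓ fixedSpace s : Submodule ℂ V) := by
    rw [← Submodule.map_comap_subtype A (fixedSpace s)]
    exact (LinearEquiv.finrank_eq
      (Submodule.equivMapOfInjective A.subtype A.injective_subtype _))
  omega

theorem localInclusion_mem {W : Subgroup (V ≃ₗᵢ[ℂ] V)} {A : Submodule ℂ V} {x : V} {ε : ℝ}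
    (h : IsTubePoint W A x ε) (a : complement (arrangement (parabolicOn W A))) :
    x + ((ε / Real.sqrt (1 + ‖(a : A)‖ ^ 2) : ℝ) : ℂ) • ((a : A) : V)
      ∈ complement (arrangement W) := by
  have hq : 0 < Real.sqrt (1 + ‖(a : A)‖ ^ 2) := Real.sqrt_pos.mpr (by positivity)
  have hc : 0 < ε / Real.sqrt (1 + ‖(a : A)‖ ^ 2) := div_pos h.pos hq
  intro H hH hmem
  by_cases hAH : Aᗮ ≤ H
  · obtain ⟨s, hs, hr, rfl⟩ := hH
    obtain ⟨g, hg, hgr, hgf⟩ := exists_restriction hs hr hAH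
    refine a.2 _ ⟨g, hg, hgr, rfl⟩ ?_
    rw [hgf]
    change ((a : A) : V) ∈ fixedSpace s
    rw [Submodule.add_mem_iff_right _ (hAH h.mem)] at hmem
    exact (Submodule.smul_mem_iff _ (by exact_mod_cast hc.ne')).mp hmem
  · refine Set.disjoint_left.mp (h.disjoint H hH hAH) ?_ hmem
    rw [mem_ball, dist_eq_norm, add_sub_cancel_left, norm_smul, Complex.norm_real,
      Real.norm_of_nonneg hc.le, ← Submodule.coe_norm, div_mul_eq_mul_div, div_lt_iff₀ hq]
    exact mul_lt_mul_of_pos_left (Real.lt_sqrt_of_sq_lt (by linarith)) h.pos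

/-- The local inclusion `i_A : X(W_A) → X(W)` at the tube point `x`: the homeomorphism
`a ↦ x + (ε / √(1 + |a|²)) a` of `X(W_A)` onto the fibre over `x` of the orthogonal projection to
`Aᗮ` restricted to the points of `X(W)` at distance less than `ε` from `Aᗮ`. -/
def localInclusion {W : Subgroup (V ≃ₗᵢ[ℂ] V)} {A : Submodule ℂ V} {x : V} {ε : ℝ}
    (h : IsTubePoint W A x ε) :
    C(complement (arrangement (parabolicOn W A)), complement (arrangement W)) where
  toFun a := ⟨x + ((ε / Real.sqrt (1 + ‖(a : A)‖ ^ 2) : ℝ) : ℂ) • ((a : A) : V),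
    localInclusion_mem h a⟩
  continuous_toFun := by
    refine Continuous.subtype_mk ?_ _
    refine continuous_const.add (Continuous.smul ?_ (by fun_prop))
    refine Complex.continuous_ofReal.comp (continuous_const.div (by fun_prop) ?_)
    intro a
    exact (Real.sqrt_pos.mpr (by positivity)).ne'

end Groups

end

end ReflArr

/-! Injectivity. The hyperplanes of `W_A` are the traces on `A` of the hyperplanes of `W` containing
`Aᗮ`, so the orthogonal projection `V → A` maps `X(W)` to `X(W_A)`. Composed with the local
inclusion it becomes `a ↦ r(a) a` with `r(a) > 0`, which is homotopic to the identity through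
positive rescalings. Hence the map on fundamental groups has a left inverse, up to a change of base
point (`injective_map_localInclusion`).

Inertia. Write `v = q + w` with `q ∈ Fᗮ`, `w ∈ F`. The claim behind everything is that the inertia
class of `F` is the conjugacy class of the loop `q + exp(2πit) w`, for any `v` whose punctured disc
`q + s w`, `0 < |s| ≤ 1`, stays in the complement (`inertiaClass_eq_conjugatesOf`). It rests on
three facts.

The boundary components are the explicit sets `stratum 𝒜 F`, `F` irreducible
(`isBoundaryComponent_iff`). The limits of `q + t w`, `t → 0`, for generic `v` are dense in such a
set and are parametrized linearly, which gives Zariski irreducibility. Density is where reflections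
enter: two irreducible subspaces are orthogonal or have irreducible sum (`sup_irreducible_or`), so
the coordinates can be corrected one at a time.

If a disc `v(s)` is transversal to the stratum of `F` at a point on no other component, then `v(0) ∈
Fᗮ` avoids all hyperplanes not containing `Fᗮ`, and the `F`-component `u` of `v'(0)` avoids all the
others (`starProjection_deriv_notMem`). The small circle of the disc therefore deforms in the
complement to a circle of the linear disc `v(0) + s u` (`IsTransversalDisc.exists_loopConj`).

Two linear loops around the same stratum are freely homotopic, because generic vectors form a path
connected set (`IsTubeVector.loopConj`).

For `F = A` inside `A` itself the loop is `exp(2πit) a`. It is central because scalars act on the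
complement, so its conjugacy class is a single element. The local inclusion rescales by a function
of `‖a‖` only, hence carries this loop to the linear loop around the divisor of `A` in the model of
`W` (`map_localInclusion_loop`). -/

namespace ReflArr

open Metric

/-! ### Irreducible subspaces of a reflection arrangement -/

section Combinatorics

variable {V : Type*} [NormedAddCommGroup V] [InnerProductSpace ℂ V]

/-- A finite arrangement of reflecting hyperplanes that is stable under its reflections. -/
structure IsReflectionArrangement (𝒜 : Set (Submodule ℂ V)) : Prop where
  finite : 𝒜.Finite
  exists_reflection : ∀ H ∈ 𝒜, ∃ s : V ≃ₗᵢ[ℂ] V, IsReflection s ∧ H = fixedSpace s ∧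
    ∀ K ∈ 𝒜, K.map (s.toLinearEquiv : V →ₗ[ℂ] V) ∈ 𝒜

theorem mem_fixedSpace {s : V ≃ₗᵢ[ℂ] V} {v : V} : v ∈ fixedSpace s ↔ s v = v := Iff.rfl

theorem sumClosure_finite {𝒜 : Set (Submodule ℂ V)} (h : 𝒜.Finite) : (sumClosure 𝒜).Finite := by
  refine (h.finite_subsets.image fun S : Set (Submodule ℂ V) => ⨆ H ∈ S, (Hᗮ : Submodule ℂ V)).subset ?_
  rintro U ⟨S, hS, rfl⟩
  exact ⟨S, hS, rfl⟩

theorem irreducibles_finite {𝒜 : Set (Submodule ℂ V)} (h : 𝒜.Finite) : (irreducibles 𝒜).Finite :=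
  (sumClosure_finite h).subset fun _ hF => hF.1

theorem orthogonal_mem_sumClosure {𝒜 : Set (Submodule ℂ V)} {H : Submodule ℂ V} (h : H ∈ 𝒜) :
    Hᗮ ∈ sumClosure 𝒜 :=
  ⟨{H}, by simpa using h, by simp⟩

theorem sup_mem_sumClosure {𝒜 : Set (Submodule ℂ V)} {U U' : Submodule ℂ V}
    (h : U ∈ sumClosure 𝒜) (h' : U' ∈ sumClosure 𝒜) : U ⊔ U' ∈ sumClosure 𝒜 := by
  obtain ⟨S, hS, rfl⟩ := h
  obtain ⟨S', hS', rfl⟩ := h'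
  exact ⟨S ∪ S', Set.union_subset hS hS', by rw [iSup_union]⟩

theorem le_of_forall_orthogonal_le {𝒜 : Set (Submodule ℂ V)} {D F : Submodule ℂ V}
    (hD : D ∈ sumClosure 𝒜) (h : ∀ H ∈ 𝒜, Hᗮ ≤ D → Hᗮ ≤ F) : D ≤ F := by
  obtain ⟨S, hS, rfl⟩ := hD
  exact iSup₂_le fun H hH => h H (hS hH) (le_iSup₂_of_le (f := fun K (_ : K ∈ S) => Kᗮ) H hH le_rfl)

theorem exists_orthogonal_le {𝒜 : Set (Submodule ℂ V)} {D : Submodule ℂ V}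
    (hD : D ∈ irreducibles 𝒜) : ∃ H ∈ 𝒜, Hᗮ ≤ D := by
  by_contra! h
  exact hD.2.1 (le_bot_iff.mp (le_of_forall_orthogonal_le hD.1 fun H hH hle => (h H hH hle).elim))

theorem exists_orthogonal_le_not_le {𝒜 : Set (Submodule ℂ V)} {D F : Submodule ℂ V}
    (hD : D ∈ irreducibles 𝒜) (h : ¬ D ≤ F) : ∃ H ∈ 𝒜, Hᗮ ≤ D ∧ ¬ Hᗮ ≤ F := by
  by_contra! h'
  exact h (le_of_forall_orthogonal_le hD.1 h')

/-- An irreducible subspace inside a decomposed one lies in one of the summands. -/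
theorem IsDecomposition.exists_le {𝒜 : Set (Submodule ℂ V)} {U D : Submodule ℂ V} {k : ℕ}
    {u : Fin k → Submodule ℂ V} (h : IsDecomposition 𝒜 U u) (hD : D ∈ irreducibles 𝒜)
    (hDU : D ≤ U) : ∃ i, D ≤ u i := by
  classical
  -- `D` is the direct sum of its nonzero traces on the summands. Two or more of these would
  -- decompose `D`, and none would force `D = 0`.
  let I : Finset (Fin k) := Finset.univ.filter fun i => D ⊓ u i ≠ ⊥
  have hsum := h.iSup_inf_eq D hD.1 hDU
  have hI : ∀ B ≤ D, ⨆ j : I, B ⊓ u j = ⨆ i, B ⊓ u i := by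
    intro B hB
    refine le_antisymm (iSup_le fun j => le_iSup (fun i => B ⊓ u i) j.1) (iSup_le fun i => ?_)
    by_cases hi : i ∈ I
    · exact le_iSup (fun j : I => B ⊓ u j) ⟨i, hi⟩
    · have : D ⊓ u i = ⊥ := by simpa [I] using hi
      exact (inf_le_inf_right _ hB).trans (this.le.trans bot_le)
  have e := I.equivFin
  rcases Nat.lt_or_ge 1 I.card with hc | hc
  · refine (hD.2.2 I.card (fun j => D ⊓ u (e.symm j)) ⟨hc, fun j => h.inf_mem D hD.1 hDU _,
      fun j => ?_, ?_, ?_, ?_, ?_⟩).elim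
    · exact (Finset.mem_filter.mp (e.symm j).2).2
    · exact (h.indep.mono fun i => inf_le_right).comp
        (Subtype.val_injective.comp e.symm.injective)
    · rw [e.symm.iSup_comp (g := fun j : I => D ⊓ u j), hI D le_rfl, hsum]
    · intro B hB hBD j
      rw [← inf_assoc, inf_eq_left.mpr hBD]
      exact h.inf_mem B hB (hBD.trans hDU) _
    · intro B hB hBD
      simp_rw [← inf_assoc, inf_eq_left.mpr hBD]
      rw [e.symm.iSup_comp (g := fun j : I => B ⊓ u j), hI B hBD]
      exact h.iSup_inf_eq B hB (hBD.trans hDU)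
  · rcases Nat.eq_zero_or_pos I.card with h0 | h0
    · have := hI D le_rfl
      rw [hsum] at this
      have hemp : IsEmpty I := by
        rw [Finset.card_eq_zero] at h0
        rw [h0]; infer_instance
      rw [iSup_of_empty] at this
      exact (hD.2.1 this.symm).elim
    · obtain ⟨i, hi⟩ := Finset.card_eq_one.mp (le_antisymm hc h0)
      refine ⟨i, ?_⟩
      rw [← hsum, ← hI D le_rfl]
      refine iSup_le fun j => ?_
      have : j.1 = i := by simpa [hi] using j.2
      rw [this]; exact inf_le_right

theorem sub_mem_orthogonal_fixedSpace (s : V ≃ₗᵢ[ℂ] V) (v : V) : s v - v ∈ (fixedSpace s)ᗮ := by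
  rw [Submodule.mem_orthogonal]
  intro h hh
  rw [inner_sub_right]
  nth_rewrite 1 [← mem_fixedSpace.mp hh]
  rw [s.inner_map_map, sub_self]

theorem orthogonal_map (s : V ≃ₗᵢ[ℂ] V) (K : Submodule ℂ V) :
    (K.map (s.toLinearEquiv : V →ₗ[ℂ] V))ᗮ = Kᗮ.map (s.toLinearEquiv : V →ₗ[ℂ] V) := by
  ext v
  rw [Submodule.mem_orthogonal]
  constructor
  · intro h
    refine ⟨s.symm v, ?_, s.apply_symm_apply v⟩
    change s.symm v ∈ Kᗮ
    rw [Submodule.mem_orthogonal]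
    intro u hu
    rw [← s.inner_map_map, s.apply_symm_apply]
    exact h _ ⟨u, hu, rfl⟩
  · rintro ⟨w, hw, rfl⟩ _ ⟨u, hu, rfl⟩
    exact (s.inner_map_map u w).trans (hw u hu)

/-- Among the irreducible subspaces between `E` and `F` on which `v` vanishes there is a maximal
one. -/
theorem IsReflectionArrangement.exists_maximal {𝒜 : Set (Submodule ℂ V)}
    (h𝒜 : IsReflectionArrangement 𝒜) {E F : Submodule ℂ V} {v : V}
    (hE : E ∈ irreducibles 𝒜) (hEF : E ≤ F) (hv : v ∈ Eᗮ) :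
    ∃ G ∈ irreducibles 𝒜, E ≤ G ∧ G ≤ F ∧ v ∈ Gᗮ ∧
      ∀ D ∈ irreducibles 𝒜, G < D → D ≤ F → v ∉ Dᗮ := by
  have hfin : {G | G ∈ irreducibles 𝒜 ∧ E ≤ G ∧ G ≤ F ∧ v ∈ Gᗮ}.Finite :=
    (irreducibles_finite h𝒜.finite).subset fun G hG => hG.1
  obtain ⟨G, hG⟩ := hfin.exists_maximal ⟨E, hE, le_rfl, hEF, hv⟩
  refine ⟨G, hG.1.1, hG.1.2.1, hG.1.2.2.1, hG.1.2.2.2, fun D hD hGD hDF hvD => ?_⟩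
  exact hGD.not_ge (hG.2 ⟨hD, hG.1.2.1.trans hGD.le, hDF, hvD⟩ hGD.le)

variable [FiniteDimensional ℂ V]

theorem IsReflection.finrank_orthogonal {s : V ≃ₗᵢ[ℂ] V} (h : IsReflection s) :
    Module.finrank ℂ (fixedSpace s)ᗮ = 1 := by
  have := Submodule.finrank_add_finrank_orthogonal (fixedSpace s)
  unfold IsReflection at h
  omega

namespace IsReflectionArrangement

variable {𝒜 : Set (Submodule ℂ V)}

theorem finrank_orthogonal (h𝒜 : IsReflectionArrangement 𝒜) {H : Submodule ℂ V} (hH : H ∈ 𝒜) :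
    Module.finrank ℂ Hᗮ = 1 := by
  obtain ⟨s, hs, rfl, -⟩ := h𝒜.exists_reflection H hH
  exact hs.finrank_orthogonal

theorem orthogonal_ne_bot (h𝒜 : IsReflectionArrangement 𝒜) {H : Submodule ℂ V} (hH : H ∈ 𝒜) :
    Hᗮ ≠ ⊥ := by
  intro h
  have := h𝒜.finrank_orthogonal hH
  rw [h, finrank_bot] at this
  omega

/-- On a line every nonzero summand is the whole line, so two of them cannot be independent. -/
theorem orthogonal_irreducible (h𝒜 : IsReflectionArrangement 𝒜) {H : Submodule ℂ V} (hH : H ∈ 𝒜) :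
    Hᗮ ∈ irreducibles 𝒜 := by
  refine ⟨orthogonal_mem_sumClosure hH, h𝒜.orthogonal_ne_bot hH, fun k u h => ?_⟩
  have hu : ∀ i, u i = Hᗮ := by
    intro i
    have hle : u i ≤ Hᗮ := h.iSup_eq ▸ le_iSup u i
    refine Submodule.eq_of_le_of_finrank_le hle ?_
    rw [h𝒜.finrank_orthogonal hH]
    have := h.ne_bot i
    rw [← Submodule.one_le_finrank_iff] at this
    exact this
  have h0 : (⟨0, by have := h.one_lt; omega⟩ : Fin k) ≠ ⟨1, h.one_lt⟩ := by simp
  have := h.indep.pairwiseDisjoint h0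
  simp only [Function.onFun, hu, disjoint_self] at this
  exact h𝒜.orthogonal_ne_bot hH this

/-- Two irreducible subspaces are orthogonal unless their sum is irreducible. -/
theorem sup_irreducible_or (h𝒜 : IsReflectionArrangement 𝒜) {D F : Submodule ℂ V}
    (hD : D ∈ irreducibles 𝒜) (hF : F ∈ irreducibles 𝒜) :
    D ⊔ F ∈ irreducibles 𝒜 ∨ F ≤ Dᗮ := by
  by_cases hM : D ⊔ F ∈ irreducibles 𝒜
  · exact Or.inl hM
  right
  have hex : ∃ (k : ℕ) (u : Fin k → Submodule ℂ V), IsDecomposition 𝒜 (D ⊔ F) u := by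
    by_contra! hno
    exact hM ⟨sup_mem_sumClosure hD.1 hF.1, fun h => hD.2.1 (sup_eq_bot_iff.mp h).1, hno⟩
  obtain ⟨k, u, hu⟩ := hex
  obtain ⟨i, hi⟩ := hu.exists_le hD le_sup_left
  obtain ⟨j, hj⟩ := hu.exists_le hF le_sup_right
  have hij : i ≠ j := by
    rintro rfl
    have htop : D ⊔ F ≤ u i := sup_le hi hj
    obtain ⟨l, hl⟩ : ∃ l : Fin k, l ≠ i := by
      have : Nontrivial (Fin k) := Fin.nontrivial_iff_two_le.mpr hu.one_lt
      exact exists_ne i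
    have hle : u l ≤ u i := (hu.iSup_eq ▸ le_iSup u l : u l ≤ D ⊔ F).trans htop
    exact hu.ne_bot l ((hu.indep.pairwiseDisjoint hl).eq_bot_of_le hle)
  -- `D` and `F` lie in different summands `u i` and `u j`. Orthogonality is now checked on the dual
  -- lines, `Hᗮ ≤ D` against `Kᗮ ≤ F`.
  refine le_of_forall_orthogonal_le hF.1 fun K hK hKF => ?_
  rw [Submodule.le_orthogonal_iff_le_orthogonal]
  refine le_of_forall_orthogonal_le hD.1 fun H hH hHD => ?_
  rw [Submodule.le_orthogonal_iff_le_orthogonal, Submodule.orthogonal_orthogonal]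
  obtain ⟨s, hs, rfl, hperm⟩ := h𝒜.exists_reflection H hH
  have hKs := hperm K hK
  have hle : (K.map (s.toLinearEquiv : V →ₗ[ℂ] V))ᗮ ≤ D ⊔ F := by
    rw [orthogonal_map]
    rintro _ ⟨β, hβ, rfl⟩
    have : s β = (s β - β) + β := by abel
    change s β ∈ _
    rw [this]
    exact add_mem (Submodule.mem_sup_left (hHD (sub_mem_orthogonal_fixedSpace s β)))
      (Submodule.mem_sup_right (hKF hβ))
  -- The reflected dual line `s(Kᗮ)` is again irreducible, hence inside a single summand, although
  -- `s β` is the sum of `β ∈ u j` and `s β - β ∈ u i`. So one of these two terms vanishes, and `s β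
  -- = β` either way.
  obtain ⟨l, hl⟩ := hu.exists_le (h𝒜.orthogonal_irreducible hKs) hle
  intro β hβ
  rw [mem_fixedSpace]
  have hα : s β - β ∈ u i := hi (hHD (sub_mem_orthogonal_fixedSpace s β))
  have hβj : β ∈ u j := hj (hKF hβ)
  have hsβ : s β ∈ u l := hl (by rw [orthogonal_map]; exact ⟨β, hβ, rfl⟩)
  by_cases hlj : l = j
  · subst hlj
    have := (Submodule.disjoint_def.mp (hu.indep.pairwiseDisjoint hij)) _ hα (sub_mem hsβ hβj)
    exact sub_eq_zero.mp this
  · have hmem : β ∈ ⨆ m, ⨆ (_ : m ≠ j), u m := by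
      have : β = s β - (s β - β) := by abel
      rw [this]
      exact sub_mem (Submodule.mem_iSup_of_mem l (Submodule.mem_iSup_of_mem hlj hsβ))
        (Submodule.mem_iSup_of_mem i (Submodule.mem_iSup_of_mem hij hα))
    have : β = 0 := Submodule.disjoint_def.mp (hu.indep j) β hβj hmem
    simp [this]

end IsReflectionArrangement

end Combinatorics

open Filter Topology

/-! ### Homogeneous coordinates and limits in the wonderful model -/

section Coordinates

variable {V : Type*} [NormedAddCommGroup V] [InnerProductSpace ℂ V]

theorem continuous_projectivizationMk {E : Type*} [AddCommGroup E] [Module ℂ E]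
    [TopologicalSpace E] : Continuous (Projectivization.mk' ℂ : {v : E // v ≠ 0} → _) :=
  continuous_coinduced_rng

theorem surjective_projectivizationMk {E : Type*} [AddCommGroup E] [Module ℂ E] :
    Function.Surjective (Projectivization.mk' ℂ : {v : E // v ≠ 0} → _) :=
  Quotient.mk_surjective

/-- The saturation of an open set is the union of its translates by nonzero scalars. -/
theorem isOpenMap_projectivizationMk {E : Type*} [AddCommGroup E] [Module ℂ E]
    [TopologicalSpace E] [ContinuousConstSMul ℂ E] :
    IsOpenMap (Projectivization.mk' ℂ : {v : E // v ≠ 0} → _) := by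
  intro U hU
  refine isOpen_coinduced.mpr ?_
  have : Projectivization.mk' ℂ ⁻¹' (Projectivization.mk' ℂ '' U) =
      ⋃ c : ℂˣ, (fun v : {v : E // v ≠ 0} =>
        (⟨c • (v : E), (smul_ne_zero_iff_ne c).mpr v.2⟩ : {v : E // v ≠ 0})) ⁻¹' U := by
    ext v
    simp only [Set.mem_preimage, Set.mem_image, Set.mem_iUnion, Projectivization.mk'_eq_mk]
    constructor
    · rintro ⟨u, hu, he⟩
      rw [Projectivization.mk_eq_mk_iff] at he
      obtain ⟨c, hc⟩ := he
      refine ⟨c, ?_⟩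
      convert hu
    · rintro ⟨c, hc⟩
      refine ⟨_, hc, ?_⟩
      rw [Projectivization.mk_eq_mk_iff]
      exact ⟨c, rfl⟩
  rw [this]
  refine isOpen_iUnion fun c => hU.preimage ?_
  exact Continuous.subtype_mk (continuous_subtype_val.const_smul (c : ℂ)) _

theorem continuous_toAmbient (𝒜 : Set (Submodule ℂ V)) :
    Continuous (HomCoord.toAmbient : HomCoord 𝒜 → Ambient 𝒜) := by
  refine Continuous.prodMk (by fun_prop) (continuous_pi fun D => ?_)
  exact continuous_projectivizationMk.comp
    (f := fun y : HomCoord 𝒜 => (⟨y.1.2 D, y.2 D⟩ : {v : V ⧸ (D : Submodule ℂ V)ᗮ // v ≠ 0}))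
    (Continuous.subtype_mk (by fun_prop) _)

theorem toAmbient_surjective (𝒜 : Set (Submodule ℂ V)) :
    Function.Surjective (HomCoord.toAmbient : HomCoord 𝒜 → Ambient 𝒜) := by
  rintro ⟨v, ℓ⟩
  refine ⟨⟨(v, fun D => (ℓ D).rep), fun D => (ℓ D).rep_nonzero⟩, ?_⟩
  refine Prod.ext rfl (funext fun D => ?_)
  exact Projectivization.mk_rep _

theorem isOpenMap_toAmbient {𝒜 : Set (Submodule ℂ V)} (h : 𝒜.Finite) :
    IsOpenMap (HomCoord.toAmbient : HomCoord 𝒜 → Ambient 𝒜) := by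
  have : Finite (irreducibles 𝒜) := irreducibles_finite h
  let e : HomCoord 𝒜 ≃ₜ
      V × ((D : irreducibles 𝒜) → {v : V ⧸ (D : Submodule ℂ V)ᗮ // v ≠ 0}) :=
    { toFun := fun y => (y.1.1, fun D => ⟨y.1.2 D, y.2 D⟩)
      invFun := fun z => ⟨(z.1, fun D => z.2 D), fun D => (z.2 D).2⟩
      left_inv := fun y => rfl
      right_inv := fun z => rfl
      continuous_toFun := by
        refine Continuous.prodMk (by fun_prop) (continuous_pi fun D => ?_)
        exact Continuous.subtype_mk (by fun_prop) _
      continuous_invFun := by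
        refine Continuous.subtype_mk (Continuous.prodMk (by fun_prop) (continuous_pi fun D => ?_)) _
        exact continuous_subtype_val.comp ((continuous_apply D).comp continuous_snd) }
  have h2 : IsOpenMap (Prod.map id (Pi.map fun D : irreducibles 𝒜 =>
      (Projectivization.mk' ℂ : {v : V ⧸ (D : Submodule ℂ V)ᗮ // v ≠ 0} → _)) :
      V × ((D : irreducibles 𝒜) → {v : V ⧸ (D : Submodule ℂ V)ᗮ // v ≠ 0}) → Ambient 𝒜) :=
    IsOpenMap.id.prodMap (IsOpenMap.piMap (fun D => isOpenMap_projectivizationMk)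
      (Eventually.of_forall fun D => surjective_projectivizationMk))
  exact h2.comp e.isOpenMap

theorem toAmbient_eq_iff {𝒜 : Set (Submodule ℂ V)} {y z : HomCoord 𝒜} :
    y.toAmbient = z.toAmbient ↔ y.1.1 = z.1.1 ∧ ∀ D, ∃ c : ℂ, c • z.1.2 D = y.1.2 D := by
  unfold HomCoord.toAmbient
  rw [Prod.mk.injEq, funext_iff]
  simp_rw [Projectivization.mk_eq_mk_iff']

/-- Limits in the ambient space are computed on homogeneous coordinates. The approximating
coordinates only need to be nonzero eventually, so `f` takes values in the whole vector space. -/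
theorem toAmbient_mem_closure {𝒜 : Set (Submodule ℂ V)} {S : Set (Ambient 𝒜)} {y₀ : HomCoord 𝒜}
    {ι : Type*} {l : Filter ι} [l.NeBot] {f : ι → CoordSpace 𝒜} (hf : Tendsto f l (𝓝 y₀.1))
    (h : ∀ᶠ i in l, ∃ hi : ∀ D, (f i).2 D ≠ 0, HomCoord.toAmbient ⟨f i, hi⟩ ∈ S) :
    y₀.toAmbient ∈ closure S := by
  have h1 : y₀ ∈ closure (HomCoord.toAmbient ⁻¹' S) := by
    rw [closure_subtype]
    refine mem_closure_of_tendsto hf (h.mono ?_)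
    rintro i ⟨hi, hS⟩
    exact ⟨⟨f i, hi⟩, hS, rfl⟩
  exact (continuous_toAmbient 𝒜).closure_preimage_subset _ h1

theorem mem_closure_preimage {𝒜 : Set (Submodule ℂ V)} (h : 𝒜.Finite) {S : Set (Ambient 𝒜)}
    {y₀ : HomCoord 𝒜} (hy : y₀.toAmbient ∈ closure S) :
    y₀ ∈ closure (HomCoord.toAmbient ⁻¹' S) :=
  (isOpenMap_toAmbient h).preimage_closure_subset_closure_preimage hy

theorem continuous_quotientMk (D : Submodule ℂ V) :
    Continuous (Submodule.Quotient.mk : V → V ⧸ Dᗮ) := Dᗮ.mkQL.continuous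

variable [FiniteDimensional ℂ V]

/-- The injection of `V ⧸ Dᗮ` into `V` with image `D` induced by the orthogonal projection. -/
noncomputable def dualPart (D : Submodule ℂ V) : (V ⧸ Dᗮ) →L[ℂ] V :=
  Submodule.liftQL Dᗮ D.starProjection fun _ hv =>
    (Submodule.starProjection_apply_eq_zero_iff D).mpr hv

@[simp]
theorem dualPart_mk (D : Submodule ℂ V) (v : V) :
    dualPart D (Submodule.Quotient.mk v) = D.starProjection v := rfl

theorem mk_eq_mk_iff {D : Submodule ℂ V} {v w : V} :
    (Submodule.Quotient.mk v : V ⧸ Dᗮ) = Submodule.Quotient.mk w ↔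
      D.starProjection v = D.starProjection w := by
  rw [Submodule.Quotient.eq, ← Submodule.starProjection_apply_eq_zero_iff, map_sub, sub_eq_zero]

theorem mk_starProjection (D : Submodule ℂ V) (v : V) :
    (Submodule.Quotient.mk (D.starProjection v) : V ⧸ Dᗮ) = Submodule.Quotient.mk v := by
  rw [mk_eq_mk_iff]
  exact Submodule.starProjection_eq_self_iff.mpr (Submodule.starProjection_apply_mem _ _)

@[simp]
theorem mk_dualPart (D : Submodule ℂ V) (y : V ⧸ Dᗮ) :
    Submodule.Quotient.mk (dualPart D y) = y := by
  induction y using Submodule.Quotient.induction_on with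
  | _ v => rw [dualPart_mk, mk_starProjection]

theorem dualPart_mem (D : Submodule ℂ V) (y : V ⧸ Dᗮ) : dualPart D y ∈ D := by
  induction y using Submodule.Quotient.induction_on with
  | _ v => exact Submodule.starProjection_apply_mem _ _

theorem dualPart_eq_zero {D : Submodule ℂ V} {y : V ⧸ Dᗮ} : dualPart D y = 0 ↔ y = 0 := by
  constructor
  · intro h
    rw [← mk_dualPart D y, h]; rfl
  · rintro rfl; exact map_zero _

theorem dualPart_injective (D : Submodule ℂ V) : Function.Injective (dualPart D) :=
  (injective_iff_map_eq_zero _).mpr fun _ h => dualPart_eq_zero.mp h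

theorem add_starProjection (F : Submodule ℂ V) (v : V) :
    F.starProjection v + Fᗮ.starProjection v = v :=
  Submodule.starProjection_add_starProjection_orthogonal v

theorem starProjection_starProjection_of_le {F D : Submodule ℂ V} (h : F ≤ D) (v : V) :
    F.starProjection (D.starProjection v) = F.starProjection v :=
  congrArg (fun f : V →L[ℂ] V => f v) (Submodule.starProjection_comp_starProjection_of_le h)

/-- Homogeneous coordinates of a point of the complement. -/
noncomputable def complementLift (𝒜 : Set (Submodule ℂ V)) (v : complement 𝒜) : HomCoord 𝒜 :=
  ⟨((v : V), fun D => Submodule.Quotient.mk (v : V)), fun D => by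
    rw [Ne, Submodule.Quotient.mk_eq_zero]
    exact notMem_orthogonal v.2 D.2⟩

theorem toAmbient_complementLift (𝒜 : Set (Submodule ℂ V)) (v : complement 𝒜) :
    (complementLift 𝒜 v).toAmbient = embed 𝒜 v := rfl

theorem toAmbient_mem_range_embed {𝒜 : Set (Submodule ℂ V)} {y : HomCoord 𝒜} :
    y.toAmbient ∈ Set.range (embed 𝒜) ↔ y.1.1 ∈ complement 𝒜 ∧
      ∀ D : irreducibles 𝒜, ∃ c : ℂ, y.1.2 D = c • Submodule.Quotient.mk y.1.1 := by
  constructor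
  · rintro ⟨v, hv⟩
    rw [← toAmbient_complementLift] at hv
    obtain ⟨h1, h2⟩ := toAmbient_eq_iff.mp hv.symm
    refine ⟨h1 ▸ v.2, fun D => ?_⟩
    obtain ⟨c, hc⟩ := h2 D
    refine ⟨c, hc.symm.trans ?_⟩
    rw [h1]
    rfl
  · rintro ⟨h1, h2⟩
    refine ⟨⟨y.1.1, h1⟩, ?_⟩
    rw [← toAmbient_complementLift]
    refine (toAmbient_eq_iff (y := y) (z := complementLift 𝒜 ⟨y.1.1, h1⟩).mpr ⟨rfl, fun D => ?_⟩).symm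
    obtain ⟨c, hc⟩ := h2 D
    exact ⟨c, hc.symm⟩

/-- On the wonderful model the `D`-th coordinate is determined by the point of `V` as long as the
latter does not lie in `Dᗮ`. -/
theorem exists_smul_eq_of_mem_wonderfulModel {𝒜 : Set (Submodule ℂ V)} (h𝒜 : 𝒜.Finite)
    {y : HomCoord 𝒜} (hy : y.toAmbient ∈ wonderfulModel 𝒜) (D : irreducibles 𝒜)
    (hD : y.1.1 ∉ (D : Submodule ℂ V)ᗮ) :
    ∃ c : ℂ, y.1.2 D = c • Submodule.Quotient.mk y.1.1 := by
  set p : HomCoord 𝒜 → V := fun y => (D : Submodule ℂ V).starProjection y.1.1 with hp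
  set k : HomCoord 𝒜 → V := fun y => dualPart (D : Submodule ℂ V) (y.1.2 D) with hk
  have hpc : Continuous p := by
    exact (ContinuousLinearMap.continuous _).comp (by fun_prop)
  have hkc : Continuous k := by
    exact (ContinuousLinearMap.continuous _).comp (by fun_prop)
  -- Proportionality of `k` to `p` as a closed condition: `k` equals its projection to the line of
  -- `p`, with the denominator cleared. It passes from the complement to the closure and can be
  -- solved where `p ≠ 0`.
  have hcl : IsClosed {y | inner ℂ (p y) (p y) • k y = inner ℂ (p y) (k y) • p y} :=
    isClosed_eq ((hpc.inner hpc).smul hkc) ((hpc.inner hkc).smul hpc)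
  have hsub : HomCoord.toAmbient ⁻¹' Set.range (embed 𝒜) ⊆
      {y | inner ℂ (p y) (p y) • k y = inner ℂ (p y) (k y) • p y} := by
    intro z hz
    obtain ⟨c, hc⟩ := (toAmbient_mem_range_embed.mp hz).2 D
    have : k z = c • p z := by
      simp only [hk, hp]
      rw [hc, map_smul, dualPart_mk]
    simp only [Set.mem_ofPred_eq]
    rw [this, inner_smul_right, smul_smul, mul_comm]
  have hmem := closure_minimal hsub hcl (mem_closure_preimage h𝒜 hy)
  simp only [Set.mem_ofPred_eq] at hmem
  have hp0 : p y ≠ 0 := fun h => hD ((Submodule.starProjection_apply_eq_zero_iff _).mp h)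
  have hpp : inner ℂ (p y) (p y) ≠ 0 := inner_self_ne_zero.mpr hp0
  refine ⟨(inner ℂ (p y) (p y))⁻¹ * inner ℂ (p y) (k y), ?_⟩
  apply dualPart_injective
  change k y = _
  rw [map_smul, dualPart_mk]
  change _ = _ • p y
  rw [mul_smul, ← hmem, smul_smul, inv_mul_cancel₀ hpp, one_smul]

theorem mem_range_embed_of_fst_mem {𝒜 : Set (Submodule ℂ V)} (h𝒜 : 𝒜.Finite)
    {p : Ambient 𝒜} (hp : p ∈ wonderfulModel 𝒜) (h : p.1 ∈ complement 𝒜) :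
    p ∈ Set.range (embed 𝒜) := by
  obtain ⟨y, rfl⟩ := toAmbient_surjective 𝒜 p
  exact toAmbient_mem_range_embed.mpr ⟨h, fun D =>
    exists_smul_eq_of_mem_wonderfulModel h𝒜 hp D (notMem_orthogonal h D.2)⟩

/-! ### The strata -/

/-- The Zariski closed subset of the ambient space that cuts the component attached to `F` out of
the wonderful model. -/
def closedLocus (𝒜 : Set (Submodule ℂ V)) (F : Submodule ℂ V) : Set (Ambient 𝒜) :=
  {p | p.1 ∈ Fᗮ ∧ ∀ D : irreducibles 𝒜, F < D → dualPart (D : Submodule ℂ V) (p.2 D).rep ∈ Fᗮ}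

/-- The component of the boundary attached to `F`. -/
def stratum (𝒜 : Set (Submodule ℂ V)) (F : Submodule ℂ V) : Set (Ambient 𝒜) :=
  wonderfulModel 𝒜 ∩ closedLocus 𝒜 F

theorem toAmbient_mem_closedLocus {𝒜 : Set (Submodule ℂ V)} {F : Submodule ℂ V} {y : HomCoord 𝒜} :
    y.toAmbient ∈ closedLocus 𝒜 F ↔ y.1.1 ∈ Fᗮ ∧
      ∀ D : irreducibles 𝒜, F < D → dualPart (D : Submodule ℂ V) (y.1.2 D) ∈ Fᗮ := by
  refine and_congr Iff.rfl (forall_congr' fun D => imp_congr_right fun _ => ?_)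
  obtain ⟨a, ha⟩ := Projectivization.exists_smul_eq_mk_rep ℂ (y.1.2 D) (y.2 D)
  change dualPart _ (Projectivization.mk ℂ (y.1.2 D) (y.2 D)).rep ∈ _ ↔ _
  rw [← ha, Units.smul_def, map_smul]
  exact Submodule.smul_mem_iff _ a.ne_zero

theorem stratum_subset_boundary {𝒜 : Set (Submodule ℂ V)} {F : Submodule ℂ V}
    (hF : F ∈ irreducibles 𝒜) : stratum 𝒜 F ⊆ boundary 𝒜 := by
  rintro p ⟨hp, hpF, -⟩
  refine ⟨hp, ?_⟩
  rintro ⟨v, rfl⟩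
  exact notMem_orthogonal v.2 hF hpF

/-- Take `G ≥ E` maximal among irreducibles with `p.1 ∈ Gᗮ`. For `D > G` the `D`-th coordinate is
then the class of `p.1` itself, whose component in `G` vanishes. -/
theorem exists_mem_stratum {𝒜 : Set (Submodule ℂ V)} (h𝒜 : IsReflectionArrangement 𝒜)
    {E : Submodule ℂ V} (hE : E ∈ irreducibles 𝒜) {p : Ambient 𝒜} (hp : p ∈ wonderfulModel 𝒜)
    (hpE : p.1 ∈ Eᗮ) : ∃ G ∈ irreducibles 𝒜, E ≤ G ∧ p ∈ stratum 𝒜 G := by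
  obtain ⟨G, hG, hEG, -, hpG, hmax⟩ := h𝒜.exists_maximal hE le_top hpE
  obtain ⟨y, rfl⟩ := toAmbient_surjective 𝒜 p
  refine ⟨G, hG, hEG, hp, toAmbient_mem_closedLocus.mpr ⟨hpG, fun D hGD => ?_⟩⟩
  obtain ⟨c, hc⟩ := exists_smul_eq_of_mem_wonderfulModel h𝒜.finite hp D
    (hmax D D.2 hGD le_top)
  rw [hc, map_smul, dualPart_mk]
  refine Submodule.smul_mem _ _ ?_
  rw [← Submodule.starProjection_apply_eq_zero_iff, starProjection_starProjection_of_le hGD.le]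
  exact (Submodule.starProjection_apply_eq_zero_iff _).mpr hpG

theorem exists_mem_stratum_of_mem_boundary {𝒜 : Set (Submodule ℂ V)}
    (h𝒜 : IsReflectionArrangement 𝒜) {p : Ambient 𝒜} (hp : p ∈ boundary 𝒜) :
    ∃ G ∈ irreducibles 𝒜, p ∈ stratum 𝒜 G := by
  have : p.1 ∉ complement 𝒜 := fun h => hp.2 (mem_range_embed_of_fst_mem h𝒜.finite hp.1 h)
  simp only [complement, Set.mem_ofPred_eq, not_forall, not_not] at this
  obtain ⟨H, hH, hpH⟩ := this
  obtain ⟨G, hG, -, h⟩ := exists_mem_stratum h𝒜 (h𝒜.orthogonal_irreducible hH) hp.1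
    (by rwa [Submodule.orthogonal_orthogonal])
  exact ⟨G, hG, h⟩

end Coordinates

/-! ### Topology of complements of finitely many subspaces -/

section FiniteUnions

variable {V : Type*} [NormedAddCommGroup V] [InnerProductSpace ℂ V]

theorem complement_insert (H : Submodule ℂ V) (ℬ : Set (Submodule ℂ V)) :
    complement (insert H ℬ) = (H : Set V)ᶜ ∩ complement ℬ := by
  ext v
  simp [complement]

variable [FiniteDimensional ℂ V]

theorem isOpen_complement {ℬ : Set (Submodule ℂ V)} (h : ℬ.Finite) : IsOpen (complement ℬ) := by
  induction ℬ, h using Set.Finite.induction_on with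
  | empty => simp [complement]
  | insert _ _ ih =>
    rw [complement_insert]
    exact (Submodule.closed_of_finiteDimensional _).isOpen_compl.inter ih

theorem dense_complement {ℬ : Set (Submodule ℂ V)} (h : ℬ.Finite) (htop : ⊤ ∉ ℬ) :
    Dense (complement ℬ) := by
  induction ℬ, h using Set.Finite.induction_on with
  | empty => simp [complement]
  | @insert H s _ hs ih =>
    rw [complement_insert]
    refine Dense.inter_of_isOpen_right ?_ (ih fun h => htop (Or.inr h)) (isOpen_complement hs)
    rw [← interior_eq_empty_iff_dense_compl]
    by_contra hne
    have := H.eq_top_of_nonempty_interior' (Set.nonempty_iff_ne_empty.mpr hne)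
    exact htop (Or.inl this.symm)

/-- The complex line through two points of the complement meets each subspace in at most one point,
and a real plane minus a countable set is path connected. -/
theorem isPathConnected_complement {ℬ : Set (Submodule ℂ V)} (h : ℬ.Finite) (htop : ⊤ ∉ ℬ) :
    IsPathConnected (complement ℬ) := by
  rw [isPathConnected_iff]
  refine ⟨(dense_complement h htop).nonempty, fun a ha b hb => ?_⟩
  let line : ℂ → V := fun z => a + z • (b - a)
  have hline : Continuous line := by fun_prop
  have hc : (⋃ H ∈ ℬ, {z | line z ∈ H}).Countable := by
    refine h.countable.biUnion fun H hH => Set.Subsingleton.countable fun z hz z' hz' => ?_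
    by_contra hne
    have h1 : (z - z') • (b - a) ∈ H := by
      have := H.sub_mem hz hz'
      simp only [line] at this
      rwa [add_sub_add_left_eq_sub, ← sub_smul] at this
    have h2 : b - a ∈ H := (H.smul_mem_iff (sub_ne_zero.mpr hne)).mp h1
    exact ha H hH ((H.add_mem_iff_left (H.smul_mem z h2)).mp hz)
  have hpc := hc.isPathConnected_compl_of_one_lt_rank (by rw [Complex.rank_real_complex]; norm_num)
  have hsub : line '' (⋃ H ∈ ℬ, {z | line z ∈ H})ᶜ ⊆ complement ℬ := by
    rintro _ ⟨z, hz, rfl⟩ H hH hmem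
    exact hz (Set.mem_biUnion hH hmem)
  have hj := (hpc.image hline).joinedIn (line 0)
    ⟨0, by simpa [line] using fun H hH hmem => ha H hH hmem, rfl⟩ (line 1)
    ⟨1, by simpa [line] using fun H hH hmem => hb H hH hmem, rfl⟩
  have := hj.mono hsub
  simpa [line] using this

end FiniteUnions

/-! ### Generic points of the strata and their density -/

section Strata

variable {V : Type*} [NormedAddCommGroup V] [InnerProductSpace ℂ V] [FiniteDimensional ℂ V]

/-- The vectors whose component in `F` lies on no hyperplane `H` with `Hᗮ ≤ F` and whose component
in `Fᗮ` lies on no other hyperplane. -/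
def genericPoints (𝒜 : Set (Submodule ℂ V)) (F : Submodule ℂ V) : Set V :=
  complement ({H | H ∈ 𝒜 ∧ Hᗮ ≤ F} ∪
    (fun H => H.comap (Fᗮ.starProjection : V →ₗ[ℂ] V)) '' {H | H ∈ 𝒜 ∧ ¬ Hᗮ ≤ F})

theorem mem_genericPoints {𝒜 : Set (Submodule ℂ V)} {F : Submodule ℂ V} {v : V} :
    v ∈ genericPoints 𝒜 F ↔ (∀ H ∈ 𝒜, Hᗮ ≤ F → v ∉ H) ∧
      ∀ H ∈ 𝒜, ¬ Hᗮ ≤ F → Fᗮ.starProjection v ∉ H := by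
  constructor
  · intro h
    exact ⟨fun H hH hF => h H (Or.inl ⟨hH, hF⟩), fun H hH hF => h _ (Or.inr ⟨H, ⟨hH, hF⟩, rfl⟩)⟩
  · rintro ⟨h1, h2⟩ K (⟨hK, hF⟩ | ⟨H, ⟨hH, hF⟩, rfl⟩)
    · exact h1 K hK hF
    · exact h2 H hH hF

theorem orthogonal_le_of_orthogonal_le {F H : Submodule ℂ V} (h : Hᗮ ≤ F) : Fᗮ ≤ H := by
  have := Submodule.orthogonal_le h
  rwa [Submodule.orthogonal_orthogonal] at this

theorem orthogonal_le_comm {F H : Submodule ℂ V} : Hᗮ ≤ F ↔ Fᗮ ≤ H := by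
  refine ⟨orthogonal_le_of_orthogonal_le, fun h => ?_⟩
  have := Submodule.orthogonal_le h
  rwa [Submodule.orthogonal_orthogonal] at this

section Generic

variable {𝒜 : Set (Submodule ℂ V)} (h𝒜 : IsReflectionArrangement 𝒜) (F : Submodule ℂ V)
include h𝒜

theorem finite_genericPoints_aux : ({H | H ∈ 𝒜 ∧ Hᗮ ≤ F} ∪
    (fun H => H.comap (Fᗮ.starProjection : V →ₗ[ℂ] V)) '' {H | H ∈ 𝒜 ∧ ¬ Hᗮ ≤ F}).Finite :=
  (h𝒜.finite.subset fun _ h => h.1).union ((h𝒜.finite.subset fun _ h => h.1).image _)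

theorem top_notMem_genericPoints_aux : (⊤ : Submodule ℂ V) ∉ {H | H ∈ 𝒜 ∧ Hᗮ ≤ F} ∪
    (fun H => H.comap (Fᗮ.starProjection : V →ₗ[ℂ] V)) '' {H | H ∈ 𝒜 ∧ ¬ Hᗮ ≤ F} := by
  rintro (⟨h, -⟩ | ⟨H, ⟨-, hF⟩, h⟩)
  · exact h𝒜.orthogonal_ne_bot h Submodule.top_orthogonal_eq_bot
  · refine hF (orthogonal_le_comm.mpr fun v hv => ?_)
    have hmem : v ∈ H.comap (Fᗮ.starProjection : V →ₗ[ℂ] V) := by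
      have h' : H.comap (Fᗮ.starProjection : V →ₗ[ℂ] V) = ⊤ := h
      rw [h']; trivial
    have : Fᗮ.starProjection v ∈ H := hmem
    rwa [Submodule.starProjection_eq_self_iff.mpr hv] at this

theorem isOpen_genericPoints : IsOpen (genericPoints 𝒜 F) :=
  isOpen_complement (finite_genericPoints_aux h𝒜 F)

theorem dense_genericPoints : Dense (genericPoints 𝒜 F) :=
  dense_complement (finite_genericPoints_aux h𝒜 F) (top_notMem_genericPoints_aux h𝒜 F)

theorem isPathConnected_genericPoints : IsPathConnected (genericPoints 𝒜 F) :=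
  isPathConnected_complement (finite_genericPoints_aux h𝒜 F) (top_notMem_genericPoints_aux h𝒜 F)

end Generic

open Classical in
/-- Homogeneous coordinates of the limit of the points `q + t w` of the complement for `t → 0`,
where `q` and `w` are the components of a vector in `Fᗮ` and in `F`. -/
noncomputable def stratumCoord (𝒜 : Set (Submodule ℂ V)) (F : Submodule ℂ V) :
    V →ₗ[ℂ] CoordSpace 𝒜 :=
  LinearMap.prod (Fᗮ.starProjection : V →ₗ[ℂ] V) (LinearMap.pi fun D =>
    if (D : Submodule ℂ V) ≤ F then (D : Submodule ℂ V)ᗮ.mkQ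
    else (D : Submodule ℂ V)ᗮ.mkQ ∘ₗ (Fᗮ.starProjection : V →ₗ[ℂ] V))

@[simp]
theorem stratumCoord_fst (𝒜 : Set (Submodule ℂ V)) (F : Submodule ℂ V) (v : V) :
    (stratumCoord 𝒜 F v).1 = Fᗮ.starProjection v := rfl

theorem stratumCoord_snd_of_le (𝒜 : Set (Submodule ℂ V)) {F : Submodule ℂ V}
    {D : irreducibles 𝒜} (h : (D : Submodule ℂ V) ≤ F) (v : V) :
    (stratumCoord 𝒜 F v).2 D = Submodule.Quotient.mk v := by
  simp [stratumCoord, h]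

theorem stratumCoord_snd_of_not_le (𝒜 : Set (Submodule ℂ V)) {F : Submodule ℂ V}
    {D : irreducibles 𝒜} (h : ¬ (D : Submodule ℂ V) ≤ F) (v : V) :
    (stratumCoord 𝒜 F v).2 D = Submodule.Quotient.mk (Fᗮ.starProjection v) := by
  simp [stratumCoord, h]

theorem notMem_orthogonal_of_orthogonal_le {D H : Submodule ℂ V} (h : Hᗮ ≤ D) {v : V} (hv : v ∉ H) :
    v ∉ Dᗮ := fun h' => hv (orthogonal_le_of_orthogonal_le h h')

theorem notMem_orthogonal_of_generic {𝒜 : Set (Submodule ℂ V)} {F : Submodule ℂ V} {v : V}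
    (hv : v ∈ genericPoints 𝒜 F) {D : Submodule ℂ V} (hD : D ∈ irreducibles 𝒜) (h : D ≤ F) :
    v ∉ Dᗮ := by
  obtain ⟨H, hH, hHD⟩ := exists_orthogonal_le hD
  exact notMem_orthogonal_of_orthogonal_le hHD ((mem_genericPoints.mp hv).1 H hH (hHD.trans h))

theorem starProjection_notMem_orthogonal_of_generic {𝒜 : Set (Submodule ℂ V)} {F : Submodule ℂ V}
    {v : V} (hv : v ∈ genericPoints 𝒜 F) {D : Submodule ℂ V} (hD : D ∈ irreducibles 𝒜)
    (h : ¬ D ≤ F) : Fᗮ.starProjection v ∉ Dᗮ := by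
  obtain ⟨H, hH, hHD, hHF⟩ := exists_orthogonal_le_not_le hD h
  exact notMem_orthogonal_of_orthogonal_le hHD ((mem_genericPoints.mp hv).2 H hH hHF)

theorem stratumCoord_snd_ne_zero {𝒜 : Set (Submodule ℂ V)} {F : Submodule ℂ V} {v : V}
    (hv : v ∈ genericPoints 𝒜 F) (D : irreducibles 𝒜) : (stratumCoord 𝒜 F v).2 D ≠ 0 := by
  by_cases h : (D : Submodule ℂ V) ≤ F
  · rw [stratumCoord_snd_of_le 𝒜 h, Ne, Submodule.Quotient.mk_eq_zero]
    exact notMem_orthogonal_of_generic hv D.2 h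
  · rw [stratumCoord_snd_of_not_le 𝒜 h, Ne, Submodule.Quotient.mk_eq_zero]
    exact starProjection_notMem_orthogonal_of_generic hv D.2 h

/-- The homogeneous coordinates `stratumCoord` of a generic vector. -/
noncomputable def stratumLift (𝒜 : Set (Submodule ℂ V)) (F : Submodule ℂ V)
    (v : genericPoints 𝒜 F) : HomCoord 𝒜 :=
  ⟨stratumCoord 𝒜 F v, stratumCoord_snd_ne_zero v.2⟩

/-- The generic points of the stratum of `F`. -/
def openStratum (𝒜 : Set (Submodule ℂ V)) (F : Submodule ℂ V) : Set (Ambient 𝒜) :=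
  Set.range fun v : genericPoints 𝒜 F => (stratumLift 𝒜 F v).toAmbient

/-- For small `t ≠ 0` the vectors `q + t w` lie in the complement. -/
theorem eventually_add_smul_mem_complement {𝒜 : Set (Submodule ℂ V)}
    (h𝒜 : IsReflectionArrangement 𝒜) {F : Submodule ℂ V} {v : V} (hv : v ∈ genericPoints 𝒜 F) :
    ∀ᶠ t : ℂ in 𝓝[≠] 0, Fᗮ.starProjection v + t • F.starProjection v ∈ complement 𝒜 := by
  obtain ⟨h1, h2⟩ := mem_genericPoints.mp hv
  refine (eventually_all_finite h𝒜.finite).mpr fun H hH => ?_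
  by_cases hHF : Hᗮ ≤ F
  · filter_upwards [self_mem_nhdsWithin] with t ht hmem
    have hq : Fᗮ.starProjection v ∈ H :=
      orthogonal_le_of_orthogonal_le hHF (Submodule.starProjection_apply_mem _ _)
    rw [H.add_mem_iff_right hq, H.smul_mem_iff ht] at hmem
    refine h1 H hH hHF ?_
    rw [← add_starProjection F v]
    exact H.add_mem hmem hq
  · have hcont : Continuous fun t : ℂ => Fᗮ.starProjection v + t • F.starProjection v := by fun_prop
    refine (hcont.tendsto 0).mono_left nhdsWithin_le_nhds
      |>.eventually_mem ((Submodule.closed_of_finiteDimensional H).isOpen_compl.mem_nhds ?_)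
    simpa using h2 H hH hHF

/-- For `D ≤ F` the vector `q` dies in `V ⧸ Dᗮ`, so `q + t w` has the class of `t v` there and its
projective coordinate is independent of `t`. The other coordinates tend to that of `q`. -/
theorem stratumLift_toAmbient_mem_wonderfulModel {𝒜 : Set (Submodule ℂ V)}
    (h𝒜 : IsReflectionArrangement 𝒜) {F : Submodule ℂ V} (v : genericPoints 𝒜 F) :
    (stratumLift 𝒜 F v).toAmbient ∈ wonderfulModel 𝒜 := by
  classical
  let q := Fᗮ.starProjection (v : V)
  let w := F.starProjection (v : V)
  let f : ℂ → CoordSpace 𝒜 := fun t => (q + t • w, fun D =>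
    if (D : Submodule ℂ V) ≤ F then Submodule.Quotient.mk (v : V)
    else Submodule.Quotient.mk (q + t • w))
  have hf : Tendsto f (𝓝[≠] 0) (𝓝 (stratumLift 𝒜 F v).1) := by
    refine Tendsto.mono_left ?_ nhdsWithin_le_nhds
    have hcont : Continuous f := by
      refine Continuous.prodMk (by fun_prop) (continuous_pi fun D => ?_)
      split_ifs
      · exact continuous_const
      · exact (continuous_quotientMk _).comp (by fun_prop)
    have h0 : f 0 = (stratumLift 𝒜 F v).1 := by
      refine Prod.ext (by simp [f, stratumLift, q]) (funext fun D => ?_)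
      by_cases h : (D : Submodule ℂ V) ≤ F
      · simp [f, stratumLift, stratumCoord_snd_of_le 𝒜 h, h]
      · simp [f, stratumLift, stratumCoord_snd_of_not_le 𝒜 h, h, q]
    exact h0 ▸ hcont.tendsto 0
  refine toAmbient_mem_closure hf ?_
  filter_upwards [eventually_add_smul_mem_complement h𝒜 v.2, self_mem_nhdsWithin] with t ht ht0
  have hD : ∀ D : irreducibles 𝒜, (D : Submodule ℂ V) ≤ F →
      (Submodule.Quotient.mk (v : V) : V ⧸ (D : Submodule ℂ V)ᗮ) =
        t⁻¹ • Submodule.Quotient.mk (q + t • w) := by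
    intro D h
    have hqD : (Submodule.Quotient.mk q : V ⧸ (D : Submodule ℂ V)ᗮ) = 0 :=
      (Submodule.Quotient.mk_eq_zero _).mpr
        (Submodule.orthogonal_le h (Submodule.starProjection_apply_mem _ _))
    have hv : (v : V) = w + q := (add_starProjection F (v : V)).symm
    rw [hv, Submodule.Quotient.mk_add, Submodule.Quotient.mk_add, hqD, zero_add, add_zero,
      Submodule.Quotient.mk_smul, smul_smul, inv_mul_cancel₀ ht0, one_smul]
  refine ⟨fun D => ?_, ?_⟩
  · by_cases h : (D : Submodule ℂ V) ≤ F
    · simp only [f, h, if_true, Ne, Submodule.Quotient.mk_eq_zero]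
      exact notMem_orthogonal_of_generic v.2 D.2 h
    · simp only [f, h, if_false, Ne, Submodule.Quotient.mk_eq_zero]
      exact notMem_orthogonal ht D.2
  · refine toAmbient_mem_range_embed.mpr ⟨ht, fun D => ?_⟩
    by_cases h : (D : Submodule ℂ V) ≤ F
    · exact ⟨t⁻¹, by simp only [f, h, if_true]; exact hD D h⟩
    · exact ⟨1, by simp only [f, h, if_false, one_smul]⟩

theorem openStratum_subset_stratum {𝒜 : Set (Submodule ℂ V)} (h𝒜 : IsReflectionArrangement 𝒜)
    (F : Submodule ℂ V) : openStratum 𝒜 F ⊆ stratum 𝒜 F := by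
  rintro _ ⟨v, rfl⟩
  refine ⟨stratumLift_toAmbient_mem_wonderfulModel h𝒜 v, toAmbient_mem_closedLocus.mpr
    ⟨Submodule.starProjection_apply_mem _ _, fun D hD => ?_⟩⟩
  change dualPart (D : Submodule ℂ V) ((stratumCoord 𝒜 F v).2 D) ∈ Fᗮ
  rw [stratumCoord_snd_of_not_le 𝒜 hD.not_ge, dualPart_mk,
    ← Submodule.starProjection_apply_eq_zero_iff, starProjection_starProjection_of_le hD.le]
  exact (Submodule.starProjection_apply_eq_zero_iff _).mpr (Submodule.starProjection_apply_mem _ _)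

/-- Generic vectors are dense in the complement, so points of the model can be approached through
vectors for which `stratumCoord` has nonzero coordinates. -/
theorem wonderfulModel_subset_closure_generic {𝒜 : Set (Submodule ℂ V)}
    (h𝒜 : IsReflectionArrangement 𝒜) (F : Submodule ℂ V) :
    wonderfulModel 𝒜 ⊆ closure (embed 𝒜 '' {v | (v : V) ∈ genericPoints 𝒜 F}) := by
  refine closure_minimal ?_ isClosed_closure
  have hcont : Continuous (embed 𝒜) := by
    refine (continuous_toAmbient 𝒜).comp (f := complementLift 𝒜) ?_
    refine Continuous.subtype_mk (Continuous.prodMk continuous_subtype_val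
      (continuous_pi fun D => ?_)) _
    exact (continuous_quotientMk _).comp continuous_subtype_val
  exact hcont.range_subset_closure_image_dense ((dense_genericPoints h𝒜 F).preimage
    (isOpen_complement h𝒜.finite).isOpenMap_subtype_val)

/-- The coordinates of a point of the complement can be deformed, close to the stratum of `F`, to
those of a generic point of this stratum. -/
theorem exists_tendsto_stratumCoord {𝒜 : Set (Submodule ℂ V)} (h𝒜 : IsReflectionArrangement 𝒜)
    {F : Submodule ℂ V} (hF : F ∈ irreducibles 𝒜) {y₀ : HomCoord 𝒜}
    (hy : y₀.toAmbient ∈ closedLocus 𝒜 F) {S : Set (HomCoord 𝒜)}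
    (hS : ∀ y ∈ S, y.1.1 ∈ genericPoints 𝒜 F ∧
      ∀ D : irreducibles 𝒜, ∃ c : ℂ, y.1.2 D = c • Submodule.Quotient.mk y.1.1)
    (D : irreducibles 𝒜) :
    ∃ f : HomCoord 𝒜 → V ⧸ (D : Submodule ℂ V)ᗮ, Tendsto f (𝓝[S] y₀) (𝓝 (y₀.1.2 D)) ∧
      ∀ᶠ y in 𝓝[S] y₀, ∃ c : ℂ, c ≠ 0 ∧ f y = c • (stratumCoord 𝒜 F y.1.1).2 D := by
  obtain ⟨-, hy2⟩ := toAmbient_mem_closedLocus.mp hy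
  have hcD : ∀ D : irreducibles 𝒜, Continuous fun y : HomCoord 𝒜 => y.1.2 D := fun D => by fun_prop
  have hne : ∀ (y : HomCoord 𝒜) (D : irreducibles 𝒜) (c : ℂ),
      y.1.2 D = c • Submodule.Quotient.mk y.1.1 → c ≠ 0 := by
    rintro y D c hc rfl
    exact y.2 D (by rw [hc, zero_smul])
  by_cases hDF : (D : Submodule ℂ V) ≤ F
  · refine ⟨fun y => y.1.2 D, ((hcD D).tendsto y₀).mono_left nhdsWithin_le_nhds, ?_⟩
    filter_upwards [self_mem_nhdsWithin] with y hyS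
    obtain ⟨c, hc⟩ := (hS y hyS).2 D
    exact ⟨c, hne y D c hc, by rw [stratumCoord_snd_of_le 𝒜 hDF, hc]⟩
  rcases h𝒜.sup_irreducible_or D.2 hF with hM | horth
  -- The aim is to remove the `F`-component of `y.1.1` from its `D`-th coordinate. That component is
  -- read off the `M`-th coordinate, where it tends to zero because `F < M` and `y₀` lies in the
  -- closed locus of `F`.
  · let M : irreducibles 𝒜 := ⟨D ⊔ F, hM⟩
    have hFM : F < M := lt_of_le_of_ne le_sup_right fun h => hDF (by
      have h1 : (D : Submodule ℂ V) ≤ M := le_sup_left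
      exact h1.trans h.ge)
    let k : HomCoord 𝒜 → V := fun y => dualPart (M : Submodule ℂ V) (y.1.2 M)
    let d : HomCoord 𝒜 → V := fun y => dualPart (D : Submodule ℂ V) (y.1.2 D)
    have hk : Continuous k := (ContinuousLinearMap.continuous _).comp (hcD M)
    have hd : Continuous d := (ContinuousLinearMap.continuous _).comp (hcD D)
    have hkF : F.starProjection (k y₀) = 0 :=
      (Submodule.starProjection_apply_eq_zero_iff _).mpr (hy2 M hFM)
    let g : V := (D : Submodule ℂ V).starProjection (k y₀)
    -- The `M`-th coordinate of `y₀` is a nonzero vector of `D ⊔ F` orthogonal to `F`, so it is not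
    -- orthogonal to `D`.
    have hg : g ≠ 0 := by
      intro h
      have h1 : k y₀ ∈ (D : Submodule ℂ V)ᗮ := (Submodule.starProjection_apply_eq_zero_iff _).mp h
      have h2 : k y₀ ∈ (M : Submodule ℂ V)ᗮ := by
        change k y₀ ∈ ((D : Submodule ℂ V) ⊔ F)ᗮ
        rw [← Submodule.inf_orthogonal]
        exact ⟨h1, hy2 M hFM⟩
      have h3 : k y₀ = 0 := by
        have := Submodule.inf_orthogonal_eq_bot (M : Submodule ℂ V)
        rw [← Submodule.mem_bot ℂ, ← this]
        exact ⟨dualPart_mem _ _, h2⟩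
      exact y₀.2 M (dualPart_eq_zero.mp h3)
    let den : HomCoord 𝒜 → ℂ := fun y => inner ℂ g ((D : Submodule ℂ V).starProjection (k y))
    have hden : Continuous den := continuous_const.inner ((ContinuousLinearMap.continuous _).comp hk)
    have hden0 : den y₀ ≠ 0 := inner_self_ne_zero.mpr hg
    -- The quotient is the ratio `c / m` of the scales of the `D`-th and `M`-th coordinates.
    -- Expressed through `g` it is continuous at `y₀`.
    refine ⟨fun y => y.1.2 D - (inner ℂ g (d y) / den y) •
      Submodule.Quotient.mk (F.starProjection (k y)), ?_, ?_⟩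
    · refine Tendsto.mono_left ?_ nhdsWithin_le_nhds
      have h1 : Tendsto (fun y => (inner ℂ g (d y) / den y)) (𝓝 y₀)
          (𝓝 (inner ℂ g (d y₀) / den y₀)) :=
        ((continuous_const.inner hd).tendsto y₀).div (hden.tendsto y₀) hden0
      have h2 : Tendsto (fun y => (Submodule.Quotient.mk (F.starProjection (k y)) :
          V ⧸ (D : Submodule ℂ V)ᗮ)) (𝓝 y₀) (𝓝 0) := by
        have := ((continuous_quotientMk (D : Submodule ℂ V)).comp
          ((ContinuousLinearMap.continuous F.starProjection).comp hk)).tendsto y₀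
        simpa [hkF, Function.comp_def] using this
      simpa using ((hcD D).tendsto y₀).sub (h1.smul h2)
    · filter_upwards [self_mem_nhdsWithin, (hden.tendsto y₀).mono_left nhdsWithin_le_nhds
        |>.eventually_ne hden0] with y hyS hy0
      obtain ⟨c, hc⟩ := (hS y hyS).2 D
      obtain ⟨m, hm⟩ := (hS y hyS).2 M
      refine ⟨c, hne y D c hc, ?_⟩
      have hm0 := hne y M m hm
      have hky : k y = m • (M : Submodule ℂ V).starProjection y.1.1 := by
        simp only [k]; rw [hm, map_smul, dualPart_mk]
      have hdy : d y = c • (D : Submodule ℂ V).starProjection y.1.1 := by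
        simp only [d]; rw [hc, map_smul, dualPart_mk]
      have hdeny : den y = m * inner ℂ g ((D : Submodule ℂ V).starProjection y.1.1) := by
        simp only [den]
        rw [hky, map_smul, starProjection_starProjection_of_le (show (D : Submodule ℂ V) ≤ M from
          le_sup_left), inner_smul_right]
      have hi0 : inner ℂ g ((D : Submodule ℂ V).starProjection y.1.1) ≠ 0 := by
        intro h; rw [hdeny, h, mul_zero] at hy0; exact hy0 rfl
      have hratio : inner ℂ g (d y) / den y = c / m := by
        rw [hdeny, hdy, inner_smul_right, mul_div_mul_right _ _ hi0]
      rw [stratumCoord_snd_of_not_le 𝒜 hDF, hratio, hky, map_smul,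
        starProjection_starProjection_of_le hFM.le, Submodule.Quotient.mk_smul, smul_smul,
        div_mul_cancel₀ _ hm0, hc, ← smul_sub, ← Submodule.Quotient.mk_sub]
      congr 2
      rw [sub_eq_iff_eq_add']
      exact (add_starProjection F _).symm
  -- When `F ⟂ D`, the `F`-component has class zero in `V ⧸ Dᗮ` and needs no correction.
  · refine ⟨fun y => y.1.2 D, ((hcD D).tendsto y₀).mono_left nhdsWithin_le_nhds, ?_⟩
    filter_upwards [self_mem_nhdsWithin] with y hyS
    obtain ⟨c, hc⟩ := (hS y hyS).2 D
    refine ⟨c, hne y D c hc, ?_⟩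
    rw [stratumCoord_snd_of_not_le 𝒜 hDF, hc]
    congr 1
    nth_rewrite 1 [← add_starProjection F y.1.1]
    rw [Submodule.Quotient.mk_add, (Submodule.Quotient.mk_eq_zero _).mpr
      (horth (Submodule.starProjection_apply_mem _ _)), zero_add]

/-- The corrected coordinates of `exists_tendsto_stratumCoord` are, up to scalars, those of generic
points of the stratum, and they converge to the given point. -/
theorem stratum_subset_closure_openStratum {𝒜 : Set (Submodule ℂ V)}
    (h𝒜 : IsReflectionArrangement 𝒜) {F : Submodule ℂ V} (hF : F ∈ irreducibles 𝒜) :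
    stratum 𝒜 F ⊆ closure (openStratum 𝒜 F) := by
  rintro p ⟨hp, hpF⟩
  obtain ⟨y₀, rfl⟩ := toAmbient_surjective 𝒜 p
  have hcl := mem_closure_preimage h𝒜.finite (wonderfulModel_subset_closure_generic h𝒜 F hp)
  set S : Set (HomCoord 𝒜) :=
    HomCoord.toAmbient ⁻¹' (embed 𝒜 '' {v | (v : V) ∈ genericPoints 𝒜 F}) with hSdef
  have hS : ∀ y ∈ S, y.1.1 ∈ genericPoints 𝒜 F ∧
      ∀ D : irreducibles 𝒜, ∃ c : ℂ, y.1.2 D = c • Submodule.Quotient.mk y.1.1 := by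
    rintro y ⟨v, hv, hvy⟩
    refine ⟨?_, (toAmbient_mem_range_embed.mp ⟨v, hvy⟩).2⟩
    have : (v : V) = y.1.1 := congrArg Prod.fst hvy
    rw [← this]; exact hv
  have : (𝓝[S] y₀).NeBot := mem_closure_iff_nhdsWithin_neBot.mp hcl
  have : Finite (irreducibles 𝒜) := irreducibles_finite h𝒜.finite
  choose f hf hf' using fun D => exists_tendsto_stratumCoord h𝒜 hF hpF hS D
  have hev := eventually_all.mpr hf'
  refine toAmbient_mem_closure (l := 𝓝[S] y₀)
    (f := fun y => (Fᗮ.starProjection y.1.1, fun D => f D y)) ?_ ?_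
  · refine Tendsto.prodMk_nhds ?_ (tendsto_pi_nhds.mpr hf)
    have h1 : Tendsto (fun y : HomCoord 𝒜 => Fᗮ.starProjection y.1.1) (𝓝[S] y₀)
        (𝓝 (Fᗮ.starProjection y₀.1.1)) :=
      (((ContinuousLinearMap.continuous Fᗮ.starProjection).comp
        (by fun_prop : Continuous fun y : HomCoord 𝒜 => y.1.1)).tendsto y₀).mono_left
        nhdsWithin_le_nhds
    rwa [Submodule.starProjection_eq_self_iff.mpr (toAmbient_mem_closedLocus.mp hpF).1] at h1
  · filter_upwards [hev, self_mem_nhdsWithin] with y hy hyS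
    have hgen := (hS y hyS).1
    refine ⟨fun D => ?_, ⟨⟨y.1.1, hgen⟩, ?_⟩⟩
    · obtain ⟨c, hc0, hc⟩ := hy D
      rw [hc]
      exact smul_ne_zero hc0 (stratumCoord_snd_ne_zero hgen D)
    · symm
      refine toAmbient_eq_iff.mpr ⟨rfl, fun D => ?_⟩
      obtain ⟨c, -, hc⟩ := hy D
      exact ⟨c, hc.symm⟩

theorem image_fst_stratum {𝒜 : Set (Submodule ℂ V)} (h𝒜 : IsReflectionArrangement 𝒜)
    (F : Submodule ℂ V) : Prod.fst '' stratum 𝒜 F = (Fᗮ : Set V) := by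
  classical
  refine Set.Subset.antisymm ?_ fun q₀ hq₀ => ?_
  · rintro _ ⟨p, hp, rfl⟩
    exact hp.2.1
  obtain ⟨v, hv⟩ := (dense_genericPoints h𝒜 F).nonempty
  obtain ⟨hv1, hv2⟩ := mem_genericPoints.mp hv
  set q := Fᗮ.starProjection v with hq
  have hqF : q ∈ Fᗮ := Submodule.starProjection_apply_mem _ _
  set w := F.starProjection v with hw
  -- `q₀` may lie on further hyperplanes, so it is approached by `q₀ + t q` with `q` generic in
  -- `Fᗮ`. When `q₀ ∈ Dᗮ` the class of `q₀ + t q` is `t` times that of `q`; dividing by `t` keeps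
  -- the coordinate nonzero in the limit.
  let u : ℂ → irreducibles 𝒜 → V := fun t D =>
    if (D : Submodule ℂ V) ≤ F then v else if q₀ ∈ (D : Submodule ℂ V)ᗮ then q else q₀ + t • q
  have hproj : ∀ t : ℂ, Fᗮ.starProjection (w + (q₀ + t • q)) = q₀ + t • q := by
    intro t
    have hmem : q₀ + t • q ∈ Fᗮ := add_mem hq₀ (Submodule.smul_mem _ _ hqF)
    rw [map_add, Submodule.starProjection_eq_self_iff.mpr hmem,
      (Submodule.starProjection_apply_eq_zero_iff Fᗮ).mpr, zero_add]
    rw [Submodule.orthogonal_orthogonal]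
    exact Submodule.starProjection_apply_mem _ _
  have hgen : ∀ᶠ t : ℂ in 𝓝[≠] 0, w + (q₀ + t • q) ∈ genericPoints 𝒜 F := by
    have : ∀ᶠ t : ℂ in 𝓝[≠] 0, ∀ H ∈ 𝒜, ¬ Hᗮ ≤ F → q₀ + t • q ∉ H := by
      refine (eventually_all_finite h𝒜.finite).mpr fun H hH => ?_
      by_cases hHF : Hᗮ ≤ F
      · exact Eventually.of_forall fun t h => (h hHF).elim
      by_cases hqH : q₀ ∈ H
      · filter_upwards [self_mem_nhdsWithin] with t ht _ hmem
        rw [H.add_mem_iff_right hqH, H.smul_mem_iff ht] at hmem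
        exact hv2 H hH hHF hmem
      · have hcont : Continuous fun t : ℂ => q₀ + t • q := by fun_prop
        refine ((hcont.tendsto 0).mono_left nhdsWithin_le_nhds |>.eventually_mem
          ((Submodule.closed_of_finiteDimensional H).isOpen_compl.mem_nhds ?_)).mono
          fun t h _ => h
        simpa using hqH
    filter_upwards [this] with t ht
    refine mem_genericPoints.mpr ⟨fun H hH hHF hmem => ?_, fun H hH hHF => ?_⟩
    · have h1 : Fᗮ ≤ H := orthogonal_le_of_orthogonal_le hHF
      rw [H.add_mem_iff_left (h1 (add_mem hq₀ (Submodule.smul_mem _ _ hqF)))] at hmem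
      refine hv1 H hH hHF ?_
      rw [← add_starProjection F v]
      exact H.add_mem hmem (h1 hqF)
    · rw [hproj]; exact ht H hH hHF
  have hu0 : ∀ D : irreducibles 𝒜, u 0 D ∉ (D : Submodule ℂ V)ᗮ := by
    intro D
    simp only [u]
    split_ifs with h1 h2
    · exact notMem_orthogonal_of_generic hv D.2 h1
    · exact starProjection_notMem_orthogonal_of_generic hv D.2 h1
    · simpa using h2
  let y₀ : HomCoord 𝒜 := ⟨(q₀, fun D => Submodule.Quotient.mk (u 0 D)), fun D => by
    rw [Ne, Submodule.Quotient.mk_eq_zero]; exact hu0 D⟩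
  have hmem : y₀.toAmbient ∈ wonderfulModel 𝒜 := by
    have hsub : closure (openStratum 𝒜 F) ⊆ wonderfulModel 𝒜 :=
      closure_minimal (fun p hp => (openStratum_subset_stratum h𝒜 F hp).1) isClosed_closure
    refine hsub (toAmbient_mem_closure (l := 𝓝[≠] (0 : ℂ))
      (f := fun t => (q₀ + t • q, fun D => Submodule.Quotient.mk (u t D))) ?_ ?_)
    · refine Tendsto.mono_left ?_ nhdsWithin_le_nhds
      have hcont : Continuous fun t : ℂ => ((q₀ + t • q, fun D => Submodule.Quotient.mk (u t D)) :
          CoordSpace 𝒜) := by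
        refine Continuous.prodMk (by fun_prop) (continuous_pi fun D => ?_)
        refine (continuous_quotientMk _).comp ?_
        simp only [u]
        split_ifs <;> fun_prop
      have := hcont.tendsto 0
      simpa [y₀] using this
    · filter_upwards [hgen, self_mem_nhdsWithin] with t ht ht0
      have key : ∀ D : irreducibles 𝒜, ∃ c : ℂ, c ≠ 0 ∧
          (Submodule.Quotient.mk (u t D) : V ⧸ (D : Submodule ℂ V)ᗮ) =
            c • (stratumCoord 𝒜 F (w + (q₀ + t • q))).2 D := by
        intro D
        by_cases h1 : (D : Submodule ℂ V) ≤ F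
        · refine ⟨1, one_ne_zero, ?_⟩
          rw [stratumCoord_snd_of_le 𝒜 h1, one_smul]
          simp only [u, h1, if_true]
          rw [Submodule.Quotient.eq]
          refine Submodule.orthogonal_le h1 ?_
          have : v - (w + (q₀ + t • q)) = q - (q₀ + t • q) := by
            rw [← sub_sub]
            congr 1
            rw [sub_eq_iff_eq_add']
            exact (add_starProjection F v).symm
          rw [this]
          exact sub_mem hqF (add_mem hq₀ (Submodule.smul_mem _ _ hqF))
        · rw [stratumCoord_snd_of_not_le 𝒜 h1, hproj]
          by_cases h2 : q₀ ∈ (D : Submodule ℂ V)ᗮ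
          · refine ⟨t⁻¹, inv_ne_zero ht0, ?_⟩
            simp only [u, h1, h2, if_true, if_false]
            rw [Submodule.Quotient.mk_add, (Submodule.Quotient.mk_eq_zero _).mpr h2, zero_add,
              Submodule.Quotient.mk_smul, smul_smul, inv_mul_cancel₀ ht0, one_smul]
          · exact ⟨1, one_ne_zero, by simp only [u, h1, h2, if_false, one_smul]⟩
      refine ⟨fun D => ?_, ⟨⟨_, ht⟩, ?_⟩⟩
      · obtain ⟨c, hc0, hc⟩ := key D
        change (Submodule.Quotient.mk (u t D) : V ⧸ (D : Submodule ℂ V)ᗮ) ≠ 0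
        rw [hc]
        exact smul_ne_zero hc0 (stratumCoord_snd_ne_zero ht D)
      · symm
        refine toAmbient_eq_iff.mpr ⟨(hproj t).symm, fun D => ?_⟩
        obtain ⟨c, -, hc⟩ := key D
        exact ⟨c, hc.symm⟩
  refine ⟨y₀.toAmbient, ⟨hmem, toAmbient_mem_closedLocus.mpr ⟨hq₀, fun D hD => ?_⟩⟩, rfl⟩
  change dualPart _ (Submodule.Quotient.mk (u 0 D)) ∈ Fᗮ
  rw [dualPart_mk, ← Submodule.starProjection_apply_eq_zero_iff,
    starProjection_starProjection_of_le hD.le]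
  refine (Submodule.starProjection_apply_eq_zero_iff _).mpr ?_
  simp only [u, hD.not_ge, if_false]
  split_ifs
  · exact hqF
  · simpa using hq₀

end Strata

/-! ### Polynomial functions and affine Zariski open sets -/

section Polynomials

theorem comp_mem_polynomialFunctions {E E' : Type*} [AddCommGroup E] [Module ℂ E] [AddCommGroup E']
    [Module ℂ E'] (L : E →ₗ[ℂ] E') {p : E' → ℂ} (hp : p ∈ polynomialFunctions E') :
    (fun x => p (L x)) ∈ polynomialFunctions E := by
  induction hp using Algebra.adjoin_induction with
  | mem p hp =>
    obtain ⟨φ, rfl⟩ := hp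
    exact Algebra.subset_adjoin ⟨φ ∘ₗ L, rfl⟩
  | algebraMap r => exact (polynomialFunctions E).algebraMap_mem r
  | add p p' _ _ h h' => exact add_mem h h'
  | mul p p' _ _ h h' => exact mul_mem h h'

theorem dual_mem_polynomialFunctions {E : Type*} [AddCommGroup E] [Module ℂ E] (φ : E →ₗ[ℂ] ℂ) :
    (fun x => φ x) ∈ polynomialFunctions E :=
  Algebra.subset_adjoin ⟨φ, rfl⟩

theorem continuous_of_mem_polynomialFunctions {E : Type*} [AddCommGroup E] [Module ℂ E]
    [TopologicalSpace E] [IsTopologicalAddGroup E] [ContinuousSMul ℂ E] [T2Space E]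
    [FiniteDimensional ℂ E] {p : E → ℂ} (hp : p ∈ polynomialFunctions E) : Continuous p := by
  induction hp using Algebra.adjoin_induction with
  | mem p hp =>
    obtain ⟨φ, rfl⟩ := hp
    exact LinearMap.continuous_of_finiteDimensional φ
  | algebraMap r => exact continuous_const
  | add p p' _ _ h h' => exact h.add h'
  | mul p p' _ _ h h' => exact h.mul h'

theorem analyticOnNhd_of_mem_polynomialFunctions {E : Type*} [NormedAddCommGroup E]
    [NormedSpace ℂ E] [FiniteDimensional ℂ E] {p : E → ℂ} (hp : p ∈ polynomialFunctions E) :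
    AnalyticOnNhd ℂ p Set.univ := by
  induction hp using Algebra.adjoin_induction with
  | mem p hp =>
    obtain ⟨φ, rfl⟩ := hp
    exact (LinearMap.toContinuousLinearMap φ).analyticOnNhd _
  | algebraMap r => exact analyticOnNhd_const
  | add p p' _ _ h h' => exact h.add h'
  | mul p p' _ _ h h' => exact h.mul h'

/-- A polynomial vanishing on a nonempty open set is zero, by the identity theorem. -/
theorem dense_ne_zero_of_mem_polynomialFunctions {E : Type*} [NormedAddCommGroup E]
    [NormedSpace ℂ E] [FiniteDimensional ℂ E] {p : E → ℂ} (hp : p ∈ polynomialFunctions E) {x : E}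
    (hx : p x ≠ 0) : Dense {x | p x ≠ 0} := by
  intro z
  by_contra hz
  have hev : ∀ᶠ w in 𝓝 z, w ∉ {x | p x ≠ 0} := by
    rw [mem_closure_iff_frequently] at hz
    exact not_frequently.mp hz
  have h0 : p =ᶠ[𝓝 z] 0 := hev.mono fun w hw => by simpa using hw
  exact hx ((analyticOnNhd_of_mem_polynomialFunctions hp).eqOn_zero_of_preconnected_of_eventuallyEq_zero
    isPreconnected_univ (Set.mem_univ z) h0 (Set.mem_univ x))

/-- Nonvanishing loci are stable under intersection, by multiplying polynomials, so they form a
basis and not merely a subbasis. -/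
theorem exists_polynomial_of_isOpen_zariskiAffine {E : Type*} [AddCommGroup E] [Module ℂ E]
    {O : Set E} (hO : IsOpen[zariskiAffine E] O) {x : E} (hx : x ∈ O) :
    ∃ p ∈ polynomialFunctions E, p x ≠ 0 ∧ ∀ z, p z ≠ 0 → z ∈ O := by
  induction hO with
  | basic s hs =>
    obtain ⟨p, hp, rfl⟩ := hs
    exact ⟨p, hp, hx, fun z hz => hz⟩
  | univ => exact ⟨1, one_mem _, one_ne_zero, fun z _ => trivial⟩
  | inter s t _ _ ihs iht =>
    obtain ⟨p, hp, hpx, hps⟩ := ihs hx.1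
    obtain ⟨p', hp', hpx', hpt⟩ := iht hx.2
    exact ⟨p * p', mul_mem hp hp', mul_ne_zero hpx hpx', fun z hz =>
      ⟨hps z (left_ne_zero_of_mul hz), hpt z (right_ne_zero_of_mul hz)⟩⟩
  | sUnion S _ ih =>
    obtain ⟨s, hs, hxs⟩ := hx
    obtain ⟨p, hp, hpx, hps⟩ := ih s hs hxs
    exact ⟨p, hp, hpx, fun z hz => ⟨s, hs, hps z hz⟩⟩

theorem isOpen_zariskiAffine_ne_zero {E : Type*} [AddCommGroup E] [Module ℂ E] (φ : E →ₗ[ℂ] ℂ) :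
    IsOpen[zariskiAffine E] {x | φ x ≠ 0} :=
  TopologicalSpace.isOpen_generateFrom_of_mem ⟨_, dual_mem_polynomialFunctions φ, rfl⟩

end Polynomials

/-! ### Irreducible components of the boundary -/

section Zariski

variable {V : Type*} [NormedAddCommGroup V] [InnerProductSpace ℂ V]

theorem exists_polynomial_of_isOpen_zariski {𝒜 : Set (Submodule ℂ V)} {O : Set (Ambient 𝒜)}
    (hO : IsOpen[zariski 𝒜] O) {y : HomCoord 𝒜} (hy : y.toAmbient ∈ O) :
    ∃ p ∈ polynomialFunctions (CoordSpace 𝒜), p y.1 ≠ 0 ∧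
      ∀ z : HomCoord 𝒜, p z.1 ≠ 0 → z.toAmbient ∈ O := by
  obtain ⟨O', hO', h⟩ := (isOpen_induced_iff (t := zariskiAffine (CoordSpace 𝒜))).mp (isOpen_coinduced.mp hO)
  have hmem : y.1 ∈ O' := by
    change y ∈ Subtype.val ⁻¹' O'
    rw [h]; exact hy
  obtain ⟨p, hp, hpy, hpz⟩ := exists_polynomial_of_isOpen_zariskiAffine hO' hmem
  refine ⟨p, hp, hpy, fun z hz => ?_⟩
  have : z ∈ Subtype.val ⁻¹' O' := hpz _ hz
  rw [h] at this
  exact this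

variable [FiniteDimensional ℂ V]

instance isClosed_orthogonal_instance (D : Submodule ℂ V) : IsClosed (Dᗮ : Set V) :=
  D.isClosed_orthogonal

theorem isOpen_of_isOpen_zariski {𝒜 : Set (Submodule ℂ V)} (h𝒜 : 𝒜.Finite) {O : Set (Ambient 𝒜)}
    (hO : IsOpen[zariski 𝒜] O) : IsOpen O := by
  have : Finite (irreducibles 𝒜) := irreducibles_finite h𝒜
  have h1 : IsOpen (HomCoord.toAmbient ⁻¹' O) := by
    rw [isOpen_iff_mem_nhds]
    intro y hy
    obtain ⟨p, hp, hpy, hpz⟩ := exists_polynomial_of_isOpen_zariski hO hy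
    have hcont : Continuous fun z : HomCoord 𝒜 => p z.1 :=
      (continuous_of_mem_polynomialFunctions hp).comp continuous_subtype_val
    filter_upwards [(hcont.tendsto y).eventually_ne hpy] with z hz
    exact hpz z hz
  rw [← Set.image_preimage_eq O (toAmbient_surjective 𝒜)]
  exact isOpenMap_toAmbient h𝒜 _ h1

theorem isClosed_zariski_closedLocus (𝒜 : Set (Submodule ℂ V)) (F : Submodule ℂ V) :
    IsClosed[zariski 𝒜] (closedLocus 𝒜 F) := by
  rw [← @isOpen_compl_iff _ _ (zariski 𝒜)]
  refine isOpen_coinduced.mpr ((isOpen_induced_iff (t := zariskiAffine (CoordSpace 𝒜))).mpr ?_)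
  let φ : V → CoordSpace 𝒜 →ₗ[ℂ] ℂ := fun f => (innerSL ℂ f : V →ₗ[ℂ] ℂ) ∘ₗ LinearMap.fst ℂ _ _
  let ψ : (D : irreducibles 𝒜) → V → CoordSpace 𝒜 →ₗ[ℂ] ℂ := fun D f =>
    (innerSL ℂ f : V →ₗ[ℂ] ℂ) ∘ₗ (dualPart (D : Submodule ℂ V) : _ →ₗ[ℂ] V) ∘ₗ
      LinearMap.proj D ∘ₗ LinearMap.snd ℂ _ _
  refine ⟨(⋃ f ∈ F, {y | φ f y ≠ 0}) ∪ ⋃ D : irreducibles 𝒜, ⋃ _ : F < D, ⋃ f ∈ F, {y | ψ D f y ≠ 0},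
    ?_, ?_⟩
  · let _ : TopologicalSpace (CoordSpace 𝒜) := zariskiAffine (CoordSpace 𝒜)
    exact (isOpen_biUnion fun f _ => isOpen_zariskiAffine_ne_zero (φ f)).union
      (isOpen_iUnion fun D => isOpen_iUnion fun _ => isOpen_biUnion fun f _ =>
        isOpen_zariskiAffine_ne_zero (ψ D f))
  · ext y
    have h1 : y.1.1 ∈ Fᗮ ↔ ∀ f ∈ F, φ f y.1 = 0 := Submodule.mem_orthogonal _ _
    have h2 : ∀ D : irreducibles 𝒜, dualPart (D : Submodule ℂ V) (y.1.2 D) ∈ Fᗮ ↔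
        ∀ f ∈ F, ψ D f y.1 = 0 := fun D => Submodule.mem_orthogonal _ _
    rw [Set.mem_preimage, Set.mem_preimage, Set.mem_compl_iff, toAmbient_mem_closedLocus, h1]
    simp_rw [h2]
    simp only [Set.mem_union, Set.mem_iUnion, Set.mem_ofPred_eq, not_and_or, not_forall,
      exists_prop]

/-- A Zariski open set meeting the stratum meets its dense set of generic points. Pulled back along
the linear map `stratumCoord`, it contains the generic vectors outside the zeros of a nonzero
polynomial; two such dense open conditions hold simultaneously. -/
theorem isIrreducible_stratum {𝒜 : Set (Submodule ℂ V)} (h𝒜 : IsReflectionArrangement 𝒜)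
    {F : Submodule ℂ V} (hF : F ∈ irreducibles 𝒜) :
    @IsIrreducible _ (zariski 𝒜) (stratum 𝒜 F) := by
  constructor
  · obtain ⟨v, hv⟩ := (dense_genericPoints h𝒜 F).nonempty
    exact ⟨_, openStratum_subset_stratum h𝒜 F ⟨⟨v, hv⟩, rfl⟩⟩
  · have key : ∀ O : Set (Ambient 𝒜), IsOpen[zariski 𝒜] O → (stratum 𝒜 F ∩ O).Nonempty →
        ∃ p ∈ polynomialFunctions V, (∃ v, p v ≠ 0) ∧
          ∀ v : genericPoints 𝒜 F, p v ≠ 0 → (stratumLift 𝒜 F v).toAmbient ∈ O := by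
      rintro O hO ⟨x, hx, hxO⟩
      obtain ⟨-, hO', v, rfl⟩ := mem_closure_iff.mp (stratum_subset_closure_openStratum h𝒜 hF hx) O
        (isOpen_of_isOpen_zariski h𝒜.finite hO) hxO
      obtain ⟨p, hp, hpv, hpz⟩ := exists_polynomial_of_isOpen_zariski hO hO'
      exact ⟨_, comp_mem_polynomialFunctions (stratumCoord 𝒜 F) hp, ⟨v, hpv⟩, fun v hv => hpz _ hv⟩
    intro O₁ O₂ h₁ h₂ hn₁ hn₂
    obtain ⟨p₁, hp₁, ⟨v₁, hv₁⟩, hO₁⟩ := key O₁ h₁ hn₁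
    obtain ⟨p₂, hp₂, ⟨v₂, hv₂⟩, hO₂⟩ := key O₂ h₂ hn₂
    have hopen : ∀ p ∈ polynomialFunctions V, IsOpen {v | p v ≠ 0} := fun p hp =>
      isOpen_ne_fun (continuous_of_mem_polynomialFunctions hp) continuous_const
    have hd := (dense_ne_zero_of_mem_polynomialFunctions hp₁ hv₁).inter_of_isOpen_left
      (dense_ne_zero_of_mem_polynomialFunctions hp₂ hv₂) (hopen p₁ hp₁)
    obtain ⟨v, hvg, hv1, hv2⟩ := hd.inter_open_nonempty _ (isOpen_genericPoints h𝒜 F)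
      (dense_genericPoints h𝒜 F).nonempty
    exact ⟨_, openStratum_subset_stratum h𝒜 F ⟨⟨v, hvg⟩, rfl⟩, hO₁ ⟨v, hvg⟩ hv1, hO₂ ⟨v, hvg⟩ hv2⟩

/-- If `G` is not contained in `F`, the base point `q` is not in `Gᗮ`. If `G < F`, the `F`-th
coordinate is the class of `v`, which has a nonzero component in `G`. Thus no stratum contains
another. -/
theorem eq_of_toAmbient_stratumLift_mem {𝒜 : Set (Submodule ℂ V)} {F G : Submodule ℂ V}
    (hF : F ∈ irreducibles 𝒜) (hG : G ∈ irreducibles 𝒜) {v : genericPoints 𝒜 F}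
    (h : (stratumLift 𝒜 F v).toAmbient ∈ closedLocus 𝒜 G) : G = F := by
  obtain ⟨h1, h2⟩ := toAmbient_mem_closedLocus.mp h
  have hGF : G ≤ F := by
    by_contra hle
    exact starProjection_notMem_orthogonal_of_generic v.2 hG hle h1
  by_contra hne
  have h3 := h2 ⟨F, hF⟩ (lt_of_le_of_ne hGF hne)
  change dualPart F ((stratumCoord 𝒜 F v).2 ⟨F, hF⟩) ∈ Gᗮ at h3
  rw [stratumCoord_snd_of_le 𝒜 (D := ⟨F, hF⟩) le_rfl, dualPart_mk,
    ← Submodule.starProjection_apply_eq_zero_iff, starProjection_starProjection_of_le hGF,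
    Submodule.starProjection_apply_eq_zero_iff] at h3
  exact notMem_orthogonal_of_generic v.2 hG hGF h3

/-- Finitely many Zariski closed loci cover the boundary, so an irreducible set lies in one of them.
-/
theorem exists_subset_stratum {𝒜 : Set (Submodule ℂ V)} (h𝒜 : IsReflectionArrangement 𝒜)
    {Y : Set (Ambient 𝒜)} (hY : Y ⊆ boundary 𝒜) (hirr : @IsIrreducible _ (zariski 𝒜) Y) :
    ∃ G ∈ irreducibles 𝒜, Y ⊆ stratum 𝒜 G := by
  classical
  have hfin := irreducibles_finite h𝒜.finite
  obtain ⟨Z, hZ, hYZ⟩ := (@isIrreducible_iff_sUnion_isClosed _ (zariski 𝒜) Y).mp hirr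
    (hfin.toFinset.image (closedLocus 𝒜)) (by
      intro Z hZ
      obtain ⟨G, -, rfl⟩ := Finset.mem_image.mp hZ
      exact isClosed_zariski_closedLocus 𝒜 G) (by
      intro p hp
      obtain ⟨G, hG, hpG⟩ := exists_mem_stratum_of_mem_boundary h𝒜 (hY hp)
      exact ⟨closedLocus 𝒜 G, by simpa using ⟨G, hG, rfl⟩, hpG.2⟩)
  obtain ⟨G, hG, rfl⟩ := Finset.mem_image.mp hZ
  exact ⟨G, by simpa using hG, fun p hp => ⟨(hY hp).1, hYZ hp⟩⟩

theorem isBoundaryComponent_stratum {𝒜 : Set (Submodule ℂ V)} (h𝒜 : IsReflectionArrangement 𝒜)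
    {F : Submodule ℂ V} (hF : F ∈ irreducibles 𝒜) : IsBoundaryComponent 𝒜 (stratum 𝒜 F) := by
  refine ⟨⟨stratum_subset_boundary hF, isIrreducible_stratum h𝒜 hF⟩, ?_⟩
  rintro Y ⟨hY, hirr⟩ hFY
  obtain ⟨G, hG, hYG⟩ := exists_subset_stratum h𝒜 hY hirr
  obtain ⟨v, hv⟩ := (dense_genericPoints h𝒜 F).nonempty
  have hmem := (hYG (hFY (openStratum_subset_stratum h𝒜 F ⟨⟨v, hv⟩, rfl⟩))).2
  obtain rfl := eq_of_toAmbient_stratumLift_mem hF hG hmem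
  exact hYG

theorem isBoundaryComponent_iff {𝒜 : Set (Submodule ℂ V)} (h𝒜 : IsReflectionArrangement 𝒜)
    {Z : Set (Ambient 𝒜)} :
    IsBoundaryComponent 𝒜 Z ↔ ∃ F ∈ irreducibles 𝒜, Z = stratum 𝒜 F := by
  constructor
  · intro h
    obtain ⟨G, hG, hZG⟩ := exists_subset_stratum h𝒜 h.1.1 h.1.2
    exact ⟨G, hG, Set.Subset.antisymm hZG
      (h.2 ⟨stratum_subset_boundary hG, isIrreducible_stratum h𝒜 hG⟩ hZG)⟩
  · rintro ⟨F, hF, rfl⟩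
    exact isBoundaryComponent_stratum h𝒜 hF

theorem isDivisorOf_iff {𝒜 : Set (Submodule ℂ V)} (h𝒜 : IsReflectionArrangement 𝒜)
    {F : Submodule ℂ V} (hF : F ∈ irreducibles 𝒜) {Z : Set (Ambient 𝒜)} :
    IsDivisorOf 𝒜 F Z ↔ Z = stratum 𝒜 F := by
  constructor
  · rintro ⟨hZ, himg⟩
    obtain ⟨G, hG, rfl⟩ := (isBoundaryComponent_iff h𝒜).mp hZ
    rw [image_fst_stratum h𝒜] at himg
    have h1 : Gᗮ = Fᗮ := SetLike.coe_injective himg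
    have h2 := congrArg Submodule.orthogonal h1
    rw [Submodule.orthogonal_orthogonal, Submodule.orthogonal_orthogonal] at h2
    rw [h2]
  · rintro rfl
    exact ⟨isBoundaryComponent_stratum h𝒜 hF, image_fst_stratum h𝒜 F⟩

theorem stratum_injOn {𝒜 : Set (Submodule ℂ V)} (h𝒜 : IsReflectionArrangement 𝒜)
    {F G : Submodule ℂ V} (h : stratum 𝒜 F = stratum 𝒜 G) : F = G := by
  have h0 := image_fst_stratum h𝒜 F
  rw [h, image_fst_stratum h𝒜 G] at h0
  have h2 := congrArg Submodule.orthogonal (SetLike.coe_injective h0)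
  rw [Submodule.orthogonal_orthogonal, Submodule.orthogonal_orthogonal] at h2
  exact h2.symm

end Zariski

/-! ### First order behaviour of transversal discs -/

section Discs

variable {V : Type*} [NormedAddCommGroup V] [InnerProductSpace ℂ V] [FiniteDimensional ℂ V]

namespace IsTransversalDisc

variable {𝒜 : Set (Submodule ℂ V)} {F : Submodule ℂ V} {Φ : ℂ → HomCoord 𝒜}

theorem differentiableAt_fst {Z : Set (Ambient 𝒜)} (hΦ : IsTransversalDisc 𝒜 Z Φ) :
    DifferentiableAt ℂ (fun s => (Φ s).1.1) 0 :=
  hΦ.holomorphic_fst.differentiableAt (isOpen_ball.mem_nhds (mem_ball_self one_pos))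

theorem differentiableAt_dualPart {Z : Set (Ambient 𝒜)} (hΦ : IsTransversalDisc 𝒜 Z Φ)
    (D : irreducibles 𝒜) :
    DifferentiableAt ℂ (fun s => dualPart (D : Submodule ℂ V) ((Φ s).1.2 D)) 0 :=
  ((dualPart (D : Submodule ℂ V)).differentiable.comp_differentiableOn
    (hΦ.holomorphic_snd D)).differentiableAt (isOpen_ball.mem_nhds (mem_ball_self one_pos))

theorem eventually_mem_range {Z : Set (Ambient 𝒜)} (hΦ : IsTransversalDisc 𝒜 Z Φ) :
    ∀ᶠ s in 𝓝[≠] (0 : ℂ), (Φ s).toAmbient ∈ Set.range (embed 𝒜) := by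
  filter_upwards [self_mem_nhdsWithin, nhdsWithin_le_nhds (ball_mem_nhds (0 : ℂ) one_pos)]
    with s hs hs1
  exact hΦ.punctured s hs1 hs

theorem center_fst_mem (hΦ : IsTransversalDisc 𝒜 (stratum 𝒜 F) Φ) : (Φ 0).1.1 ∈ Fᗮ :=
  hΦ.center_mem.2.1

theorem eq_of_center_mem (h𝒜 : IsReflectionArrangement 𝒜)
    (hΦ : IsTransversalDisc 𝒜 (stratum 𝒜 F) Φ) {G : Submodule ℂ V} (hG : G ∈ irreducibles 𝒜)
    (h : (Φ 0).toAmbient ∈ stratum 𝒜 G) : G = F := by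
  by_contra hne
  exact hΦ.center_notMem _ (isBoundaryComponent_stratum h𝒜 hG)
    (fun h' => hne (stratum_injOn h𝒜 h')) h

/-- Otherwise the centre would lie on the stratum of some irreducible `G ≥ Hᗮ`, which must be `F`.
-/
theorem center_fst_notMem (h𝒜 : IsReflectionArrangement 𝒜)
    (hΦ : IsTransversalDisc 𝒜 (stratum 𝒜 F) Φ) {H : Submodule ℂ V} (hH : H ∈ 𝒜)
    (hHF : ¬ Hᗮ ≤ F) : (Φ 0).1.1 ∉ H := by
  intro hmem
  obtain ⟨G, hG, hHG, hp⟩ := exists_mem_stratum h𝒜 (h𝒜.orthogonal_irreducible hH)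
    hΦ.center_mem.1 (show (Φ 0).1.1 ∈ Hᗮᗮ by rwa [Submodule.orthogonal_orthogonal])
  obtain rfl := hΦ.eq_of_center_mem h𝒜 hG hp
  exact hHF hHG

theorem center_fst_notMem_orthogonal (h𝒜 : IsReflectionArrangement 𝒜)
    (hΦ : IsTransversalDisc 𝒜 (stratum 𝒜 F) Φ) {D : Submodule ℂ V} (hD : D ∈ irreducibles 𝒜)
    (hDF : ¬ D ≤ F) : (Φ 0).1.1 ∉ Dᗮ := by
  obtain ⟨H, hH, hHD, hHF⟩ := exists_orthogonal_le_not_le hD hDF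
  exact notMem_orthogonal_of_orthogonal_le hHD (hΦ.center_fst_notMem h𝒜 hH hHF)

theorem eventually_mem_genericPoints (h𝒜 : IsReflectionArrangement 𝒜)
    (hΦ : IsTransversalDisc 𝒜 (stratum 𝒜 F) Φ) :
    ∀ᶠ s in 𝓝[≠] (0 : ℂ), (Φ s).1.1 ∈ genericPoints 𝒜 F := by
  have h1 : ∀ᶠ s in 𝓝[≠] (0 : ℂ), ∀ H ∈ 𝒜, ¬ Hᗮ ≤ F → Fᗮ.starProjection (Φ s).1.1 ∉ H := by
    refine (eventually_all_finite h𝒜.finite).mpr fun H hH => ?_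
    by_cases hHF : Hᗮ ≤ F
    · exact Eventually.of_forall fun s h => (h hHF).elim
    have hc : ContinuousAt (fun s => Fᗮ.starProjection (Φ s).1.1) 0 :=
      (ContinuousLinearMap.continuous Fᗮ.starProjection).continuousAt.comp
        hΦ.differentiableAt_fst.continuousAt
    refine (Tendsto.eventually_mem (hc.tendsto.mono_left nhdsWithin_le_nhds)
      ((Submodule.closed_of_finiteDimensional H).isOpen_compl.mem_nhds ?_)).mono fun s hs _ => hs
    rw [Submodule.starProjection_eq_self_iff.mpr hΦ.center_fst_mem]
    exact hΦ.center_fst_notMem h𝒜 hH hHF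
  filter_upwards [h1, hΦ.eventually_mem_range] with s hs hr
  exact mem_genericPoints.mpr ⟨fun H hH _ => (toAmbient_mem_range_embed.mp hr).1 H hH, hs⟩

/-- Near its centre the disc can be replaced, without changing its first order jet as long as the
component of its velocity in `F` vanishes, by a disc inside the stratum. -/
theorem exists_hasDerivAt_coord (h𝒜 : IsReflectionArrangement 𝒜)
    (hΦ : IsTransversalDisc 𝒜 (stratum 𝒜 F) Φ)
    (h0 : F.starProjection (deriv (fun s => (Φ s).1.1) 0) = 0) (D : irreducibles 𝒜) :
    ∃ (f : ℂ → V) (f' : V), HasDerivAt f f' 0 ∧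
      HasDerivAt (fun s => dualPart (D : Submodule ℂ V) ((Φ s).1.2 D)) f' 0 ∧
      f 0 = dualPart (D : Submodule ℂ V) ((Φ 0).1.2 D) ∧
      ∀ᶠ s in 𝓝[≠] (0 : ℂ), ∃ c : ℂ, c ≠ 0 ∧
        Submodule.Quotient.mk (f s) = c • (stratumCoord 𝒜 F (Φ s).1.1).2 D := by
  have hk := (hΦ.differentiableAt_dualPart D).hasDerivAt
  have hne : ∀ (s : ℂ) (c : ℂ), (Φ s).1.2 D = c • Submodule.Quotient.mk (Φ s).1.1 → c ≠ 0 := by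
    rintro s c hc rfl
    exact (Φ s).2 D (by rw [hc, zero_smul])
  by_cases hDF : (D : Submodule ℂ V) ≤ F
  · refine ⟨_, _, hk, hk, rfl, ?_⟩
    filter_upwards [hΦ.eventually_mem_range] with s hs
    obtain ⟨c, hc⟩ := (toAmbient_mem_range_embed.mp hs).2 D
    exact ⟨c, hne s c hc, by rw [mk_dualPart, hc, stratumCoord_snd_of_le 𝒜 hDF]⟩
  set P := (D : Submodule ℂ V).starProjection with hP
  set g := P (Φ 0).1.1 with hg
  have hg0 : g ≠ 0 := fun h => hΦ.center_fst_notMem_orthogonal h𝒜 D.2 hDF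
    ((Submodule.starProjection_apply_eq_zero_iff _).mp h)
  have hv := hΦ.differentiableAt_fst.hasDerivAt
  have hPv : HasDerivAt (fun s => P (Φ s).1.1) (P (deriv (fun s => (Φ s).1.1) 0)) 0 :=
    P.hasFDerivAt.comp_hasDerivAt 0 hv
  have hw : HasDerivAt (fun s => F.starProjection (Φ s).1.1) 0 0 := by
    have := F.starProjection.hasFDerivAt.comp_hasDerivAt 0 hv
    rwa [h0] at this
  have hw0 : F.starProjection (Φ 0).1.1 = 0 :=
    (Submodule.starProjection_apply_eq_zero_iff _).mpr hΦ.center_fst_mem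
  have hnum := ((innerSL ℂ g).hasFDerivAt.comp_hasDerivAt 0 hk).differentiableAt
  have hden := ((innerSL ℂ g).hasFDerivAt.comp_hasDerivAt 0 hPv).differentiableAt
  have hden0 : innerSL ℂ g (P (Φ 0).1.1) ≠ 0 := inner_self_ne_zero.mpr hg0
  -- For `s ≠ 0` this is the scale of the `D`-th coordinate relative to the class of `v(s)`; the
  -- quotient formula makes it differentiable at `0`. Subtracting `c` times the `F`-component costs
  -- nothing to first order, since that component vanishes at `0` together with its derivative.
  set c : ℂ → ℂ := fun s => innerSL ℂ g (dualPart (D : Submodule ℂ V) ((Φ s).1.2 D)) /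
    innerSL ℂ g (P (Φ s).1.1) with hcdef
  have hc : DifferentiableAt ℂ c 0 := hnum.div hden hden0
  have hcw : HasDerivAt (fun s => c s • F.starProjection (Φ s).1.1) 0 0 := by
    have := hc.hasDerivAt.smul hw
    simp only [hw0, smul_zero, add_zero] at this
    exact this
  refine ⟨fun s => dualPart (D : Submodule ℂ V) ((Φ s).1.2 D) - c s • F.starProjection (Φ s).1.1,
    _, hk.sub hcw, by simpa using hk, by simp [hw0], ?_⟩
  have hcont : ∀ᶠ s in 𝓝[≠] (0 : ℂ), innerSL ℂ g (P (Φ s).1.1) ≠ 0 :=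
    (hden.continuousAt.tendsto.mono_left nhdsWithin_le_nhds).eventually_ne hden0
  filter_upwards [hΦ.eventually_mem_range, hcont] with s hs hs0
  obtain ⟨a, ha⟩ := (toAmbient_mem_range_embed.mp hs).2 D
  have hca : c s = a := by
    simp only [hcdef]
    rw [ha, map_smul, dualPart_mk, map_smul, smul_eq_mul, mul_div_assoc, div_self hs0, mul_one]
  refine ⟨a, hne s a ha, ?_⟩
  rw [stratumCoord_snd_of_not_le 𝒜 hDF, Submodule.Quotient.mk_sub, mk_dualPart, hca, ha,
    Submodule.Quotient.mk_smul, ← smul_sub, ← Submodule.Quotient.mk_sub]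
  congr 2
  rw [sub_eq_iff_eq_add']
  exact (add_starProjection F _).symm

/-- If the velocity had no `F`-component, the disc would have the same first order jet as a curve
inside the stratum. Every polynomial vanishing on the stratum would then have zero derivative along
the disc, against transversality. -/
theorem starProjection_deriv_ne_zero (h𝒜 : IsReflectionArrangement 𝒜)
    (hΦ : IsTransversalDisc 𝒜 (stratum 𝒜 F) Φ) :
    F.starProjection (deriv (fun s => (Φ s).1.1) 0) ≠ 0 := by
  intro h0
  obtain ⟨p, hp, hpZ, hpd⟩ := hΦ.transversal
  have : Finite (irreducibles 𝒜) := irreducibles_finite h𝒜.finite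
  have := Fintype.ofFinite (irreducibles 𝒜)
  -- Quotient coordinates are represented by vectors of `V`, so that the disc and the comparison
  -- curve have literally the same value and velocity at `0`.
  let Θ : (V × (irreducibles 𝒜 → V)) →ₗ[ℂ] CoordSpace 𝒜 :=
    LinearMap.prodMap LinearMap.id (LinearMap.pi fun D =>
      (D : Submodule ℂ V)ᗮ.mkQ ∘ₗ LinearMap.proj D)
  have hΘ : ∀ (v : V) (k : irreducibles 𝒜 → V),
      Θ (v, k) = (v, fun D => Submodule.Quotient.mk (k D)) := fun v k => rfl
  choose f f' hf hk hf0 hfs using hΦ.exists_hasDerivAt_coord h𝒜 h0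
  have hv := hΦ.differentiableAt_fst.hasDerivAt
  set v' := deriv (fun s => (Φ s).1.1) 0 with hv'
  have hq : HasDerivAt (fun s => Fᗮ.starProjection (Φ s).1.1) v' 0 := by
    have h1 := Fᗮ.starProjection.hasFDerivAt.comp_hasDerivAt 0 hv
    have h2 : Fᗮ.starProjection v' = v' := by
      have := add_starProjection F v'
      rwa [h0, zero_add] at this
    rwa [h2] at h1
  have hA : HasDerivAt (fun s => ((Φ s).1.1, fun D : irreducibles 𝒜 =>
      dualPart (D : Submodule ℂ V) ((Φ s).1.2 D))) (v', f') 0 :=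
    hv.prodMk (hasDerivAt_pi.mpr hk)
  have hB : HasDerivAt (fun s => (Fᗮ.starProjection (Φ s).1.1, fun D => f D s)) (v', f') 0 :=
    hq.prodMk (hasDerivAt_pi.mpr hf)
  have hcenter : Fᗮ.starProjection (Φ 0).1.1 = (Φ 0).1.1 :=
    Submodule.starProjection_eq_self_iff.mpr hΦ.center_fst_mem
  have hBA : (Fᗮ.starProjection (Φ 0).1.1, fun D => f D 0) = ((Φ 0).1.1,
      fun D : irreducibles 𝒜 => dualPart (D : Submodule ℂ V) ((Φ 0).1.2 D)) := by
    rw [hcenter]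
    simp only [hf0]
  have hp' : ∀ x, DifferentiableAt ℂ (fun x => p (Θ x)) x := fun x =>
    (analyticOnNhd_of_mem_polynomialFunctions (comp_mem_polynomialFunctions Θ hp) x
      (Set.mem_univ x)).differentiableAt
  have hpA := (hp' _).hasFDerivAt.comp_hasDerivAt (0 : ℂ) hA
  have hΘA : ∀ s, Θ ((Φ s).1.1, fun D : irreducibles 𝒜 =>
      dualPart (D : Submodule ℂ V) ((Φ s).1.2 D)) = (Φ s).1 := by
    intro s
    rw [hΘ]
    simp only [mk_dualPart]
  have hΘB0 : Θ (Fᗮ.starProjection (Φ 0).1.1, fun D => f D 0) = (Φ 0).1 := by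
    rw [hBA, hΘA]
  have hfd : fderiv ℂ (fun x => p (Θ x)) (Fᗮ.starProjection (Φ 0).1.1, fun D => f D 0) (v', f') = 0 := by
    have hpB := (hp' _).hasFDerivAt.comp_hasDerivAt (0 : ℂ) hB
    have hzero : (fun s => p (Θ (Fᗮ.starProjection (Φ s).1.1, fun D => f D s))) =ᶠ[𝓝 0]
        fun _ => 0 := by
      have hev := (eventually_all.mpr hfs).and (hΦ.eventually_mem_genericPoints h𝒜)
      rw [eventually_nhdsWithin_iff] at hev
      filter_upwards [hev] with s hs
      by_cases hs0 : s = 0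
      · subst hs0
        rw [hΘB0]
        exact hpZ _ hΦ.center_mem
      obtain ⟨h1, h2⟩ := hs hs0
      rw [hΘ]
      refine hpZ ⟨_, fun D => ?_⟩ (openStratum_subset_stratum h𝒜 F ⟨⟨_, h2⟩, ?_⟩)
      · obtain ⟨c, hc0, hc⟩ := h1 D
        change (Submodule.Quotient.mk (f D s) : V ⧸ (D : Submodule ℂ V)ᗮ) ≠ 0
        rw [hc]
        exact smul_ne_zero hc0 (stratumCoord_snd_ne_zero h2 D)
      · symm
        refine toAmbient_eq_iff.mpr ⟨rfl, fun D => ?_⟩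
        obtain ⟨c, -, hc⟩ := h1 D
        exact ⟨c, hc.symm⟩
    exact hpB.unique ((hasDerivAt_const (0 : ℂ) (0 : ℂ)).congr_of_eventuallyEq hzero)
  refine hpd ?_
  have h3 : (fun s => p (Φ s).1) = (fun x => p (Θ x)) ∘ (fun s => ((Φ s).1.1,
      fun D : irreducibles 𝒜 => dualPart (D : Submodule ℂ V) ((Φ s).1.2 D))) := by
    funext s
    exact congrArg p (hΘA s).symm
  rw [h3, hpA.deriv, ← hBA, hfd]

/-- The component in `F` of the velocity of a transversal disc is generic. -/
theorem starProjection_deriv_notMem (h𝒜 : IsReflectionArrangement 𝒜) (hF : F ∈ irreducibles 𝒜)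
    (hΦ : IsTransversalDisc 𝒜 (stratum 𝒜 F) Φ) {H : Submodule ℂ V} (hH : H ∈ 𝒜) (hHF : Hᗮ ≤ F) :
    F.starProjection (deriv (fun s => (Φ s).1.1) 0) ∉ H := by
  set u := F.starProjection (deriv (fun s => (Φ s).1.1) 0) with hu
  intro hmem
  have hu0 : u ≠ 0 := hΦ.starProjection_deriv_ne_zero h𝒜
  have huF : u ∈ F := Submodule.starProjection_apply_mem _ _
  -- If `u` lay on `H`, the centre would also lie on the stratum of this `G`, which differs from `F`
  -- because `u` is a nonzero vector of `F`. The coordinates at `D > G` remain to be checked.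
  obtain ⟨G, hG, hHG, hGF, huG, hmax⟩ := h𝒜.exists_maximal (h𝒜.orthogonal_irreducible hH) hHF
    (show u ∈ Hᗮᗮ by rwa [Submodule.orthogonal_orthogonal])
  have hne : G ≠ F := by
    rintro rfl
    have : u ∈ G ⊓ Gᗮ := ⟨huF, huG⟩
    rw [Submodule.inf_orthogonal_eq_bot, Submodule.mem_bot] at this
    exact hu0 this
  refine hne (hΦ.eq_of_center_mem h𝒜 hG ⟨hΦ.center_mem.1, toAmbient_mem_closedLocus.mpr
    ⟨Submodule.orthogonal_le hGF hΦ.center_fst_mem, fun D hGD => ?_⟩⟩)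
  rw [← Submodule.starProjection_apply_eq_zero_iff]
  set P := (D : Submodule ℂ V).starProjection with hP
  by_cases hDF : (D : Submodule ℂ V) ≤ F
  · have hw : DifferentiableAt ℂ (fun s => F.starProjection (Φ s).1.1) 0 :=
      F.starProjection.differentiableAt.comp 0 hΦ.differentiableAt_fst
    have hwd : deriv (fun s => F.starProjection (Φ s).1.1) 0 = u :=
      (F.starProjection.hasFDerivAt.comp_hasDerivAt 0 hΦ.differentiableAt_fst.hasDerivAt).deriv
    have hw0 : F.starProjection (Φ 0).1.1 = 0 :=
      (Submodule.starProjection_apply_eq_zero_iff _).mpr hΦ.center_fst_mem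
    -- For `D ≤ F` the vector `P v(s) / s` represents the `D`-th coordinate and extends continuously
    -- by `P u`, nonzero by maximality of `G`. The coordinate of the centre is thus proportional to
    -- `P u`, which is orthogonal to `G`.
    set r : ℂ → V := fun s => P (dslope (fun s => F.starProjection (Φ s).1.1) 0 s) with hr
    have hrc : ContinuousAt r 0 := P.continuous.continuousAt.comp
      (continuousAt_dslope_same.mpr hw)
    have hr0 : r 0 = P u := by simp only [hr, dslope_same, hwd]
    set k : ℂ → V := fun s => dualPart (D : Submodule ℂ V) ((Φ s).1.2 D) with hk
    have hkc : ContinuousAt k 0 := (hΦ.differentiableAt_dualPart D).continuousAt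
    have hrel : ∀ᶠ s in 𝓝[≠] (0 : ℂ), inner ℂ (r s) (r s) • k s = inner ℂ (r s) (k s) • r s := by
      filter_upwards [hΦ.eventually_mem_range, self_mem_nhdsWithin] with s hs hs0
      obtain ⟨a, ha⟩ := (toAmbient_mem_range_embed.mp hs).2 D
      have hrs : r s = s⁻¹ • P (Φ s).1.1 := by
        simp only [hr]
        rw [dslope_of_ne _ hs0, slope_def_module, sub_zero, hw0, sub_zero, map_smul]
        congr 1
        have hq : P (Fᗮ.starProjection (Φ s).1.1) = 0 :=
          (Submodule.starProjection_apply_eq_zero_iff _).mpr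
            (Submodule.orthogonal_le hDF (Submodule.starProjection_apply_mem _ _))
        nth_rewrite 2 [← add_starProjection F (Φ s).1.1]
        rw [map_add, hq, add_zero]
      have hks : k s = (a * s) • r s := by
        rw [hrs, smul_smul, mul_assoc, mul_inv_cancel₀ hs0, mul_one]
        simp only [hk]
        rw [ha, map_smul, dualPart_mk]
      rw [hks, inner_smul_right, smul_smul, mul_comm]
    have hlim : inner ℂ (r 0) (r 0) • k 0 = inner ℂ (r 0) (k 0) • r 0 := by
      refine tendsto_nhds_unique_of_eventuallyEq (l := 𝓝[≠] (0 : ℂ)) ?_ ?_ hrel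
      · exact ((hrc.inner hrc).smul hkc).tendsto.mono_left nhdsWithin_le_nhds
      · exact ((hrc.inner hkc).smul hrc).tendsto.mono_left nhdsWithin_le_nhds
    have hPu : P u ≠ 0 := fun h =>
      hmax D D.2 hGD hDF ((Submodule.starProjection_apply_eq_zero_iff _).mp h)
    have hGr : G.starProjection (r 0) = 0 := by
      rw [hr0, starProjection_starProjection_of_le hGD.le]
      exact (Submodule.starProjection_apply_eq_zero_iff _).mpr huG
    have h1 := congrArg G.starProjection hlim
    rw [map_smul, map_smul, hGr, smul_zero, hr0] at h1
    exact (smul_eq_zero.mp h1).resolve_left (inner_self_ne_zero.mpr hPu)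
  -- For other `D` the coordinate of the centre is determined by its point in `V`, which lies in `Fᗮ
  -- ≤ Gᗮ`.
  · obtain ⟨c, hc⟩ := exists_smul_eq_of_mem_wonderfulModel h𝒜.finite hΦ.center_mem.1 D
      (hΦ.center_fst_notMem_orthogonal h𝒜 D.2 hDF)
    rw [hc, map_smul, map_smul, dualPart_mk, starProjection_starProjection_of_le hGD.le,
      (Submodule.starProjection_apply_eq_zero_iff _).mpr
        (Submodule.orthogonal_le hGF hΦ.center_fst_mem), smul_zero]

end IsTransversalDisc

/-- A linear transversal disc. -/
theorem exists_isTransversalDisc {𝒜 : Set (Submodule ℂ V)} (h𝒜 : IsReflectionArrangement 𝒜)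
    {F : Submodule ℂ V} (hF : F ∈ irreducibles 𝒜) {v : V} (hv : v ∈ genericPoints 𝒜 F)
    (h : ∀ s : ℂ, s ≠ 0 → ‖s‖ < 1 →
      Fᗮ.starProjection v + s • F.starProjection v ∈ complement 𝒜) :
    ∃ Φ, IsTransversalDisc 𝒜 (stratum 𝒜 F) Φ ∧
      ∀ s ∈ ball (0 : ℂ) 1, (Φ s).1.1 = Fᗮ.starProjection v + s • F.starProjection v := by
  classical
  set q := Fᗮ.starProjection v with hq
  set w := F.starProjection v with hw
  have hwq : w + q = v := add_starProjection F v
  have hqF : q ∈ Fᗮ := Submodule.starProjection_apply_mem _ _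
  let f : ℂ → CoordSpace 𝒜 := fun s => (q + s • w, fun D =>
    if (D : Submodule ℂ V) ≤ F then Submodule.Quotient.mk v else Submodule.Quotient.mk (q + s • w))
  have hf0 : f 0 = stratumCoord 𝒜 F v := by
    refine Prod.ext (by simp [f, hq]) (funext fun D => ?_)
    by_cases h : (D : Submodule ℂ V) ≤ F
    · simp [f, stratumCoord_snd_of_le 𝒜 h, h]
    · simp [f, stratumCoord_snd_of_not_le 𝒜 h, h, hq]
  have hf : ∀ s : ℂ, ‖s‖ < 1 → ∀ D, (f s).2 D ≠ 0 := by
    intro s hs D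
    by_cases hs0 : s = 0
    · subst hs0
      rw [hf0]
      exact stratumCoord_snd_ne_zero hv D
    by_cases hD : (D : Submodule ℂ V) ≤ F
    · simp only [f, hD, if_true, Ne, Submodule.Quotient.mk_eq_zero]
      exact notMem_orthogonal_of_generic hv D.2 hD
    · simp only [f, hD, if_false, Ne, Submodule.Quotient.mk_eq_zero]
      exact notMem_orthogonal (h s hs0 hs) D.2
  -- A lift has to have nonzero coordinates for all `s : ℂ`, so outside the unit disc it takes the
  -- value at the centre.
  let z : ℂ → ℂ := fun s => if ‖s‖ < 1 then s else 0
  have hz : ∀ s, ‖z s‖ < 1 := by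
    intro s
    simp only [z]
    split_ifs with hs
    · exact hs
    · simp
  have hzs : ∀ s ∈ ball (0 : ℂ) 1, z s = s := by
    intro s hs
    simp only [z, if_pos (mem_ball_zero_iff.mp hs)]
  let Φ : ℂ → HomCoord 𝒜 := fun s => ⟨f (z s), hf _ (hz s)⟩
  have hΦ : ∀ s ∈ ball (0 : ℂ) 1, (Φ s).1 = f s := fun s hs => by
    simp only [Φ]; rw [hzs s hs]
  have hcenter : Φ 0 = stratumLift 𝒜 F ⟨v, hv⟩ := by
    refine Subtype.ext ?_
    rw [hΦ 0 (mem_ball_self one_pos), hf0]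
    rfl
  have hw0 : w ≠ 0 := by
    intro h0
    obtain ⟨H, hH, hHF⟩ := exists_orthogonal_le hF
    refine (mem_genericPoints.mp hv).1 H hH hHF (orthogonal_le_of_orthogonal_le hHF ?_)
    rw [← hwq, h0, zero_add]
    exact hqF
  refine ⟨Φ, ⟨?_, fun D => ?_, ?_, ?_, ?_, ?_⟩, fun s hs => by rw [hΦ s hs]⟩
  · have : DifferentiableOn ℂ (fun s : ℂ => q + s • w) (ball 0 1) := by fun_prop
    exact this.congr fun s hs => by rw [hΦ s hs]
  · by_cases hD : (D : Submodule ℂ V) ≤ F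
    · have : DifferentiableOn ℂ (fun s : ℂ => (Submodule.Quotient.mk v :
          V ⧸ (D : Submodule ℂ V)ᗮ)) (ball 0 1) := differentiableOn_const _
      exact this.congr fun s hs => by rw [hΦ s hs]; simp only [f, hD, if_true]
    · have : DifferentiableOn ℂ (fun s : ℂ => (D : Submodule ℂ V)ᗮ.mkQL (q + s • w)) (ball 0 1) :=
        (D : Submodule ℂ V)ᗮ.mkQL.differentiable.comp_differentiableOn (by fun_prop)
      exact this.congr fun s hs => by rw [hΦ s hs]; simp only [f, hD, if_false]; rfl
  · rw [hcenter]
    exact openStratum_subset_stratum h𝒜 F ⟨_, rfl⟩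
  · rintro Z' hZ' hne hmem
    obtain ⟨G, hG, rfl⟩ := (isBoundaryComponent_iff h𝒜).mp hZ'
    rw [hcenter] at hmem
    exact hne (by rw [eq_of_toAmbient_stratumLift_mem hF hG hmem.2])
  · intro s hs hs0
    have hmem := h s hs0 (mem_ball_zero_iff.mp hs)
    refine toAmbient_mem_range_embed.mpr ?_
    rw [hΦ s hs]
    refine ⟨hmem, fun D => ?_⟩
    by_cases hD : (D : Submodule ℂ V) ≤ F
    · refine ⟨s⁻¹, ?_⟩
      simp only [f, hD, if_true]
      have hqD : (Submodule.Quotient.mk q : V ⧸ (D : Submodule ℂ V)ᗮ) = 0 :=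
        (Submodule.Quotient.mk_eq_zero _).mpr (Submodule.orthogonal_le hD hqF)
      rw [← hwq, Submodule.Quotient.mk_add, Submodule.Quotient.mk_add, hqD, zero_add, add_zero,
        Submodule.Quotient.mk_smul, smul_smul, inv_mul_cancel₀ hs0, one_smul]
    · exact ⟨1, by simp only [f, hD, if_false, one_smul]⟩
  -- The linear form `⟨w, ·⟩` vanishes on the stratum, whose image is in `Fᗮ`, and has derivative
  -- `‖w‖² ≠ 0` along the disc.
  · refine ⟨_, dual_mem_polynomialFunctions ((innerSL ℂ w : V →ₗ[ℂ] ℂ) ∘ₗ LinearMap.fst ℂ _ _),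
      fun y hy => ?_, ?_⟩
    · exact Submodule.inner_right_of_mem_orthogonal (Submodule.starProjection_apply_mem _ _) hy.2.1
    · have hd : HasDerivAt (fun s : ℂ => innerSL ℂ w (q + s • w)) (innerSL ℂ w w) 0 := by
        refine (innerSL ℂ w).hasFDerivAt.comp_hasDerivAt 0 ?_
        simpa using ((hasDerivAt_id (0 : ℂ)).smul_const w).const_add q
      have heq : (fun s => ((innerSL ℂ w : V →ₗ[ℂ] ℂ) ∘ₗ LinearMap.fst ℂ _ _) (Φ s).1) =ᶠ[𝓝 0]
          fun s : ℂ => innerSL ℂ w (q + s • w) := by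
        filter_upwards [ball_mem_nhds (0 : ℂ) one_pos] with s hs
        rw [hΦ s hs]
        rfl
      rw [heq.deriv_eq, hd.deriv]
      exact inner_self_ne_zero.mpr hw0

end Discs

open unitInterval

/-! ### Free homotopy and conjugacy of loop classes -/

section FreeHomotopy

variable {X : Type*} [TopologicalSpace X]

/-- A free homotopy of loops, along the path `γ` described by the base points. -/
theorem trans_eq_trans_of_freeHomotopy {x y : X} (ℓ : Path x x) (ℓ' : Path y y) (γ : Path x y)
    (F : C(I × I, X)) (h0 : ∀ t, F (0, t) = ℓ t) (h1 : ∀ t, F (1, t) = ℓ' t)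
    (hs0 : ∀ s, F (s, 0) = γ s) (hs1 : ∀ s, F (s, 1) = γ s) :
    (Path.Homotopic.Quotient.mk γ).trans (Path.Homotopic.Quotient.mk ℓ') =
      (Path.Homotopic.Quotient.mk ℓ).trans (Path.Homotopic.Quotient.mk γ) := by
  rw [← Path.Homotopic.Quotient.mk_trans, ← Path.Homotopic.Quotient.mk_trans,
    Path.Homotopic.Quotient.eq]
  -- The two ways around the boundary of the square are homotopic because the square is simply
  -- connected; their images under `F` are the two sides.
  let a : Path ((0, 0) : I × I) (1, 0) :=
    { toFun := fun s => (s, 0), source' := rfl, target' := rfl }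
  let b : Path ((1, 0) : I × I) (1, 1) :=
    { toFun := fun t => (1, t), source' := rfl, target' := rfl }
  let c : Path ((0, 0) : I × I) (0, 1) :=
    { toFun := fun t => (0, t), source' := rfl, target' := rfl }
  let d : Path ((0, 1) : I × I) (1, 1) :=
    { toFun := fun s => (s, 1), source' := rfl, target' := rfl }
  have hx : x = F (0, 0) := by rw [h0, ℓ.source]
  have hy : y = F (1, 1) := by rw [h1, ℓ'.target]
  have : ContractibleSpace I := (convex_Icc (0 : ℝ) 1).contractibleSpace ⟨0, by simp⟩
  have hom := ((SimplyConnectedSpace.paths_homotopic (a.trans b) (c.trans d)).map F).pathCast hx hy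
  convert hom using 1
  · ext t
    simp only [Path.cast_coe, Path.map_coe, Function.comp_apply, Path.trans_apply]
    split_ifs
    · exact (hs0 _).symm
    · exact (h1 _).symm
  · ext t
    simp only [Path.cast_coe, Path.map_coe, Function.comp_apply, Path.trans_apply]
    split_ifs
    · exact (h0 _).symm
    · exact (hs1 _).symm

/-- The loop classes `a` and `b` are conjugate by the class of a path. -/
def LoopConj {x y : X} (a : Path.Homotopic.Quotient x x) (b : Path.Homotopic.Quotient y y) : Prop :=
  ∃ p : Path.Homotopic.Quotient x y, p.trans b = a.trans p

theorem LoopConj.trans {x y z : X} {a : Path.Homotopic.Quotient x x}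
    {b : Path.Homotopic.Quotient y y} {c : Path.Homotopic.Quotient z z} (h : LoopConj a b)
    (h' : LoopConj b c) : LoopConj a c := by
  obtain ⟨p, hp⟩ := h
  obtain ⟨q, hq⟩ := h'
  exact ⟨p.trans q, by rw [Path.Homotopic.Quotient.trans_assoc, hq,
    ← Path.Homotopic.Quotient.trans_assoc, hp, Path.Homotopic.Quotient.trans_assoc]⟩

theorem LoopConj.symm {x y : X} {a : Path.Homotopic.Quotient x x}
    {b : Path.Homotopic.Quotient y y} (h : LoopConj a b) : LoopConj b a := by
  obtain ⟨p, hp⟩ := h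
  refine ⟨p.symm, ?_⟩
  have h1 : (p.symm.trans (p.trans b)).trans p.symm = (p.symm.trans (a.trans p)).trans p.symm := by
    rw [hp]
  rw [← Path.Homotopic.Quotient.trans_assoc p.symm p b, Path.Homotopic.Quotient.symm_trans,
    Path.Homotopic.Quotient.refl_trans, Path.Homotopic.Quotient.trans_assoc,
    Path.Homotopic.Quotient.trans_assoc, Path.Homotopic.Quotient.trans_symm,
    Path.Homotopic.Quotient.trans_refl] at h1
  exact h1.symm

theorem LoopConj.eq_conj {x y : X} {a : Path.Homotopic.Quotient x x}
    {b : Path.Homotopic.Quotient y y} (p : Path.Homotopic.Quotient x y)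
    (hp : p.trans b = a.trans p) : a = p.trans (b.trans p.symm) := by
  rw [← Path.Homotopic.Quotient.trans_assoc, hp, Path.Homotopic.Quotient.trans_assoc,
    Path.Homotopic.Quotient.trans_symm, Path.Homotopic.Quotient.trans_refl]

theorem LoopConj.conj {x y : X} (b : Path.Homotopic.Quotient y y)
    (p : Path.Homotopic.Quotient x y) : LoopConj (p.trans (b.trans p.symm)) b := by
  refine ⟨p, ?_⟩
  rw [Path.Homotopic.Quotient.trans_assoc, Path.Homotopic.Quotient.trans_assoc,
    Path.Homotopic.Quotient.symm_trans, Path.Homotopic.Quotient.trans_refl]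

theorem loopConj_iff_isConj {x : X} {a b : Path.Homotopic.Quotient x x} :
    LoopConj a b ↔ IsConj (FundamentalGroup.fromPath b) (FundamentalGroup.fromPath a) := by
  rw [isConj_comm, isConj_iff]
  -- Multiplication in the fundamental group is concatenation in the reverse order, so `p a = b p`
  -- unfolds to the path identity on the right.
  have key : ∀ p : FundamentalGroup X x, p * FundamentalGroup.fromPath a * p⁻¹ =
      FundamentalGroup.fromPath b ↔
      Path.Homotopic.Quotient.trans p b = Path.Homotopic.Quotient.trans a p := by
    intro p
    rw [mul_inv_eq_iff_eq_mul, eq_comm]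
    exact Iff.rfl
  constructor
  · rintro ⟨p, hp⟩
    exact ⟨p, (key p).mpr hp⟩
  · rintro ⟨p, hp⟩
    exact ⟨p, (key p).mp hp⟩

end FreeHomotopy

/-! ### Linear loops around a stratum and the inertia class -/

section Loops

variable {V : Type*} [NormedAddCommGroup V] [InnerProductSpace ℂ V]

/-- A free homotopy through loops of the complement. -/
theorem loopConj_of_freeHomotopy {𝒜 : Set (Submodule ℂ V)} {x y : complement 𝒜} {ℓ : Path x x}
    {ℓ' : Path y y} (F : I × I → V) (hF : Continuous F) (hmem : ∀ p, F p ∈ complement 𝒜)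
    (h0 : ∀ t, F (0, t) = ℓ t) (h1 : ∀ t, F (1, t) = ℓ' t) (hper : ∀ s, F (s, 0) = F (s, 1)) :
    LoopConj (Path.Homotopic.Quotient.mk ℓ) (Path.Homotopic.Quotient.mk ℓ') := by
  let G : C(I × I, complement 𝒜) := ⟨fun p => ⟨F p, hmem p⟩, by fun_prop⟩
  let γ : Path x y :=
    { toFun := fun s => G (s, 0)
      source' := Subtype.ext (by change F (0, 0) = x; rw [h0, ℓ.source])
      target' := Subtype.ext (by change F (1, 0) = y; rw [h1, ℓ'.source]) }
  exact ⟨_, trans_eq_trans_of_freeHomotopy ℓ ℓ' γ G (fun t => Subtype.ext (h0 t))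
    (fun t => Subtype.ext (h1 t)) (fun s => rfl) (fun s => Subtype.ext (hper s).symm)⟩

/-- The standard parametrization of the unit circle. -/
noncomputable def circ (t : I) : ℂ := Complex.exp (2 * Real.pi * Complex.I * (t : ℝ))

@[fun_prop]
theorem continuous_circ : Continuous circ := by
  unfold circ; fun_prop

theorem norm_circ (t : I) : ‖circ t‖ = 1 := by
  have : (2 * Real.pi * Complex.I * (t : ℝ) : ℂ) = ((2 * Real.pi * t : ℝ) : ℂ) * Complex.I := by
    push_cast; ring
  rw [circ, this, Complex.norm_exp_ofReal_mul_I]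

theorem circ_ne_zero (t : I) : circ t ≠ 0 := Complex.exp_ne_zero _

@[simp]
theorem circ_zero : circ 0 = 1 := by simp [circ]

@[simp]
theorem circ_one : circ 1 = 1 := by simp [circ, Complex.exp_two_pi_mul_I]

variable [FiniteDimensional ℂ V]

/-- The complex disc `q + s w`, `|s| ≤ 1`, through `v = q + w` is transversal to the stratum of
`F`. -/
structure IsTubeVector (𝒜 : Set (Submodule ℂ V)) (F : Submodule ℂ V) (v : V) : Prop where
  generic : v ∈ genericPoints 𝒜 F
  mem : ∀ s : ℂ, s ≠ 0 → ‖s‖ ≤ 1 →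
    Fᗮ.starProjection v + s • F.starProjection v ∈ complement 𝒜

theorem orthogonal_starProjection_add_smul (F : Submodule ℂ V) {q w : V} (hq : q ∈ Fᗮ)
    (hw : w ∈ F) : Fᗮ.starProjection (q + w) = q := by
  rw [map_add, Submodule.starProjection_eq_self_iff.mpr hq,
    (Submodule.starProjection_apply_eq_zero_iff Fᗮ).mpr
      (by rwa [Submodule.orthogonal_orthogonal]), add_zero]

theorem starProjection_add_smul (F : Submodule ℂ V) {q w : V} (hq : q ∈ Fᗮ)
    (hw : w ∈ F) : F.starProjection (q + w) = w := by
  rw [map_add, Submodule.starProjection_eq_self_iff.mpr hw,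
    (Submodule.starProjection_apply_eq_zero_iff F).mpr hq, zero_add]

theorem add_smul_mem_genericPoints {𝒜 : Set (Submodule ℂ V)} {F : Submodule ℂ V} {v : V}
    (hv : v ∈ genericPoints 𝒜 F) {c : ℂ} (hc : c ≠ 0) :
    Fᗮ.starProjection v + c • F.starProjection v ∈ genericPoints 𝒜 F := by
  have hq : Fᗮ.starProjection v ∈ Fᗮ := Submodule.starProjection_apply_mem _ _
  have hw : F.starProjection v ∈ F := Submodule.starProjection_apply_mem _ _
  obtain ⟨h1, h2⟩ := mem_genericPoints.mp hv
  refine mem_genericPoints.mpr ⟨fun H hH hHF hmem => ?_, fun H hH hHF => ?_⟩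
  · have hqH := orthogonal_le_of_orthogonal_le hHF hq
    rw [H.add_mem_iff_right hqH, H.smul_mem_iff hc] at hmem
    refine h1 H hH hHF ?_
    rw [← add_starProjection F v]
    exact H.add_mem hmem hqH
  · rw [orthogonal_starProjection_add_smul F hq (F.smul_mem c hw)]
    exact h2 H hH hHF

theorem isTubeVector_add_smul {𝒜 : Set (Submodule ℂ V)} {F : Submodule ℂ V} {v : V}
    (hv : v ∈ genericPoints 𝒜 F) {δ : ℂ} (hδ : δ ≠ 0)
    (h : ∀ s : ℂ, s ≠ 0 → ‖s‖ ≤ ‖δ‖ →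
      Fᗮ.starProjection v + s • F.starProjection v ∈ complement 𝒜) :
    IsTubeVector 𝒜 F (Fᗮ.starProjection v + δ • F.starProjection v) := by
  have hq : Fᗮ.starProjection v ∈ Fᗮ := Submodule.starProjection_apply_mem _ _
  have hw : F.starProjection v ∈ F := Submodule.starProjection_apply_mem _ _
  refine ⟨add_smul_mem_genericPoints hv hδ, fun s hs0 hs => ?_⟩
  rw [orthogonal_starProjection_add_smul F hq (F.smul_mem δ hw),
    starProjection_add_smul F hq (F.smul_mem δ hw), smul_smul]
  refine h _ (mul_ne_zero hs0 hδ) ?_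
  rw [norm_mul]
  exact mul_le_of_le_one_left (norm_nonneg _) hs

namespace IsTubeVector

variable {𝒜 : Set (Submodule ℂ V)} {F : Submodule ℂ V} {v : V}

theorem circ_mem (hv : IsTubeVector 𝒜 F v) (t : I) :
    Fᗮ.starProjection v + circ t • F.starProjection v ∈ complement 𝒜 :=
  hv.mem _ (circ_ne_zero t) (norm_circ t).le

theorem mem_complement (hv : IsTubeVector 𝒜 F v) : v ∈ complement 𝒜 := by
  have := hv.mem 1 one_ne_zero (by simp)
  rwa [one_smul, add_comm, add_starProjection] at this

/-- The loop `q + exp(2πit) w` around the stratum of `F`. -/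
noncomputable def loop (hv : IsTubeVector 𝒜 F v) :
    Path (⟨v, hv.mem_complement⟩ : complement 𝒜) ⟨v, hv.mem_complement⟩ where
  toFun t := ⟨Fᗮ.starProjection v + circ t • F.starProjection v, hv.circ_mem t⟩
  continuous_toFun := by fun_prop
  source' := Subtype.ext (by
    change _ + circ 0 • _ = v
    rw [circ_zero, one_smul, add_comm, add_starProjection])
  target' := Subtype.ext (by
    change _ + circ 1 • _ = v
    rw [circ_one, one_smul, add_comm, add_starProjection])

theorem loop_apply (hv : IsTubeVector 𝒜 F v) (t : I) :
    (hv.loop t : V) = Fᗮ.starProjection v + circ t • F.starProjection v := rfl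

theorem loopConj_of_path {v' : V} (hv : IsTubeVector 𝒜 F v) (hv' : IsTubeVector 𝒜 F v')
    (η : I → V) (hη : Continuous η) (h : ∀ s, IsTubeVector 𝒜 F (η s)) (h0 : η 0 = v)
    (h1 : η 1 = v') :
    LoopConj (Path.Homotopic.Quotient.mk hv.loop) (Path.Homotopic.Quotient.mk hv'.loop) := by
  subst h0 h1
  refine loopConj_of_freeHomotopy
    (fun p : I × I => Fᗮ.starProjection (η p.1) + circ p.2 • F.starProjection (η p.1))
    (by fun_prop) (fun p => (h p.1).circ_mem p.2) (fun t => rfl) (fun t => rfl) fun s => by simp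

theorem scale (hv : IsTubeVector 𝒜 F v) {δ : ℝ} (hδ : 0 < δ) (hδ1 : δ ≤ 1) :
    IsTubeVector 𝒜 F (Fᗮ.starProjection v + (δ : ℂ) • F.starProjection v) := by
  have hn : ‖(δ : ℂ)‖ = δ := by rw [Complex.norm_real, Real.norm_of_nonneg hδ.le]
  exact isTubeVector_add_smul hv.generic (by exact_mod_cast hδ.ne')
    fun s hs0 hs => hv.mem s hs0 (hs.trans (hn.le.trans hδ1))

theorem loopConj_scale (hv : IsTubeVector 𝒜 F v) {δ : ℝ} (hδ : 0 < δ) (hδ1 : δ ≤ 1) :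
    LoopConj (Path.Homotopic.Quotient.mk hv.loop)
      (Path.Homotopic.Quotient.mk (hv.scale hδ hδ1).loop) := by
  have hpos : ∀ s : I, 0 < 1 - (s : ℝ) * (1 - δ) := fun s => by
    nlinarith [s.2.1, s.2.2]
  have hle : ∀ s : I, 1 - (s : ℝ) * (1 - δ) ≤ 1 := fun s => by
    nlinarith [s.2.1, s.2.2]
  refine loopConj_of_path hv _ (fun s : I => Fᗮ.starProjection v +
    ((1 - (s : ℝ) * (1 - δ) : ℝ) : ℂ) • F.starProjection v) ?_
    (fun s => hv.scale (hpos s) (hle s)) ?_ ?_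
  · fun_prop
  · simp only [Set.Icc.coe_zero, zero_mul, sub_zero, Complex.ofReal_one, one_smul]
    rw [add_comm, add_starProjection]
  · simp

/-- The loops around the stratum of `F` are freely homotopic to each other. -/
theorem loopConj (h𝒜 : IsReflectionArrangement 𝒜) {v' : V} (hv : IsTubeVector 𝒜 F v)
    (hv' : IsTubeVector 𝒜 F v') :
    LoopConj (Path.Homotopic.Quotient.mk hv.loop) (Path.Homotopic.Quotient.mk hv'.loop) := by
  obtain ⟨η, hη⟩ := (isPathConnected_genericPoints h𝒜 F).joinedIn v hv.generic v' hv'.generic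
  let N : Set (V × ℂ) := {p | ∀ H ∈ 𝒜, ¬ Hᗮ ≤ F →
    Fᗮ.starProjection p.1 + p.2 • F.starProjection p.1 ∉ H}
  have hN : IsOpen N := by
    have hcont : Continuous fun p : V × ℂ =>
        Fᗮ.starProjection p.1 + p.2 • F.starProjection p.1 := by fun_prop
    have hfin : {H | H ∈ 𝒜 ∧ ¬ Hᗮ ≤ F}.Finite := h𝒜.finite.subset fun H h => h.1
    have : N = (fun p : V × ℂ => Fᗮ.starProjection p.1 + p.2 • F.starProjection p.1) ⁻¹'
        complement {H | H ∈ 𝒜 ∧ ¬ Hᗮ ≤ F} := by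
      ext p
      simp [N, complement]
    rw [this]
    exact (isOpen_complement hfin).preimage hcont
  -- Compactness of the path `η` gives one radius `δ` valid along all of it. Both loops are shrunk
  -- to this radius and then carried along `η`. Hyperplanes containing `Fᗮ` impose no bound on the
  -- radius.
  obtain ⟨u, w, -, hw, hu, hw0, huw⟩ := generalized_tube_lemma (isCompact_range η.continuous)
    (isCompact_singleton (x := (0 : ℂ))) hN (by
      rintro ⟨x, s⟩ ⟨⟨τ, rfl⟩, rfl⟩ H hH hHF
      simpa using (mem_genericPoints.mp (hη τ)).2 H hH hHF)
  obtain ⟨ε, hε, hball⟩ := Metric.isOpen_iff.mp hw 0 (hw0 rfl)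
  obtain ⟨δ, hδ, hδ1, hδε⟩ : ∃ δ : ℝ, 0 < δ ∧ δ ≤ 1 ∧ δ < ε :=
    ⟨min 1 (ε / 2), lt_min one_pos (half_pos hε), min_le_left _ _,
      (min_le_right _ _).trans_lt (half_lt_self hε)⟩
  have hn : ‖(δ : ℂ)‖ = δ := by rw [Complex.norm_real, Real.norm_of_nonneg hδ.le]
  have htube : ∀ τ, IsTubeVector 𝒜 F
      (Fᗮ.starProjection (η τ) + (δ : ℂ) • F.starProjection (η τ)) := by
    intro τ
    refine isTubeVector_add_smul (hη τ) (by exact_mod_cast hδ.ne') fun s hs0 hs H hH hmem => ?_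
    by_cases hHF : Hᗮ ≤ F
    · exact (mem_genericPoints.mp (add_smul_mem_genericPoints (hη τ) hs0)).1 H hH hHF hmem
    · have hsw : s ∈ w := hball (mem_ball_zero_iff.mpr ((hs.trans hn.le).trans_lt hδε))
      have hp : (η τ, s) ∈ N := huw (Set.mk_mem_prod (hu ⟨τ, rfl⟩) hsw)
      exact hp H hH hHF hmem
  have hmid : LoopConj (Path.Homotopic.Quotient.mk (hv.scale hδ hδ1).loop)
      (Path.Homotopic.Quotient.mk (hv'.scale hδ hδ1).loop) :=
    loopConj_of_path (hv.scale hδ hδ1) (hv'.scale hδ hδ1)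
      (fun τ => Fᗮ.starProjection (η τ) + (δ : ℂ) • F.starProjection (η τ)) (by fun_prop) htube
      (by rw [η.source]) (by rw [η.target])
  exact (hv.loopConj_scale hδ hδ1).trans (hmid.trans (hv'.loopConj_scale hδ hδ1).symm)

end IsTubeVector

/-- The loop around the centre of a transversal disc is freely homotopic to a standard loop. -/
theorem IsTransversalDisc.exists_loopConj {𝒜 : Set (Submodule ℂ V)}
    (h𝒜 : IsReflectionArrangement 𝒜) {F : Submodule ℂ V} (hF : F ∈ irreducibles 𝒜)
    {Φ : ℂ → HomCoord 𝒜} (hΦ : IsTransversalDisc 𝒜 (stratum 𝒜 F) Φ) {y : complement 𝒜}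
    {ℓ : Path y y} (hℓ : ∀ t : I, (ℓ t : V) = (Φ (circ t / 2)).1.1) :
    ∃ (v : V) (hv : IsTubeVector 𝒜 F v), LoopConj (Path.Homotopic.Quotient.mk ℓ)
      (Path.Homotopic.Quotient.mk hv.loop) := by
  set u := F.starProjection (deriv (fun s => (Φ s).1.1) 0) with hu
  have huF : u ∈ F := Submodule.starProjection_apply_mem _ _
  set v : ℂ → V := fun s => (Φ s).1.1 with hvdef
  set q : ℂ → V := fun s => Fᗮ.starProjection (v s) with hq
  set w : ℂ → V := fun s => F.starProjection (v s) with hw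
  set k : ℂ → V := dslope w 0 with hk
  have hvX : ∀ s ∈ ball (0 : ℂ) 1, s ≠ 0 → v s ∈ complement 𝒜 := fun s hs hs0 =>
    (toAmbient_mem_range_embed.mp (hΦ.punctured s hs hs0)).1
  have hvc : ContinuousOn v (ball 0 1) := hΦ.holomorphic_fst.continuousOn
  have hqc : ContinuousOn q (ball 0 1) :=
    (ContinuousLinearMap.continuous Fᗮ.starProjection).comp_continuousOn hvc
  have hwc : ContinuousOn w (ball 0 1) :=
    (ContinuousLinearMap.continuous F.starProjection).comp_continuousOn hvc
  have h0ball : ball (0 : ℂ) 1 ∈ 𝓝 (0 : ℂ) := ball_mem_nhds 0 one_pos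
  have hwd : HasDerivAt w u 0 :=
    F.starProjection.hasFDerivAt.comp_hasDerivAt 0 hΦ.differentiableAt_fst.hasDerivAt
  have hkc : ContinuousOn k (ball 0 1) :=
    (continuousOn_dslope h0ball).mpr ⟨hwc, hwd.differentiableAt⟩
  have hk0 : k 0 = u := by rw [hk, dslope_same, hwd.deriv]
  have hw0 : w 0 = 0 := (Submodule.starProjection_apply_eq_zero_iff _).mpr hΦ.center_fst_mem
  have hq0 : q 0 = v 0 := Submodule.starProjection_eq_self_iff.mpr hΦ.center_fst_mem
  have hwk : ∀ s, s • k s = w s := fun s => by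
    have := sub_smul_dslope w 0 s
    rwa [sub_zero, hw0, sub_zero] at this
  have hqF : ∀ s, q s ∈ Fᗮ := fun s => Submodule.starProjection_apply_mem _ _
  -- Since `w(s) = s k(s)` and `k(0) = u`, this two-parameter family is the disc `v(s)` for `z = (s,
  -- s)` and the linear disc `v(0) + s u` for `z = (0, s)`.
  have hev : ∀ᶠ z in 𝓝 ((0 : ℂ), (0 : ℂ)), z.2 ≠ 0 → q z.1 + z.2 • k z.1 ∈ complement 𝒜 := by
    have hqa : ContinuousAt (fun z : ℂ × ℂ => q z.1) (0, 0) :=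
      ContinuousAt.comp (f := Prod.fst) (hqc.continuousAt h0ball) continuousAt_fst
    have hka : ContinuousAt (fun z : ℂ × ℂ => k z.1) (0, 0) :=
      ContinuousAt.comp (f := Prod.fst) (hkc.continuousAt h0ball) continuousAt_fst
    have : ∀ᶠ z in 𝓝 ((0 : ℂ), (0 : ℂ)), ∀ H ∈ 𝒜, z.2 ≠ 0 → q z.1 + z.2 • k z.1 ∉ H := by
      refine (eventually_all_finite h𝒜.finite).mpr fun H hH => ?_
      have hopen : IsOpen (H : Set V)ᶜ := (Submodule.closed_of_finiteDimensional H).isOpen_compl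
      by_cases hHF : Hᗮ ≤ F
      · have hkH : (fun z : ℂ × ℂ => k z.1) (0, 0) ∈ (H : Set V)ᶜ := by
          change k 0 ∉ H
          rw [hk0]
          exact hΦ.starProjection_deriv_notMem h𝒜 hF hH hHF
        filter_upwards [hka.eventually_mem (hopen.mem_nhds hkH)] with z hz hz0 hmem
        rw [H.add_mem_iff_right (orthogonal_le_of_orthogonal_le hHF (hqF _)),
          H.smul_mem_iff hz0] at hmem
        exact hz hmem
      · have hc : ContinuousAt (fun z : ℂ × ℂ => q z.1 + z.2 • k z.1) (0, 0) :=
          hqa.add (continuousAt_snd.smul hka)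
        refine (hc.eventually_mem (hopen.mem_nhds ?_)).mono fun z hz _ => hz
        change q 0 + (0 : ℂ) • k 0 ∉ H
        rw [zero_smul, add_zero, hq0]
        exact hΦ.center_fst_notMem h𝒜 hH hHF
    exact this.mono fun z hz hz0 H hH => hz H hH hz0
  obtain ⟨ε, hε, hball⟩ := Metric.eventually_nhds_iff_ball.mp hev
  set r : ℝ := min (1 / 2) (ε / 2) with hr
  have hr0 : 0 < r := lt_min (by norm_num) (half_pos hε)
  have hr2 : r ≤ 1 / 2 := min_le_left _ _
  have hrε : r < ε := (min_le_right _ _).trans_lt (half_lt_self hε)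
  have hrn : ‖(r : ℂ)‖ = r := by rw [Complex.norm_real, Real.norm_of_nonneg hr0.le]
  have hrc0 : (r : ℂ) ≠ 0 := by exact_mod_cast hr0.ne'
  have hX : ∀ z₁ z₂ : ℂ, ‖z₁‖ ≤ r → ‖z₂‖ ≤ r → z₂ ≠ 0 → q z₁ + z₂ • k z₁ ∈ complement 𝒜 := by
    intro z₁ z₂ h1 h2 h0
    refine hball (z₁, z₂) ?_ h0
    rw [mem_ball, Prod.dist_eq, dist_zero_right, dist_zero_right]
    exact max_lt (h1.trans_lt hrε) (h2.trans_lt hrε)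
  have hscale : ∀ (a : ℝ) (t : I), 0 ≤ a → ‖(a : ℂ) * circ t‖ = a := fun a t ha => by
    rw [norm_mul, norm_circ, mul_one, Complex.norm_real, Real.norm_of_nonneg ha]
  have hvr : v r ∈ complement 𝒜 := hvX _ (mem_ball_zero_iff.mpr (by rw [hrn]; linarith)) hrc0
  have hcirc : ∀ a : ℝ, 0 < a → a ≤ 1 / 2 → ∀ t : I, v (a * circ t) ∈ complement 𝒜 :=
    fun a ha ha2 t => hvX _ (mem_ball_zero_iff.mpr (by rw [hscale a t ha.le]; linarith))
      (mul_ne_zero (by exact_mod_cast ha.ne') (circ_ne_zero t))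
  let ℓ₁ : Path (⟨v r, hvr⟩ : complement 𝒜) ⟨v r, hvr⟩ :=
    { toFun := fun t => ⟨v (r * circ t), hcirc r hr0 hr2 t⟩
      continuous_toFun := by
        refine Continuous.subtype_mk (hvc.comp_continuous (by fun_prop) fun t => ?_) _
        rw [mem_ball_zero_iff, hscale r t hr0.le]; linarith
      source' := Subtype.ext (by simp)
      target' := Subtype.ext (by simp) }
  have htubeq : Fᗮ.starProjection (q 0 + u) = q 0 := orthogonal_starProjection_add_smul F (hqF 0) huF
  have htubew : F.starProjection (q 0 + u) = u := starProjection_add_smul F (hqF 0) huF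
  have hgen : q 0 + u ∈ genericPoints 𝒜 F := by
    refine mem_genericPoints.mpr ⟨fun H hH hHF hmem => ?_, fun H hH hHF => ?_⟩
    · rw [H.add_mem_iff_right (orthogonal_le_of_orthogonal_le hHF (hqF _))] at hmem
      exact hΦ.starProjection_deriv_notMem h𝒜 hF hH hHF hmem
    · rw [htubeq, hq0]
      exact hΦ.center_fst_notMem h𝒜 hH hHF
  have htube := isTubeVector_add_smul hgen hrc0 (fun s hs0 hs => by
    rw [htubeq, htubew]
    have := hX 0 s (by simpa using hr0.le) (hs.trans hrn.le) hs0
    rwa [hk0] at this)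
  refine ⟨_, htube, LoopConj.trans (b := Path.Homotopic.Quotient.mk ℓ₁) ?_ ?_⟩
  -- First deformation: the radius of the circle in the disc decreases from `1 / 2` to `r`.
  · have hρ : ∀ s : I, 0 < 1 / 2 - (s : ℝ) * (1 / 2 - r) ∧ 1 / 2 - (s : ℝ) * (1 / 2 - r) ≤ 1 / 2 :=
      fun s => ⟨by nlinarith [s.2.1, s.2.2], by nlinarith [s.2.1, s.2.2]⟩
    refine loopConj_of_freeHomotopy
      (fun p : I × I => v (((1 / 2 - (p.1 : ℝ) * (1 / 2 - r) : ℝ) : ℂ) * circ p.2)) ?_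
      (fun p => hcirc _ (hρ p.1).1 (hρ p.1).2 p.2) (fun t => ?_) (fun t => ?_) fun s => by simp
    · refine hvc.comp_continuous (by fun_prop) fun p => ?_
      rw [mem_ball_zero_iff, hscale _ p.2 (hρ p.1).1.le]
      linarith [(hρ p.1).2]
    · rw [hℓ]
      simp only [Set.Icc.coe_zero, zero_mul, sub_zero]
      change v _ = v _
      congr 1
      push_cast
      ring
    · change v _ = v _
      congr 2
      simp
  -- Second deformation: the first parameter contracts to `0` while the second keeps running around
  -- the circle of radius `r`.
  · have hσ : ∀ p : I × I, ‖((((1 - (p.1 : ℝ)) * r : ℝ) : ℂ) * circ p.2)‖ ≤ r := fun p => by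
      rw [hscale _ _ (mul_nonneg (by linarith [p.1.2.2]) hr0.le)]
      exact mul_le_of_le_one_left hr0.le (by linarith [p.1.2.1])
    have hmemball : ∀ p : I × I, (((1 - (p.1 : ℝ)) * r : ℝ) : ℂ) * circ p.2 ∈ ball (0 : ℂ) 1 :=
      fun p => mem_ball_zero_iff.mpr ((hσ p).trans_lt (by linarith))
    refine loopConj_of_freeHomotopy (fun p : I × I =>
      q ((((1 - (p.1 : ℝ)) * r : ℝ) : ℂ) * circ p.2) +
        ((r : ℂ) * circ p.2) • k ((((1 - (p.1 : ℝ)) * r : ℝ) : ℂ) * circ p.2)) ?_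
      (fun p => hX _ _ (hσ p) (hscale r p.2 hr0.le).le
        (mul_ne_zero hrc0 (circ_ne_zero _))) (fun t => ?_) (fun t => ?_) fun s => by simp
    · exact (hqc.comp_continuous (by fun_prop) hmemball).add
        ((by fun_prop : Continuous fun p : I × I => (r : ℂ) * circ p.2).smul
          (hkc.comp_continuous (by fun_prop) hmemball))
    · change _ = v (r * circ t)
      simp only [Set.Icc.coe_zero, sub_zero, one_mul]
      rw [hwk, add_comm]
      exact add_starProjection F _
    · rw [IsTubeVector.loop_apply, htubeq, htubew,
        orthogonal_starProjection_add_smul F (hqF 0) (F.smul_mem _ huF),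
        starProjection_add_smul F (hqF 0) (F.smul_mem _ huF)]
      simp only [Set.Icc.coe_one, sub_self, zero_mul, Complex.ofReal_zero]
      rw [hk0, smul_smul, mul_comm]

/-- The inertia class around the divisor of `F` is the conjugacy class of a standard loop. -/
theorem inertiaClass_eq_conjugatesOf {𝒜 : Set (Submodule ℂ V)} (h𝒜 : IsReflectionArrangement 𝒜)
    {F : Submodule ℂ V} (hF : F ∈ irreducibles 𝒜) {v : V} (hv : IsTubeVector 𝒜 F v) :
    inertiaClass 𝒜 F ⟨v, hv.mem_complement⟩ =
      conjugatesOf (FundamentalGroup.fromPath (Path.Homotopic.Quotient.mk hv.loop)) := by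
  ext g
  change g ∈ inertiaClass 𝒜 F _ ↔ IsConj _ g
  constructor
  · rintro ⟨Z, hZ, Φ, hΦ, y, γ, ℓ, hℓ, rfl⟩
    obtain rfl := (isDivisorOf_iff h𝒜 hF).mp hZ
    obtain ⟨v', hv', hconj⟩ := hΦ.exists_loopConj h𝒜 hF hℓ
    refine loopConj_iff_isConj.mp (LoopConj.trans ?_ (hconj.trans (hv'.loopConj h𝒜 hv)))
    rw [Path.Homotopic.Quotient.mk_trans, Path.Homotopic.Quotient.mk_trans,
      Path.Homotopic.Quotient.mk_symm]
    exact LoopConj.conj _ _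
  · intro hg
    have h1 : LoopConj (FundamentalGroup.toPath g) (Path.Homotopic.Quotient.mk hv.loop) :=
      loopConj_iff_isConj.mpr hg
    obtain ⟨Φ, hΦ, hΦv⟩ := exists_isTransversalDisc h𝒜 hF hv.generic
      fun s hs0 hs => hv.mem s hs0 hs.le
    have hhalf : (0 : ℝ) < 1 / 2 := by norm_num
    have hhalf1 : (1 / 2 : ℝ) ≤ 1 := by norm_num
    -- Inertia elements use the circle `|s| = 1/2`, which in the linear disc of `v` is the standard
    -- loop of the vector scaled by `1 / 2`.
    obtain ⟨p, hp⟩ := h1.trans (hv.loopConj_scale hhalf hhalf1)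
    obtain ⟨γ, rfl⟩ := Path.Homotopic.Quotient.mk_surjective p
    refine ⟨_, (isDivisorOf_iff h𝒜 hF).mpr rfl, Φ, hΦ, _, γ, (hv.scale hhalf hhalf1).loop,
      fun t => ?_, ?_⟩
    · have hq : Fᗮ.starProjection v ∈ Fᗮ := Submodule.starProjection_apply_mem _ _
      have hw : F.starProjection v ∈ F := Submodule.starProjection_apply_mem _ _
      change _ = (Φ (circ t / 2)).1.1
      rw [hΦv, IsTubeVector.loop_apply, orthogonal_starProjection_add_smul F hq (F.smul_mem _ hw),
        starProjection_add_smul F hq (F.smul_mem _ hw), smul_smul]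
      · congr 2
        push_cast
        ring
      · rw [mem_ball_zero_iff, norm_div, norm_circ]
        norm_num
    · rw [Path.Homotopic.Quotient.mk_trans, Path.Homotopic.Quotient.mk_trans,
        Path.Homotopic.Quotient.mk_symm]
      exact LoopConj.eq_conj _ hp

end Loops

/-! ### The arrangements of `W` and of its parabolic subgroups -/

section Arrangements

variable {V : Type*} [NormedAddCommGroup V] [InnerProductSpace ℂ V] [FiniteDimensional ℂ V]

omit [FiniteDimensional ℂ V] in
theorem fixedSpace_conj (s r : V ≃ₗᵢ[ℂ] V) :
    fixedSpace (s * r * s⁻¹) = (fixedSpace r).map (s.toLinearEquiv : V →ₗ[ℂ] V) := by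
  ext v
  constructor
  · intro h
    have h' : s (r (s.symm v)) = v := h
    refine ⟨s.symm v, ?_, s.apply_symm_apply v⟩
    change r (s.symm v) = s.symm v
    rw [LinearIsometryEquiv.eq_symm_apply, h']
  · rintro ⟨w, hw, rfl⟩
    have hw' : r w = w := hw
    change s (r (s.symm (s w))) = s w
    rw [s.symm_apply_apply, hw']

-- A reflection `s` of the group maps the hyperplane of `r` to that of the conjugate reflection `s r
-- s⁻¹`.
omit [FiniteDimensional ℂ V] in
theorem isReflectionArrangement_arrangement {G : Subgroup (V ≃ₗᵢ[ℂ] V)}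
    (h : (arrangement G).Finite) : IsReflectionArrangement (arrangement G) := by
  refine ⟨h, ?_⟩
  rintro _ ⟨s, hs, hr, rfl⟩
  refine ⟨s, hr, rfl, ?_⟩
  rintro _ ⟨r, hrG, hrr, rfl⟩
  refine ⟨s * r * s⁻¹, G.mul_mem (G.mul_mem hs hrG) (G.inv_mem hs), ?_, (fixedSpace_conj s r).symm⟩
  unfold IsReflection at *
  rw [fixedSpace_conj]
  have : Module.finrank ℂ ((fixedSpace r).map (s.toLinearEquiv : V →ₗ[ℂ] V)) =
      Module.finrank ℂ (fixedSpace r) := LinearEquiv.finrank_map_eq s.toLinearEquiv _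
  rw [this]
  exact hrr

omit [FiniteDimensional ℂ V] in
theorem arrangement_finite {W : Subgroup (V ≃ₗᵢ[ℂ] V)} (h : Finite W) :
    (arrangement W).Finite := by
  have hW : (W : Set (V ≃ₗᵢ[ℂ] V)).Finite := h
  refine (hW.image fixedSpace).subset ?_
  rintro _ ⟨s, hs, -, rfl⟩
  exact ⟨s, hs, rfl⟩

/-- The reflecting hyperplanes of `W_A` are the traces on `A` of those of `W` that contain `Aᗮ`. -/
theorem mem_arrangement_parabolicOn {W : Subgroup (V ≃ₗᵢ[ℂ] V)} {A : Submodule ℂ V}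
    {K : Submodule ℂ A} : K ∈ arrangement (parabolicOn W A) ↔
      ∃ H ∈ arrangement W, Hᗮ ≤ A ∧ K = H.comap A.subtype := by
  constructor
  · rintro ⟨g, ⟨w, hw, hgw⟩, hg, rfl⟩
    have hA : Aᗮ ≤ fixedSpace w := fun v hv => hw.2 v hv
    have hfix : fixedSpace g = (fixedSpace w).comap A.subtype := by
      ext a
      change g a = a ↔ w (a : V) = a
      rw [Subtype.ext_iff, hgw]
    refine ⟨fixedSpace w, ⟨w, hw.1, ?_, rfl⟩, orthogonal_le_comm.mpr hA, hfix⟩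
    unfold IsReflection at *
    have h1 : A ⊔ fixedSpace w = ⊤ := by
      refine top_le_iff.mp ?_
      rw [← Submodule.sup_orthogonal_of_hasOrthogonalProjection (K := A)]
      exact sup_le_sup_left hA A
    have h2 := Submodule.finrank_sup_add_finrank_inf_eq A (fixedSpace w)
    rw [h1, finrank_top] at h2
    have h3 : Module.finrank ℂ ((fixedSpace w).comap A.subtype)
        = Module.finrank ℂ (A ⊓ fixedSpace w : Submodule ℂ V) := by
      rw [← Submodule.map_comap_subtype A (fixedSpace w)]
      exact (LinearEquiv.finrank_eq
        (Submodule.equivMapOfInjective A.subtype A.injective_subtype _))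
    rw [hfix] at hg
    omega
  · rintro ⟨_, ⟨s, hs, hr, rfl⟩, hA, rfl⟩
    obtain ⟨g, hg, hgr, hgf⟩ := exists_restriction hs hr (orthogonal_le_comm.mp hA)
    exact ⟨g, hg, hgr, hgf.symm⟩

theorem arrangement_parabolicOn_finite {W : Subgroup (V ≃ₗᵢ[ℂ] V)} (h : Finite W)
    (A : Submodule ℂ V) : (arrangement (parabolicOn W A)).Finite := by
  refine ((arrangement_finite h).image fun H => H.comap A.subtype).subset ?_
  intro K hK
  obtain ⟨H, hH, -, rfl⟩ := mem_arrangement_parabolicOn.mp hK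
  exact ⟨H, hH, rfl⟩

/-- Orthogonality inside `A` agrees with orthogonality in `V` here, because `H` contains `Aᗮ`. This
identifies sums of dual lines for `W_A` with those for `W` inside `A`, so decompositions transfer.
-/
theorem map_orthogonal_comap_subtype {A H : Submodule ℂ V} (hA : Hᗮ ≤ A) :
    ((H.comap A.subtype)ᗮ).map A.subtype = Hᗮ := by
  ext v
  constructor
  · rintro ⟨a, ha, rfl⟩
    rw [Submodule.mem_orthogonal]
    intro h hh
    have h2 : Aᗮ.starProjection h ∈ Aᗮ := Submodule.starProjection_apply_mem _ _
    have h1 : A.starProjection h ∈ H := by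
      have : A.starProjection h = h - Aᗮ.starProjection h := by
        rw [eq_sub_iff_add_eq]
        exact add_starProjection A h
      rw [this]
      exact H.sub_mem hh (orthogonal_le_comm.mp hA h2)
    rw [← add_starProjection A h, inner_add_left]
    change inner ℂ (A.starProjection h) (a : V) + inner ℂ (Aᗮ.starProjection h) (a : V) = 0
    rw [Submodule.inner_left_of_mem_orthogonal a.2 h2, add_zero]
    exact ha ⟨A.starProjection h, Submodule.starProjection_apply_mem _ _⟩ h1
  · intro hv
    exact ⟨⟨v, hA hv⟩, fun a ha => hv a ha, rfl⟩

theorem map_mem_sumClosure {W : Subgroup (V ≃ₗᵢ[ℂ] V)} {A : Submodule ℂ V} {U : Submodule ℂ A}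
    (hU : U ∈ sumClosure (arrangement (parabolicOn W A))) :
    U.map A.subtype ∈ sumClosure (arrangement W) := by
  obtain ⟨S, hS, rfl⟩ := hU
  refine ⟨{H | H ∈ arrangement W ∧ Hᗮ ≤ A ∧ H.comap A.subtype ∈ S}, fun H h => h.1, ?_⟩
  simp_rw [Submodule.map_iSup]
  refine le_antisymm (iSup₂_le fun K hK => ?_) (iSup₂_le fun H hH => ?_)
  · obtain ⟨H, hH, hHA, rfl⟩ := mem_arrangement_parabolicOn.mp (hS hK)
    rw [map_orthogonal_comap_subtype hHA]
    exact le_iSup₂_of_le (f := fun (H : Submodule ℂ V)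
      (_ : H ∈ {H | H ∈ arrangement W ∧ Hᗮ ≤ A ∧ H.comap A.subtype ∈ S}) => Hᗮ) H ⟨hH, hHA, hK⟩ le_rfl
  · rw [← map_orthogonal_comap_subtype hH.2.1]
    exact le_iSup₂_of_le (f := fun (K : Submodule ℂ A) (_ : K ∈ S) => Kᗮ.map A.subtype) _ hH.2.2
      le_rfl

theorem comap_mem_sumClosure {W : Subgroup (V ≃ₗᵢ[ℂ] V)} {A B : Submodule ℂ V}
    (hB : B ∈ sumClosure (arrangement W)) (hBA : B ≤ A) :
    B.comap A.subtype ∈ sumClosure (arrangement (parabolicOn W A)) := by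
  obtain ⟨S, hS, rfl⟩ := hB
  have hSA : ∀ H ∈ S, Hᗮ ≤ A := fun H hH =>
    (le_iSup₂_of_le (f := fun K (_ : K ∈ S) => Kᗮ) H hH le_rfl).trans hBA
  refine ⟨(fun H => H.comap A.subtype) '' S, ?_, ?_⟩
  · rintro _ ⟨H, hH, rfl⟩
    exact mem_arrangement_parabolicOn.mpr ⟨H, hS hH, hSA H hH, rfl⟩
  · apply Submodule.map_injective_of_injective A.injective_subtype
    rw [Submodule.map_comap_subtype, inf_eq_right.mpr hBA, iSup_image]
    simp_rw [Submodule.map_iSup]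
    exact iSup_congr fun H => iSup_congr fun hH => (map_orthogonal_comap_subtype (hSA H hH)).symm

/-- The whole space `A` is irreducible for the arrangement of `W_A`. -/
theorem top_mem_irreducibles {W : Subgroup (V ≃ₗᵢ[ℂ] V)} {A : Submodule ℂ V}
    (hA : A ∈ irreducibles (arrangement W)) :
    (⊤ : Submodule ℂ A) ∈ irreducibles (arrangement (parabolicOn W A)) := by
  have hinj := A.injective_subtype
  refine ⟨?_, ?_, fun k u hu => hA.2.2 k (fun i => (u i).map A.subtype) ?_⟩
  · have := comap_mem_sumClosure hA.1 le_rfl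
    rwa [Submodule.comap_subtype_self] at this
  · intro h
    have := congrArg (Submodule.map A.subtype) h
    rw [Submodule.map_subtype_top, Submodule.map_bot] at this
    exact hA.2.1 this
  have hinf : ∀ B ≤ A, ∀ i, B ⊓ (u i).map A.subtype =
      (B.comap A.subtype ⊓ u i).map A.subtype := by
    intro B hB i
    rw [Submodule.map_inf _ hinj, Submodule.map_comap_subtype, inf_eq_right.mpr hB]
  refine ⟨hu.one_lt, fun i => map_mem_sumClosure (hu.mem i), fun i h => hu.ne_bot i ?_,
    fun i => ?_, ?_, fun B hB hBA i => ?_, fun B hB hBA => ?_⟩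
  · apply Submodule.map_injective_of_injective hinj
    rw [h, Submodule.map_bot]
  · simp_rw [← Submodule.map_iSup]
    exact Submodule.disjoint_map hinj (hu.indep i)
  · rw [← Submodule.map_iSup, hu.iSup_eq, Submodule.map_subtype_top]
  · rw [hinf B hBA]
    exact map_mem_sumClosure (hu.inf_mem _ (comap_mem_sumClosure hB hBA) le_top i)
  · simp_rw [hinf B hBA]
    rw [← Submodule.map_iSup, hu.iSup_inf_eq _ (comap_mem_sumClosure hB hBA) le_top,
      Submodule.map_comap_subtype, inf_eq_right.mpr hBA]

omit [FiniteDimensional ℂ V] in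
theorem smul_mem_complement {𝒜 : Set (Submodule ℂ V)} {v : V} (hv : v ∈ complement 𝒜) {c : ℂ}
    (hc : c ≠ 0) : c • v ∈ complement 𝒜 :=
  fun H hH hmem => hv H hH ((H.smul_mem_iff hc).mp hmem)

omit [FiniteDimensional ℂ V] in
theorem starProjection_top_apply (v : V) : (⊤ : Submodule ℂ V).starProjection v = v :=
  Submodule.starProjection_eq_self_iff.mpr trivial

theorem starProjection_top_orthogonal_apply (v : V) :
    (⊤ : Submodule ℂ V)ᗮ.starProjection v = 0 := by
  have := add_starProjection ⊤ v
  rwa [starProjection_top_apply, add_eq_left] at this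

theorem isTubeVector_top {𝒜 : Set (Submodule ℂ V)} {v : V} (hv : v ∈ complement 𝒜) :
    IsTubeVector 𝒜 ⊤ v := by
  refine ⟨mem_genericPoints.mpr ⟨fun H hH _ => hv H hH, fun H _ h => (h le_top).elim⟩,
    fun s hs0 _ => ?_⟩
  rw [starProjection_top_apply, starProjection_top_orthogonal_apply, zero_add]
  exact smul_mem_complement hv hs0

theorem IsTubeVector.loop_top_apply {𝒜 : Set (Submodule ℂ V)} {v : V} (hv : IsTubeVector 𝒜 ⊤ v)
    (t : I) : (hv.loop t : V) = circ t • v := by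
  rw [loop_apply, starProjection_top_apply, starProjection_top_orthogonal_apply, zero_add]

/-- The class of the loop `t ↦ exp(2πit) v` is central. -/
theorem IsTubeVector.conjugatesOf_loop_top {𝒜 : Set (Submodule ℂ V)} {v : V}
    (hv : IsTubeVector 𝒜 ⊤ v) :
    conjugatesOf (FundamentalGroup.fromPath (Path.Homotopic.Quotient.mk hv.loop)) =
      {FundamentalGroup.fromPath (Path.Homotopic.Quotient.mk hv.loop)} := by
  refine Set.eq_singleton_iff_unique_mem.mpr ⟨mem_conjugatesOf_self, fun g hg => ?_⟩
  obtain ⟨p, hp⟩ := loopConj_iff_isConj.mpr hg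
  obtain ⟨γ, rfl⟩ := Path.Homotopic.Quotient.mk_surjective p
  -- Multiplying the loop `γ` by the unit circle gives a torus, whose square shows that the two
  -- loops commute.
  have hcomm := trans_eq_trans_of_freeHomotopy hv.loop hv.loop γ
    ⟨fun p => ⟨circ p.2 • (γ p.1 : V), smul_mem_complement (γ p.1).2 (circ_ne_zero _)⟩,
      by fun_prop⟩
    (fun t => Subtype.ext (by rw [hv.loop_top_apply]; simp))
    (fun t => Subtype.ext (by rw [hv.loop_top_apply]; simp))
    (fun s => Subtype.ext (by simp)) (fun s => Subtype.ext (by simp))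
  have h1 := LoopConj.eq_conj _ hp
  have h2 := LoopConj.eq_conj _ hcomm
  exact h1.trans h2.symm

end Arrangements

/-! ### The local inclusion on fundamental groups -/

section LocalInclusion

variable {V : Type*} [NormedAddCommGroup V] [InnerProductSpace ℂ V] [FiniteDimensional ℂ V]
  {W : Subgroup (V ≃ₗᵢ[ℂ] V)} {A : Submodule ℂ V} {x : V} {ε : ℝ}

/-- The factor by which the local inclusion rescales the vector `a`. -/
noncomputable def radius (ε : ℝ) (a : A) : ℝ := ε / Real.sqrt (1 + ‖a‖ ^ 2)

omit [FiniteDimensional ℂ V] in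
theorem radius_pos (hε : 0 < ε) (a : A) : 0 < radius ε a :=
  div_pos hε (Real.sqrt_pos.mpr (by positivity))

omit [FiniteDimensional ℂ V] in
theorem continuous_radius (ε : ℝ) : Continuous (radius ε : A → ℝ) :=
  continuous_const.div (by fun_prop) fun _ => (Real.sqrt_pos.mpr (by positivity)).ne'

omit [FiniteDimensional ℂ V] in
theorem radius_mul_norm_lt (hε : 0 < ε) (a : A) : radius ε a * ‖a‖ < ε := by
  have hq : 0 < Real.sqrt (1 + ‖a‖ ^ 2) := Real.sqrt_pos.mpr (by positivity)
  rw [radius, div_mul_eq_mul_div, div_lt_iff₀ hq]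
  exact mul_lt_mul_of_pos_left (Real.lt_sqrt_of_sq_lt (by linarith)) hε

theorem localInclusion_apply (hx : IsTubePoint W A x ε)
    (a : complement (arrangement (parabolicOn W A))) :
    (localInclusion hx a : V) = x + (radius ε (a : A) : ℂ) • ((a : A) : V) := rfl

/-- Hyperplanes containing `Aᗮ` are avoided because `a` avoids their traces on `A`, the others
because the whole disc stays in the ball of radius `ε` around `x`. -/
theorem isTubeVector_localInclusion (hx : IsTubePoint W A x ε)
    (a : complement (arrangement (parabolicOn W A))) :
    IsTubeVector (arrangement W) A (x + (radius ε (a : A) : ℂ) • ((a : A) : V)) := by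
  have hA : (radius ε (a : A) : ℂ) • ((a : A) : V) ∈ A := A.smul_mem _ (a : A).2
  have hr := radius_pos hx.pos (a : A)
  have key : ∀ s : ℂ, s ≠ 0 → ‖s‖ ≤ 1 →
      x + s • (radius ε (a : A) : ℂ) • ((a : A) : V) ∈ complement (arrangement W) := by
    intro s hs0 hs H hH hmem
    by_cases hHA : Hᗮ ≤ A
    · rw [H.add_mem_iff_right (orthogonal_le_of_orthogonal_le hHA hx.mem), H.smul_mem_iff hs0,
        H.smul_mem_iff (by exact_mod_cast hr.ne')] at hmem
      exact a.2 _ (mem_arrangement_parabolicOn.mpr ⟨H, hH, hHA, rfl⟩) hmem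
    · refine Set.disjoint_left.mp (hx.disjoint H hH fun h => hHA (orthogonal_le_comm.mpr h)) ?_ hmem
      rw [mem_ball, dist_eq_norm, add_sub_cancel_left, norm_smul, norm_smul, Complex.norm_real,
        Real.norm_of_nonneg hr.le, ← Submodule.coe_norm]
      exact (mul_le_of_le_one_left (by positivity) hs).trans_lt (radius_mul_norm_lt hx.pos _)
  refine ⟨mem_genericPoints.mpr ⟨fun H hH _ => ?_, fun H hH hHA => ?_⟩, fun s hs0 hs => ?_⟩
  · have := key 1 one_ne_zero (by simp) H hH
    rwa [one_smul] at this
  · rw [orthogonal_starProjection_add_smul A hx.mem hA]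
    exact Set.disjoint_left.mp (hx.disjoint H hH fun h => hHA (orthogonal_le_comm.mpr h))
      (mem_ball_self hx.pos)
  · rw [orthogonal_starProjection_add_smul A hx.mem hA, starProjection_add_smul A hx.mem hA]
    exact key s hs0 hs

/-- The rescaling factor depends only on `‖a‖`, hence is constant along `exp(2πit) a`; the two loops
agree pointwise. -/
theorem map_localInclusion_loop (hx : IsTubePoint W A x ε)
    (a : complement (arrangement (parabolicOn W A))) :
    FundamentalGroup.map (localInclusion hx) a
      (FundamentalGroup.fromPath (Path.Homotopic.Quotient.mk (isTubeVector_top a.2).loop)) =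
    FundamentalGroup.fromPath
      (Path.Homotopic.Quotient.mk (isTubeVector_localInclusion hx a).loop) := by
  change Path.Homotopic.Quotient.mk ((isTubeVector_top a.2).loop.map (localInclusion hx).continuous)
    = Path.Homotopic.Quotient.mk (isTubeVector_localInclusion hx a).loop
  refine congrArg _ (Path.ext (funext fun t => Subtype.ext ?_))
  have hA : (radius ε (a : A) : ℂ) • ((a : A) : V) ∈ A := A.smul_mem _ (a : A).2
  have hn : ‖circ t • (a : A)‖ = ‖(a : A)‖ := by rw [norm_smul, norm_circ, one_mul]
  have hr : radius ε (circ t • (a : A)) = radius ε (a : A) := by rw [radius, radius, hn]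
  have hl := IsTubeVector.loop_top_apply (isTubeVector_top a.2) t
  change (localInclusion hx ((isTubeVector_top a.2).loop t) : V) =
    Aᗮ.starProjection (x + (radius ε (a : A) : ℂ) • ((a : A) : V)) +
      circ t • A.starProjection (x + (radius ε (a : A) : ℂ) • ((a : A) : V))
  rw [orthogonal_starProjection_add_smul A hx.mem hA, starProjection_add_smul A hx.mem hA,
    localInclusion_apply, hl, hr, Submodule.coe_smul, smul_comm (circ t)]

/-- The orthogonal projection `X(W) → X(W_A)`. -/
noncomputable def projectionToParabolic (W : Subgroup (V ≃ₗᵢ[ℂ] V)) (A : Submodule ℂ V) :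
    C(complement (arrangement W), complement (arrangement (parabolicOn W A))) where
  toFun v := ⟨⟨A.starProjection (v : V), Submodule.starProjection_apply_mem _ _⟩, by
    intro K hK hmem
    obtain ⟨H, hH, hHA, rfl⟩ := mem_arrangement_parabolicOn.mp hK
    refine v.2 H hH ?_
    rw [← add_starProjection A (v : V)]
    exact H.add_mem hmem
      (orthogonal_le_of_orthogonal_le hHA (Submodule.starProjection_apply_mem _ _))⟩
  continuous_toFun := by
    refine Continuous.subtype_mk (Continuous.subtype_mk ?_ _) _
    exact (ContinuousLinearMap.continuous _).comp continuous_subtype_val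

theorem projectionToParabolic_localInclusion (hx : IsTubePoint W A x ε)
    (a : complement (arrangement (parabolicOn W A))) :
    (projectionToParabolic W A (localInclusion hx a) : A) = (radius ε (a : A) : ℂ) • (a : A) :=
  Subtype.ext (starProjection_add_smul A hx.mem (A.smul_mem _ (a : A).2))

/-- The projection to `A` undoes the inclusion up to a positive factor, so it recovers each loop
class up to conjugation by one fixed path `γ`. -/
theorem injective_map_localInclusion (hx : IsTubePoint W A x ε)
    (a₀ : complement (arrangement (parabolicOn W A))) :
    Function.Injective (FundamentalGroup.map (localInclusion hx) a₀) := by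
  -- Linear interpolation from `1` to the factor of the local inclusion; it stays positive, so the
  -- homotopy `ρ s a • a` remains in the complement.
  let ρ : I → complement (arrangement (parabolicOn W A)) → ℝ := fun s a =>
    (1 - (s : ℝ)) + s * radius ε (a : A)
  have hρ : ∀ s a, 0 < ρ s a := by
    intro s a
    have h1 := radius_pos hx.pos (a : A)
    have h2 : 0 ≤ (s : ℝ) * radius ε (a : A) := mul_nonneg s.2.1 h1.le
    rcases eq_or_lt_of_le s.2.2 with hs | hs
    · simp only [ρ, hs]; linarith
    · simp only [ρ]; linarith
  have hρc : Continuous fun p : I × complement (arrangement (parabolicOn W A)) => ρ p.1 p.2 := by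
    have := (continuous_radius (A := A) ε).comp (continuous_subtype_val.comp
      (continuous_snd (X := I) (Y := complement (arrangement (parabolicOn W A)))))
    exact (by fun_prop : Continuous fun p : I × complement (arrangement (parabolicOn W A)) =>
      1 - (p.1 : ℝ)).add ((by fun_prop : Continuous
        fun p : I × complement (arrangement (parabolicOn W A)) => (p.1 : ℝ)).mul this)
  let Sc : I × complement (arrangement (parabolicOn W A)) →
      complement (arrangement (parabolicOn W A)) := fun p =>
    ⟨(ρ p.1 p.2 : ℂ) • (p.2 : A), smul_mem_complement p.2.2 (by exact_mod_cast (hρ _ _).ne')⟩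
  have hSc : Continuous Sc := by
    refine Continuous.subtype_mk ?_ _
    exact (Complex.continuous_ofReal.comp hρc).smul (continuous_subtype_val.comp continuous_snd)
  have hS0 : ∀ a, Sc (0, a) = a := fun a => Subtype.ext (by simp [Sc, ρ])
  have hS1 : ∀ a, Sc (1, a) = projectionToParabolic W A (localInclusion hx a) := fun a =>
    Subtype.ext (by rw [projectionToParabolic_localInclusion]; simp [Sc, ρ])
  let γ : Path a₀ (projectionToParabolic W A (localInclusion hx a₀)) :=
    { toFun := fun s => Sc (s, a₀)
      continuous_toFun := by fun_prop
      source' := hS0 a₀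
      target' := hS1 a₀ }
  have key : ∀ ℓ : Path a₀ a₀, (Path.Homotopic.Quotient.mk γ).trans
      (((Path.Homotopic.Quotient.mk ℓ).map (localInclusion hx)).map (projectionToParabolic W A)) =
      (Path.Homotopic.Quotient.mk ℓ).trans (Path.Homotopic.Quotient.mk γ) := by
    intro ℓ
    rw [← Path.Homotopic.Quotient.mk_map, ← Path.Homotopic.Quotient.mk_map]
    refine trans_eq_trans_of_freeHomotopy ℓ _ γ ⟨fun p => Sc (p.1, ℓ p.2), by fun_prop⟩
      (fun t => hS0 _) (fun t => hS1 _) (fun s => ?_) (fun s => ?_)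
    · change Sc (s, ℓ 0) = Sc (s, a₀)
      rw [ℓ.source]
    · change Sc (s, ℓ 1) = Sc (s, a₀)
      rw [ℓ.target]
  intro α β h
  obtain ⟨ℓ, rfl⟩ := Path.Homotopic.Quotient.mk_surjective (FundamentalGroup.toPath α)
  obtain ⟨ℓ', rfl⟩ := Path.Homotopic.Quotient.mk_surjective (FundamentalGroup.toPath β)
  have h' : (Path.Homotopic.Quotient.mk ℓ).map (localInclusion hx) =
      (Path.Homotopic.Quotient.mk ℓ').map (localInclusion hx) := h
  have h1 := LoopConj.eq_conj _ (key ℓ)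
  have h2 := LoopConj.eq_conj _ (key ℓ')
  rw [h'] at h1
  exact h1.trans h2.symm

end LocalInclusion

end ReflArr

theorem mainTheorem3 {V : Type*} [NormedAddCommGroup V] [InnerProductSpace ℂ V]
    [FiniteDimensional ℂ V] (W : Subgroup (V ≃ₗᵢ[ℂ] V))
    (hW : ReflArr.IsIrreducibleReflectionGroup W) (A : Submodule ℂ V)
    (hA : A ∈ ReflArr.irreducibles (ReflArr.arrangement W)) (x : V) (ε : ℝ)
    (hx : ReflArr.IsTubePoint W A x ε)
    (a₀ : ReflArr.complement (ReflArr.arrangement (ReflArr.parabolicOn W A))) :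
    Function.Injective (FundamentalGroup.map (ReflArr.localInclusion hx) a₀) ∧
    ∃ z : FundamentalGroup
        (ReflArr.complement (ReflArr.arrangement (ReflArr.parabolicOn W A))) a₀,
      ReflArr.inertiaClass (ReflArr.arrangement (ReflArr.parabolicOn W A)) ⊤ a₀ = {z} ∧
      ReflArr.inertiaClass (ReflArr.arrangement W) A (ReflArr.localInclusion hx a₀) =
        conjugatesOf (FundamentalGroup.map (ReflArr.localInclusion hx) a₀ z) := by
  refine ⟨ReflArr.injective_map_localInclusion hx a₀, FundamentalGroup.fromPath
    (Path.Homotopic.Quotient.mk (ReflArr.isTubeVector_top a₀.2).loop), ?_, ?_⟩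
  · rw [← ReflArr.IsTubeVector.conjugatesOf_loop_top]
    exact ReflArr.inertiaClass_eq_conjugatesOf (ReflArr.isReflectionArrangement_arrangement
      (ReflArr.arrangement_parabolicOn_finite hW.finite A)) (ReflArr.top_mem_irreducibles hA)
      (ReflArr.isTubeVector_top a₀.2)
  · rw [ReflArr.map_localInclusion_loop]
    exact ReflArr.inertiaClass_eq_conjugatesOf (ReflArr.isReflectionArrangement_arrangement
      (ReflArr.arrangement_finite hW.finite)) hA (ReflArr.isTubeVector_localInclusion hx a₀)
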